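/- **Network.** Consider a slotted-time network on a finite directed graph with node set $\mathcal N$ and link set $\mathcal L$; commodities $c\in\mathcal N$ are destinations. In each slot node $n$ admits $R^{(c)}_n(t)\in[0,R_{max}]$ units of commodity $c$. The utilities $U^{(c)}_n$ are strictly increasing, continuously differentiable and strictly concave on $[0,\infty)$ with $U^{(c)}_n(0)=0$; $\beta=\max_{n,c}(U^{(c)}_n)'(0)$ and $U_{tot}(\boldsymbol r)=\sum_{n,c}U^{(c)}_n(r^{nc})$. When the channel state is $s$, the power vector $\boldsymbol P\ge 0$ is chosen from a non-empty compact set $\mathcal P^{(s)}$ which is closed under setting components to zero and on which every node spends at most $P_{max}$. Link $l$ then has rate $0\le\mu_l(s,\boldsymbol P)\le\mu_{max}$, where setting $P_l$ to zero lowers $\mu_l$ by at most $\delta P_l$ (for a fixed $\delta>0$) and does not lower any other rate. Node $n$ harvests $e_n(t)\in[0,h_n(t)]$, $h_n(t)\le h_{max}$. The channel state $S(t)$ and the energy state $\boldsymbol h(t)$ evolve independently as finite-state irreducible aperiodic Markov chains with stationary distributions $\pi$. The rates $\mu^{(c)}_l(t)\geq 0$ allocated to the commodities satisfy $\sum_c\mu^{(c)}_l(t)\le\mu_l(t)$.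 Data queues evolve by $Q^{(c)}_n(t+1)=[Q^{(c)}_n(t)-\sum_{l\text{ out of }n}\mu_l^{(c)}(t)]^++\sum_{l\text{ into }n}\mu^{(c)}_l(t)+R^{(c)}_n(t)$ for $n\ne c$, with $Q_c^{(c)}=0$. Energy queues evolve by $E_n(t+1)=E_n(t)-\sum_{l\text{ out of }n}P_l(t)+e_n(t)$, where $\sum_{l\text{ out of }n}P_l(t)\le E_n(t)$ is required. Let $U_{tot}(\boldsymbol r^*)$ be the supremum of $U_{tot}(\overline{\boldsymbol r})$, $\overline r^{nc}=\liminf_t\frac1t\sum_{\tau<t}\mathbb E R^{(c)}_n(\tau)$, over all non-anticipating policies that start with empty queues, satisfy these constraints, keep the energy queues bounded, and keep $\limsup_t\frac1t\sum_{\tau<t}\sum_{n,c}\mathbb E Q_n^{(c)}(\tau)$ finite. Let $\gamma=R_{max}+d_{max}\mu_{max}$ with $d_{max}$ the maximal in-degree. **ESA** with parameters $V,\boldsymbol\theta$: in each slot set $e_n=h_n$ if $E_n<\theta_n$ and $e_n=0$ otherwise; let $R^{(c)}_n$ maximize $VU^{(c)}_n(r)-Q^{(c)}_nr$ over $[0,R_{max}]$;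 with weights $W^{(c)}_{[n,b]}=[Q^{(c)}_n-Q^{(c)}_b-\gamma]^+$ let $\boldsymbol P\in\mathcal P^{(S(t))}$ maximize $\sum_l\mu_l(S(t),\boldsymbol P)\max_cW^{(c)}_l+\sum_n(E_n-\theta_n)\sum_{l\text{ out of }n}P_l$ subject to $\sum_{l\text{ out of }n}P_l\le E_n$ for all $n$; give the full rate of each link to one commodity of maximal weight on it if that weight is positive, and nothing otherwise. Ties are broken arbitrarily (non-anticipating). **MESA** with storage size $M=4[\log V]^2$. *Phase I:* run ESA on virtual queues $\hat{\boldsymbol Q},\hat{\boldsymbol E}$ up to time $T$ and put $\mathcal Q^{(c)}_n=[\hat Q^{(c)}_n(T)-\frac M2]^+$, $\mathcal E_n=[\hat E_n(T)-\frac M2]^+$. *Phase II:* reset time to $0$ (the environment continues), restart ESA on virtual queues from $\hat{\boldsymbol Q}(0)=\boldsymbol{\mathcal Q}$, $\hat{\boldsymbol E}(0)=\boldsymbol{\mathcal E}$, and use its actions for the actual queues, which start from $\boldsymbol Q(0)=\boldsymbol 0$, $\boldsymbol E(0)=\boldsymbol 0$. With $P_n=\sum_{l\text{ out of }n}P_l$,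 the level $E_n(t+1)$ is $\min\{[E_n-P_n]^++[e_n-(\mathcal E_n-\hat E_n)]^+,M\}$ if $\hat E_n<\mathcal E_n$, $\min\{E_n+e_n,M\}$ if $\hat E_n>\mathcal E_n+M$ (no power is spent), and $\min\{[E_n-P_n]^++e_n,M\}$ otherwise. Packets that a node $n$ should send are dropped unless $\hat E_n(t)\in[\mathcal E_n+P_{max},\mathcal E_n+M]$. With $A^{(c)}_n(t)$ the admitted data plus the data sent to $n$ and not dropped, $0\le Q^{(c)}_n(t+1)\le[Q^{(c)}_n(t)-\sum_{l\text{ out of }n}\mu_l^{(c)}(t)]^++\tilde A^{(c)}_n(t)$ for $n\neq c$ (and $Q_c^{(c)}=0$), where $\tilde A^{(c)}_n=[A^{(c)}_n-(\mathcal Q^{(c)}_n-\hat Q^{(c)}_n)]^+$ if $\hat Q^{(c)}_n<\mathcal Q^{(c)}_n$ and $\tilde A^{(c)}_n=A^{(c)}_n$ otherwise; the difference $A^{(c)}_n-\tilde A^{(c)}_n$ is dropped, too. **Assumptions.** For $\boldsymbol\upsilon=(\upsilon_n^{(c)})\succeq 0$ with $\upsilon_c^{(c)}=0$ and $\boldsymbol\nu\in\mathbb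 R^{\mathcal N}$ let $g_V(\boldsymbol\upsilon,\boldsymbol\nu)$ be the $\pi$-average over $(s,\boldsymbol h)$ of the supremum, over one-slot decisions ($0\le r^{nc}\le R_{max}$, $\boldsymbol P\in\mathcal P^{(s)}$, $0\le\mu_l^{(c)}$, $\sum_c\mu^{(c)}_l\le\mu_l(s,\boldsymbol P)$, $0\le e_n\le h_n$), of $V U_{tot}(\boldsymbol r)-\sum_{n,c}\upsilon^{(c)}_n\big[r^{nc}+\sum_{l\text{ into }n}\mu^{(c)}_l-\sum_{l\text{ out of }n}\mu^{(c)}_l\big]-\sum_n\nu_n\big[\sum_{l\text{ out of }n}P_l-e_n\big]$. Assume that for every $V\ge1$ the function $g_V$ has a unique minimizer $\boldsymbol y^*_V=(\boldsymbol\upsilon^*,\boldsymbol\nu^*)$ and that $g_V(\boldsymbol y)\ge g_V(\boldsymbol y^*_V)+L\|\boldsymbol y^*_V-\boldsymbol y\|$ for all such $\boldsymbol y=(\boldsymbol\upsilon,\boldsymbol\nu)$, with a constant $L>0$ independent of $V$. **Theorem.** Under these assumptions there are constants $C>0$ and $V_0\ge1$, depending only on the network and $L$, such that the following holds for all $V\ge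 V_0$, all $\boldsymbol\theta$ with $\theta_n\ge\delta\beta V+P_{max}$ and $\theta_n-\nu^*_n>0$ for all $n$, all $T$, and every run of MESA whose Phase I starts from empty queues, or from any queues with $0\le\hat Q_n^{(c)}\le\beta V+R_{max}$, $\hat Q^{(c)}_c=0$, $0\le\hat E_n\le\theta_n+h_{max}$, and is in steady state at time $T$ (if ESA runs on, the distribution of the queues at every $t\ge T$ is the one at $T$). The storage levels satisfy $0\le E_n(t)\le M$, and a node that is not dropping its packets never spends more than $E_n(t)$. Moreover, with probability at least $1-C/V^4$ over the history up to time $T$, the conditional expectations given this history satisfy $$\overline{\boldsymbol Q}=\limsup_{t\to\infty}\frac1t\sum_{\tau<t}\sum_{n,c}\mathbb E[Q^{(c)}_n(\tau)]\le C[\log V]^2,\qquad U_{tot}(\overline{\boldsymbol r})\ge U_{tot}(\boldsymbol r^*)-\frac CV,$$ where $\overline r^{nc}=\liminf_t\frac1t\sum_{\tau<t}\mathbb E[R^{(c)}_n(\tau)]$ are the admission rates in Phase II, and the long-run average ($\limsup$) expected amount of data dropped per slot is at most $C/V$. -/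

import Mathlib

open MeasureTheory Filter Topology Set

noncomputable section

/-- The transition matrix of a finite Markov chain that is irreducible and aperiodic. -/
structure IsIrredAperiodic {X : Type*} [Fintype X] [DecidableEq X] (p : Matrix X X ℝ) : Prop where
  nonneg : ∀ i j, 0 ≤ p i j
  row_sum : ∀ i, ∑ j, p i j = 1
  irreducible : ∀ i j, ∃ k : ℕ, 0 < (p ^ k) i j
  aperiodic : ∀ i, ∀ d : ℕ, (∀ k : ℕ, 0 < k → 0 < (p ^ k) i i → d ∣ k) → d = 1

/-- `w` is a stationary distribution of the transition matrix `p`. -/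
structure IsStationaryDist {X : Type*} [Fintype X] (p : Matrix X X ℝ) (w : X → ℝ) : Prop where
  nonneg : ∀ i, 0 ≤ w i
  sum_one : ∑ i, w i = 1
  stationary : ∀ j, ∑ i, w i * p i j = w j

/-- An energy harvesting network: a directed graph with node set `Node` and link set `Link`,
channel states `Ch`, energy states `En`. Commodities are the destination nodes. -/
structure EHNetwork (Node Link Ch En : Type*) [Fintype Node] [DecidableEq Node] [Fintype Link]
    [DecidableEq Link] [Fintype Ch] [DecidableEq Ch] [Fintype En] [DecidableEq En] where
  /-- start and end node of a link; the graph has no parallel links -/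
  src : Link → Node
  dst : Link → Node
  link_inj : Function.Injective fun l => (src l, dst l)
  /-- largest admissible amount of new data per slot, node and commodity -/
  Rmax : ℝ
  Rmax_nonneg : 0 ≤ Rmax
  /-- utility `U n c` of the commodity `c` data admitted at node `n` -/
  U : Node → Node → ℝ → ℝ
  U_contDiff : ∀ n c, ContDiffOn ℝ 1 (U n c) (Ici 0)
  U_strictMono : ∀ n c, StrictMonoOn (U n c) (Ici 0)
  U_strictConcave : ∀ n c, StrictConcaveOn ℝ (Ici 0) (U n c)
  U_zero : ∀ n c, U n c 0 = 0
  /-- feasible power vectors in each channel state -/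
  PowSet : Ch → Set (Link → ℝ)
  Pmax : ℝ
  PowSet_nonempty : ∀ s, (PowSet s).Nonempty
  PowSet_compact : ∀ s, IsCompact (PowSet s)
  pow_nonneg : ∀ s, ∀ P ∈ PowSet s, ∀ l, 0 ≤ P l
  pow_le : ∀ s, ∀ P ∈ PowSet s, ∀ n, ∑ l with src l = n, P l ≤ Pmax
  pow_update : ∀ s, ∀ P ∈ PowSet s, ∀ l, Function.update P l 0 ∈ PowSet s
  /-- rate-power function: rate of a link in a channel state under a power vector -/
  mu : Ch → (Link → ℝ) → Link → ℝ
  muMax : ℝ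
  mu_nonneg : ∀ s, ∀ P ∈ PowSet s, ∀ l, 0 ≤ mu s P l
  mu_le : ∀ s, ∀ P ∈ PowSet s, ∀ l, mu s P l ≤ muMax
  δ : ℝ
  δ_pos : 0 < δ
  mu_property1 : ∀ s, ∀ P ∈ PowSet s, ∀ l, mu s P l ≤ mu s (Function.update P l 0) l + δ * P l
  mu_property2 : ∀ s, ∀ P ∈ PowSet s, ∀ l l', l' ≠ l →
    mu s P l' ≤ mu s (Function.update P l 0) l'
  /-- harvestable energy of each node in each energy state -/
  h : En → Node → ℝ
  hmax : ℝ
  h_nonneg : ∀ j n, 0 ≤ h j n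
  h_le : ∀ j n, h j n ≤ hmax
  /-- transition matrices and steady-state probabilities of channel and energy states -/
  pCh : Matrix Ch Ch ℝ
  pEn : Matrix En En ℝ
  pCh_chain : IsIrredAperiodic pCh
  pEn_chain : IsIrredAperiodic pEn
  πCh : Ch → ℝ
  πEn : En → ℝ
  πCh_stat : IsStationaryDist pCh πCh
  πEn_stat : IsStationaryDist pEn πEn

/-- The decisions of one slot: admitted data `adm n c`, link powers `pow l`, rates `rate l c`
allocated to commodity `c` on link `l`, harvested energy `harv n`. -/
structure SlotAction (Node Link : Type*) where
  adm : Node → Node → ℝ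
  pow : Link → ℝ
  rate : Link → Node → ℝ
  harv : Node → ℝ

namespace EHNetwork

variable {Node Link Ch En : Type*} [Fintype Node] [DecidableEq Node] [Fintype Link]
  [DecidableEq Link] [Fintype Ch] [DecidableEq Ch] [Fintype En] [DecidableEq En]

/-- maximum in-degree -/
def dmax (net : EHNetwork Node Link Ch En) : ℕ :=
  Finset.univ.sup fun n => (Finset.univ.filter fun l => net.dst l = n).card

/-- largest first derivative of the utility functions -/
def β (net : EHNetwork Node Link Ch En) : ℝ :=
  ⨆ p : Node × Node, derivWithin (net.U p.1 p.2) (Ici 0) 0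

def γ (net : EHNetwork Node Link Ch En) : ℝ := net.Rmax + net.dmax * net.muMax

def Utot (net : EHNetwork Node Link Ch En) (r : Node → Node → ℝ) : ℝ :=
  ∑ n, ∑ c, net.U n c (r n c)

/-- total power spent by node `n` -/
def spent (net : EHNetwork Node Link Ch En) (P : Link → ℝ) (n : Node) : ℝ :=
  ∑ l with net.src l = n, P l

/-- total commodity `c` rate out of node `n` -/
def outRate (net : EHNetwork Node Link Ch En) (m : Link → Node → ℝ) (n c : Node) : ℝ :=
  ∑ l with net.src l = n, m l c

/-- total commodity `c` rate into node `n` -/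
def inRate (net : EHNetwork Node Link Ch En) (m : Link → Node → ℝ) (n c : Node) : ℝ :=
  ∑ l with net.dst l = n, m l c

/-- The decision constraints of a slot in channel state `s` and energy state `j`, apart from
the energy-availability constraint. -/
structure Admissible (net : EHNetwork Node Link Ch En) (s : Ch) (j : En)
    (a : SlotAction Node Link) : Prop where
  adm_mem : ∀ n c, a.adm n c ∈ Icc 0 net.Rmax
  pow_mem : a.pow ∈ net.PowSet s
  rate_nonneg : ∀ l c, 0 ≤ a.rate l c
  rate_le : ∀ l, ∑ c, a.rate l c ≤ net.mu s a.pow l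
  harv_mem : ∀ n, a.harv n ∈ Icc 0 (net.h j n)

/-- data queues after one slot; data that has reached its destination leaves the network -/
def nextQ (net : EHNetwork Node Link Ch En) (Q : Node → Node → ℝ) (a : SlotAction Node Link) :
    Node → Node → ℝ := fun n c =>
  if n = c then 0 else max (Q n c - net.outRate a.rate n c) 0 + net.inRate a.rate n c + a.adm n c

/-- energy queues after one slot -/
def nextE (net : EHNetwork Node Link Ch En) (E : Node → ℝ) (a : SlotAction Node Link) : Node → ℝ :=
  fun n => E n - net.spent a.pow n + a.harv n

/-! ### The dual function -/

/-- The dual function of a single channel state `s` and a single energy state `j`. -/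
def dualAt (net : EHNetwork Node Link Ch En) (V : ℝ) (s : Ch) (j : En)
    (υ : Node → Node → ℝ) (ν : Node → ℝ) : ℝ :=
  sSup {x | ∃ a : SlotAction Node Link, net.Admissible s j a ∧
    x = V * net.Utot a.adm
      - ∑ n, ∑ c, υ n c * (a.adm n c + net.inRate a.rate n c - net.outRate a.rate n c)
      - ∑ n, ν n * (net.spent a.pow n - a.harv n)}

/-- The dual function `g`. -/
def dual (net : EHNetwork Node Link Ch En) (V : ℝ) (υ : Node → Node → ℝ) (ν : Node → ℝ) : ℝ :=
  ∑ s, net.πCh s * ∑ j, net.πEn j * net.dualAt V s j υ ν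

/-- Dual feasibility of the data multipliers. There is no queue, hence no constraint and no
multiplier, for data that is at its destination. -/
def DualFeasible (υ : Node → Node → ℝ) : Prop :=
  (∀ n c, 0 ≤ υ n c) ∧ ∀ c, υ c c = 0

def IsDualOptimal (net : EHNetwork Node Link Ch En) (V : ℝ) (υ : Node → Node → ℝ)
    (ν : Node → ℝ) : Prop :=
  DualFeasible υ ∧ ∀ υ' ν', DualFeasible υ' → net.dual V υ ν ≤ net.dual V υ' ν'

/-- Euclidean distance of two multiplier vectors. -/
def dualDist (υ : Node → Node → ℝ) (ν : Node → ℝ) (υ' : Node → Node → ℝ) (ν' : Node → ℝ) : ℝ :=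
  Real.sqrt (∑ n, ∑ c, (υ n c - υ' n c) ^ 2 + ∑ n, (ν n - ν' n) ^ 2)

/-! ### The random environment, policies and the optimal utility -/

/-- `S` and `H` are the channel and energy state processes: with respect to the filtration `ℱ`
(which also carries all past decisions) they are Markov chains that move independently. -/
structure IsEnv (net : EHNetwork Node Link Ch En) {Ω : Type*} {mΩ : MeasurableSpace Ω}
    (ℙ : Measure Ω) (ℱ : Filtration ℕ mΩ) (S : ℕ → Ω → Ch) (H : ℕ → Ω → En) : Prop where
  meas_S : ∀ t s, MeasurableSet[ℱ t] {ω | S t ω = s}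
  meas_H : ∀ t j, MeasurableSet[ℱ t] {ω | H t ω = j}
  markov : ∀ t s j,
    ℙ[({ω | S (t + 1) ω = s ∧ H (t + 1) ω = j}).indicator (fun _ => (1 : ℝ)) | ℱ t]
      =ᵐ[ℙ] fun ω => net.pCh (S t ω) s * net.pEn (H t ω) j

/-- Queues and actions at local time `t` are known at global time `t₀ + t`. -/
structure IsAdapted {Ω : Type*} {mΩ : MeasurableSpace Ω} (ℱ : Filtration ℕ mΩ) (t₀ : ℕ)
    (Q : ℕ → Ω → Node → Node → ℝ) (E : ℕ → Ω → Node → ℝ) (a : ℕ → Ω → SlotAction Node Link) :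
    Prop where
  Q_meas : ∀ t n c, Measurable[ℱ (t₀ + t)] fun ω => Q t ω n c
  E_meas : ∀ t n, Measurable[ℱ (t₀ + t)] fun ω => E t ω n
  adm_meas : ∀ t n c, Measurable[ℱ (t₀ + t)] fun ω => (a t ω).adm n c
  pow_meas : ∀ t l, Measurable[ℱ (t₀ + t)] fun ω => (a t ω).pow l
  rate_meas : ∀ t l c, Measurable[ℱ (t₀ + t)] fun ω => (a t ω).rate l c
  harv_meas : ∀ t n, Measurable[ℱ (t₀ + t)] fun ω => (a t ω).harv n

/-- A feasible policy of the utility maximization problem: it respects all decision constraints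
and the energy-availability constraint, is powered by storage devices of some finite capacity,
and stabilizes the network. -/
structure IsFeasiblePolicy (net : EHNetwork Node Link Ch En) {Ω : Type*} {mΩ : MeasurableSpace Ω}
    (ℙ : Measure Ω) (ℱ : Filtration ℕ mΩ) (S : ℕ → Ω → Ch) (H : ℕ → Ω → En)
    (Q : ℕ → Ω → Node → Node → ℝ) (E : ℕ → Ω → Node → ℝ) (a : ℕ → Ω → SlotAction Node Link) :
    Prop where
  adapted : IsAdapted ℱ 0 Q E a
  Q_zero : ∀ ω n c, Q 0 ω n c = 0
  E_zero : ∀ ω n, E 0 ω n = 0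
  admissible : ∀ t ω, net.Admissible (S t ω) (H t ω) (a t ω)
  energy_available : ∀ t ω n, net.spent (a t ω).pow n ≤ E t ω n
  Q_next : ∀ t ω, Q (t + 1) ω = net.nextQ (Q t ω) (a t ω)
  E_next : ∀ t ω, E (t + 1) ω = net.nextE (E t ω) (a t ω)
  capacity : ∃ B : ℝ, ∀ t ω n, E t ω n ≤ B
  stable : limsup (fun t : ℕ =>
    (((1 / (t : ℝ)) * ∑ τ ∈ Finset.range t, ∑ n, ∑ c, ∫ ω, Q τ ω n c ∂ℙ : ℝ) : EReal)) atTop < ⊤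

/-- Long-run average expected admitted rates. -/
def avgRate {Ω : Type*} {mΩ : MeasurableSpace Ω} (ℙ : Measure Ω)
    (a : ℕ → Ω → SlotAction Node Link) (n c : Node) : ℝ :=
  liminf (fun t : ℕ => (1 / (t : ℝ)) * ∑ τ ∈ Finset.range t, ∫ ω, (a τ ω).adm n c ∂ℙ) atTop

/-- The optimal utility over all feasible policies. -/
def optUtility (net : EHNetwork Node Link Ch En) : ℝ :=
  sSup {u | ∃ (Ω : Type) (mΩ : MeasurableSpace Ω) (ℙ : Measure Ω) (ℱ : Filtration ℕ mΩ)
    (S : ℕ → Ω → Ch) (H : ℕ → Ω → En) (Q : ℕ → Ω → Node → Node → ℝ) (E : ℕ → Ω → Node → ℝ)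
    (a : ℕ → Ω → SlotAction Node Link), IsProbabilityMeasure ℙ ∧ net.IsEnv ℙ ℱ S H ∧
    net.IsFeasiblePolicy ℙ ℱ S H Q E a ∧ u = net.Utot (avgRate ℙ a)}

/-! ### The Energy-limited Scheduling Algorithm -/

/-- weight of commodity `c` on link `l` -/
def weight (net : EHNetwork Node Link Ch En) (Q : Node → Node → ℝ) (l : Link) (c : Node) : ℝ :=
  max (Q (net.src l) c - Q (net.dst l) c - net.γ) 0

/-- the objective of the power allocation step -/
def powObj (net : EHNetwork Node Link Ch En) (θ : Node → ℝ) (Q : Node → Node → ℝ)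
    (E : Node → ℝ) (s : Ch) (P : Link → ℝ) : ℝ :=
  ∑ l, net.mu s P l * (⨆ c, net.weight Q l c) + ∑ n, (E n - θ n) * net.spent P n

/-- `a` is a decision that ESA may take when it sees queues `Q`, `E`, channel state `s` and
the harvestable energy is that of state `j`. Ties may be broken in any way. -/
structure IsESAAction (net : EHNetwork Node Link Ch En) (V : ℝ) (θ : Node → ℝ)
    (Q : Node → Node → ℝ) (E : Node → ℝ) (s : Ch) (j : En) (a : SlotAction Node Link) : Prop where
  harvest : ∀ n, a.harv n = if E n < θ n then net.h j n else 0
  adm_mem : ∀ n c, a.adm n c ∈ Icc 0 net.Rmax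
  adm_max : ∀ n c, ∀ r ∈ Icc 0 net.Rmax,
    V * net.U n c r - Q n c * r ≤ V * net.U n c (a.adm n c) - Q n c * a.adm n c
  pow_mem : a.pow ∈ net.PowSet s
  energy_available : ∀ n, net.spent a.pow n ≤ E n
  pow_max : ∀ P ∈ net.PowSet s, (∀ n, net.spent P n ≤ E n) →
    net.powObj θ Q E s P ≤ net.powObj θ Q E s a.pow
  routing : ∀ l, ∃ c', (∀ c, net.weight Q l c ≤ net.weight Q l c') ∧
    (∀ c, c ≠ c' → a.rate l c = 0) ∧
    a.rate l c' = if 0 < net.weight Q l c' then net.mu s a.pow l else 0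

/-- A run of ESA from global time `t₀` on, with arbitrary initial queues. -/
structure IsESARun (net : EHNetwork Node Link Ch En) (V : ℝ) (θ : Node → ℝ)
    {Ω : Type*} {mΩ : MeasurableSpace Ω} (ℱ : Filtration ℕ mΩ)
    (S : ℕ → Ω → Ch) (H : ℕ → Ω → En) (t₀ : ℕ)
    (Q : ℕ → Ω → Node → Node → ℝ) (E : ℕ → Ω → Node → ℝ) (a : ℕ → Ω → SlotAction Node Link) :
    Prop where
  adapted : IsAdapted ℱ t₀ Q E a
  action : ∀ t ω, net.IsESAAction V θ (Q t ω) (E t ω) (S (t₀ + t) ω) (H (t₀ + t) ω) (a t ω)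
  Q_next : ∀ t ω, Q (t + 1) ω = net.nextQ (Q t ω) (a t ω)
  E_next : ∀ t ω, E (t + 1) ω = net.nextE (E t ω) (a t ω)

/-- Initial queues in the range in which ESA keeps them; zero queues are the main example. -/
structure InitRange (net : EHNetwork Node Link Ch En) (V : ℝ) (θ : Node → ℝ)
    (Q : Node → Node → ℝ) (E : Node → ℝ) : Prop where
  Q_mem : ∀ n c, Q n c ∈ Icc 0 (net.β * V + net.Rmax)
  Q_dest : ∀ c, Q c c = 0
  E_mem : ∀ n, E n ∈ Icc 0 (θ n + net.hmax)

/-- Phase I of MESA: a run of ESA on the virtual queues whose queue distribution is in steady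
state at time `T`, that is, does not change any more if ESA runs on. -/
structure IsPhaseOne (net : EHNetwork Node Link Ch En) (V : ℝ) (θ : Node → ℝ)
    {Ω : Type*} {mΩ : MeasurableSpace Ω} (ℙ : Measure Ω) (ℱ : Filtration ℕ mΩ)
    (S : ℕ → Ω → Ch) (H : ℕ → Ω → En) (T : ℕ)
    (Q : ℕ → Ω → Node → Node → ℝ) (E : ℕ → Ω → Node → ℝ) (a : ℕ → Ω → SlotAction Node Link) :
    Prop where
  run : net.IsESARun V θ ℱ S H 0 Q E a
  init : ∀ ω, net.InitRange V θ (Q 0 ω) (E 0 ω)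
  steady : ∀ t, T ≤ t →
    ℙ.map (fun ω => (Q t ω, E t ω)) = ℙ.map (fun ω => (Q T ω, E T ω))

/-! ### The Modified-ESA algorithm -/

/-- storage size -/
def storage (V : ℝ) : ℝ := 4 * Real.log V ^ 2

/-- the virtual energy level `Ehat` of a node lies in the window in which its packets are sent -/
def InWindow (net : EHNetwork Node Link Ch En) (M : ℝ) (E₀ Ehat : Node → ℝ) (n : Node) : Prop :=
  Ehat n ∈ Icc (E₀ n + net.Pmax) (E₀ n + M)

open Classical in
/-- input of the actual data queues: packets of nodes outside their window are dropped -/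
def input (net : EHNetwork Node Link Ch En) (M : ℝ) (E₀ Ehat : Node → ℝ)
    (a : SlotAction Node Link) (n c : Node) : ℝ :=
  a.adm n c + ∑ l with net.dst l = n,
    if net.InWindow M E₀ Ehat (net.src l) then a.rate l c else 0

/-- the part of the input that the actual data queue accepts -/
def accepted (net : EHNetwork Node Link Ch En) (M : ℝ) (Q₀ : Node → Node → ℝ) (E₀ : Node → ℝ)
    (Qhat : Node → Node → ℝ) (Ehat : Node → ℝ) (a : SlotAction Node Link) (n c : Node) : ℝ :=
  if Qhat n c < Q₀ n c then
    max (net.input M E₀ Ehat a n c - (Q₀ n c - Qhat n c)) 0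
  else net.input M E₀ Ehat a n c

open Classical in
/-- total amount of data dropped in a slot, both at the links and at the queue inputs -/
def dropped (net : EHNetwork Node Link Ch En) (M : ℝ) (Q₀ : Node → Node → ℝ) (E₀ : Node → ℝ)
    (Qhat : Node → Node → ℝ) (Ehat : Node → ℝ) (a : SlotAction Node Link) : ℝ :=
  (∑ l, ∑ c, if net.InWindow M E₀ Ehat (net.src l) then 0 else a.rate l c)
    + ∑ n, ∑ c, (net.input M E₀ Ehat a n c - net.accepted M Q₀ E₀ Qhat Ehat a n c)

/-- actual energy queues after one slot -/
def nextActualE (net : EHNetwork Node Link Ch En) (M : ℝ) (E₀ Ehat E : Node → ℝ)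
    (a : SlotAction Node Link) : Node → ℝ := fun n =>
  if Ehat n < E₀ n then
    min (max (E n - net.spent a.pow n) 0 + max (a.harv n - (E₀ n - Ehat n)) 0) M
  else if E₀ n + M < Ehat n then min (E n + a.harv n) M
  else min (max (E n - net.spent a.pow n) 0 + a.harv n) M

/-- Phase II of MESA after a Phase I that ends at global time `T` with virtual queues `Q₁ T`,
`E₁ T`. `Qhat`, `Ehat` are the virtual queues, `Q`, `E` the actual ones, and `Q₀`, `E₀` the
estimated attraction points. Time is reset to zero. The data queues may be smaller than the
update formula when a node has too few packets to fill an allocated rate. -/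
structure IsPhaseTwo (net : EHNetwork Node Link Ch En) (V : ℝ) (θ : Node → ℝ)
    {Ω : Type*} {mΩ : MeasurableSpace Ω} (ℱ : Filtration ℕ mΩ)
    (S : ℕ → Ω → Ch) (H : ℕ → Ω → En) (T : ℕ)
    (Q₁ : ℕ → Ω → Node → Node → ℝ) (E₁ : ℕ → Ω → Node → ℝ)
    (Q₀ : Ω → Node → Node → ℝ) (E₀ : Ω → Node → ℝ)
    (Qhat : ℕ → Ω → Node → Node → ℝ) (Ehat : ℕ → Ω → Node → ℝ) (a : ℕ → Ω → SlotAction Node Link)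
    (Q : ℕ → Ω → Node → Node → ℝ) (E : ℕ → Ω → Node → ℝ) : Prop where
  Q₀_eq : ∀ ω n c, Q₀ ω n c = max (Q₁ T ω n c - storage V / 2) 0
  E₀_eq : ∀ ω n, E₀ ω n = max (E₁ T ω n - storage V / 2) 0
  Qhat_zero : ∀ ω, Qhat 0 ω = Q₀ ω
  Ehat_zero : ∀ ω, Ehat 0 ω = E₀ ω
  run : net.IsESARun V θ ℱ S H T Qhat Ehat a
  Q_zero : ∀ ω n c, Q 0 ω n c = 0
  E_zero : ∀ ω n, E 0 ω n = 0
  Q_meas : ∀ t n c, Measurable[ℱ (T + t)] fun ω => Q t ω n c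
  Q_nonneg : ∀ t ω n c, 0 ≤ Q t ω n c
  Q_dest : ∀ t ω c, Q t ω c c = 0
  Q_next : ∀ t ω n c, n ≠ c → Q (t + 1) ω n c ≤
    max (Q t ω n c - net.outRate (a t ω).rate n c) 0
      + net.accepted (storage V) (Q₀ ω) (E₀ ω) (Qhat t ω) (Ehat t ω) (a t ω) n c
  E_next : ∀ t ω, E (t + 1) ω = net.nextActualE (storage V) (E₀ ω) (Ehat t ω) (E t ω) (a t ω)

/-! ### Long-run averages given the outcome of Phase I -/

/-- `(1/t) ∑_{τ<t} 𝔼[X τ | 𝒢]` -/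
def condAvg {Ω : Type*} {mΩ : MeasurableSpace Ω} (ℙ : Measure Ω) (𝒢 : MeasurableSpace Ω)
    (X : ℕ → Ω → ℝ) (t : ℕ) (ω : Ω) : ℝ :=
  (1 / (t : ℝ)) * ∑ τ ∈ Finset.range t, (ℙ[X τ | 𝒢]) ω

/-- long-run average expected value, with `limsup`, in the extended reals -/
def condLimsupAvg {Ω : Type*} {mΩ : MeasurableSpace Ω} (ℙ : Measure Ω) (𝒢 : MeasurableSpace Ω)
    (X : ℕ → Ω → ℝ) (ω : Ω) : EReal :=
  limsup (fun t => (condAvg ℙ 𝒢 X t ω : EReal)) atTop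

/-- long-run average expected admitted rates -/
def condAvgRate {Ω : Type*} {mΩ : MeasurableSpace Ω} (ℙ : Measure Ω) (𝒢 : MeasurableSpace Ω)
    (a : ℕ → Ω → SlotAction Node Link) (ω : Ω) (n c : Node) : ℝ :=
  liminf (fun t => condAvg ℙ 𝒢 (fun τ ω => (a τ ω).adm n c) t ω) atTop

end EHNetwork

end

/-!
The linear growth of the dual function determines its minimizer. The one-slot dual function is
`sup_r (V U(r) - υ r)` plus a supremum over routing, power and harvesting that is positively
homogeneous in the multipliers. Along the ray through the minimizer the second part is linear and
the first one is differentiable, because the utilities are strictly concave. So the dual function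
has no kink there, and growth of at least `L` times the distance in both directions is possible
only if the minimizer is the origin (`EHNetwork.minimizer_eq_zero`). In other words, the assumption
describes networks that can carry full admission with some slack in all queues, and the growth
condition becomes `V * maxUtility + L * ‖y‖ ≤ dual V y` (`EHNetwork.dual_ge`). Since full admission
is an upper bound for the utility of every policy (`EHNetwork.optUtility_le`), it remains to show
that the queues of ESA, as a point `y = (Q, θ - E)` of the multiplier space, stay near the origin.

ESA maximizes the one-slot Lagrangian at `y` up to a constant, because the energy-availability
constraint costs nothing when `θ ≥ δ β V + Pmax` (`EHNetwork.IsESAAction.powObj_le`,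
`EHNetwork.IsESAAction.dualAt_le`). Hence the drift of `‖y‖²` is controlled by the dual function of
the current state of the environment. Subtracting twice the solution of the Poisson equation of the
environment chain (`exists_poisson`), applied to the one-slot dual functions, replaces this by the
stationary average, so the corrected quadratic function has drift at most `-2 L ‖y‖ + const`. Its
square root has bounded increments and negative drift far away, and an exponential of it contracts
geometrically (`exists_exp_drift`, `EHNetwork.exists_lyapunov`), with constants that do not depend
on `V` and `θ`. The next queues are known one slot ahead, only the environment is random, so the
drift inequality is a finite sum and conditional expectations enter only in
`EHNetwork.IsESARun.condExp_exp_le`.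

This exponential moment bound is used twice. In steady state it gives
`𝔼 exp (κ ‖y(T)‖) ≤ B` (`EHNetwork.IsPhaseOne.integral_exp_le`), so that with `M = 4 (log V)²` the
virtual queues end Phase I within `M / 8` of the attraction point `Q = 0`, `E = θ` except with
probability `O(V⁻⁴)`. In Phase II it holds conditionally on the history up to time `T`. The actual
queues follow the virtual ones (`EHNetwork.IsPhaseTwo.le_energy`, `EHNetwork.IsPhaseTwo.data_le`).
On the good event data is dropped only when the virtual queues are farther than `M / 8` from the
attraction point, and ESA admits all data unless a virtual queue is of order `V`; both events have
long-run conditional frequency `O(1 / V)`.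
-/

/-! ### Finite Markov chains and the Poisson equation -/

namespace IsIrredAperiodic

variable {X : Type*} [Fintype X] [DecidableEq X] {p : Matrix X X ℝ}

lemma pow_nonneg (hp : IsIrredAperiodic p) (k : ℕ) (i j : X) : 0 ≤ (p ^ k) i j := by
  induction k generalizing i j with
  | zero => rw [pow_zero, Matrix.one_apply]; split_ifs <;> norm_num
  | succ k ih =>
    rw [pow_succ, Matrix.mul_apply]
    exact Finset.sum_nonneg fun x _ => mul_nonneg (ih i x) (hp.nonneg x j)

lemma pow_row_sum (hp : IsIrredAperiodic p) (k : ℕ) (i : X) : ∑ j, (p ^ k) i j = 1 := by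
  induction k generalizing i with
  | zero => simp [Matrix.one_apply]
  | succ k ih =>
    simp_rw [pow_succ, Matrix.mul_apply]
    rw [Finset.sum_comm]
    simp_rw [← Finset.mul_sum, hp.row_sum, mul_one, ih]

lemma pow_add_pos (hp : IsIrredAperiodic p) {k l : ℕ} {i j m : X} (h₁ : 0 < (p ^ k) i j)
    (h₂ : 0 < (p ^ l) j m) : 0 < (p ^ (k + l)) i m := by
  rw [pow_add, Matrix.mul_apply]
  exact lt_of_lt_of_le (mul_pos h₁ h₂) (Finset.single_le_sum
    (f := fun x => (p ^ k) i x * (p ^ l) x m)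
    (fun x _ => mul_nonneg (hp.pow_nonneg k i x) (hp.pow_nonneg l x m)) (Finset.mem_univ j))

/-- The return times to a state form a numerical semigroup whose greatest common divisor is `1`,
so they contain all large numbers; hence so do the travel times between any two states. -/
lemma exists_forall_ge_pow_pos (hp : IsIrredAperiodic p) (i j : X) :
    ∃ K, ∀ k, K ≤ k → 0 < (p ^ k) i j := by
  have hret : ∃ K, ∀ k, K ≤ k → 0 < (p ^ k) i i := by
    let A : AddSubmonoid ℕ :=
      { carrier := {k | 0 < (p ^ k) i i}
        zero_mem' := by simp
        add_mem' := fun ha hb => hp.pow_add_pos ha hb }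
    have hgcd : Nat.setGcd (A : Set ℕ) = 1 :=
      hp.aperiodic i _ fun k _ hk => Nat.setGcd_dvd_of_mem hk
    obtain ⟨K, hK⟩ := Nat.exists_mem_closure_of_ge (A : Set ℕ)
    refine ⟨K, fun k hk => ?_⟩
    have := hK k hk (by rw [hgcd]; exact one_dvd k)
    rw [AddSubmonoid.closure_eq] at this
    exact this
  obtain ⟨K, hK⟩ := hret
  obtain ⟨l, hl⟩ := hp.irreducible i j
  refine ⟨K + l, fun k hk => ?_⟩
  obtain ⟨m, rfl⟩ : ∃ m, k = m + l := ⟨k - l, by omega⟩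
  exact hp.pow_add_pos (hK m (by omega)) hl

end IsIrredAperiodic

section ProductChain

variable {X Y : Type*} [Fintype X] [DecidableEq X] [Fintype Y] [DecidableEq Y]
  {p : Matrix X X ℝ} {q : Matrix Y Y ℝ}

/-- Two chains that move independently are jointly irreducible because both are aperiodic; by the
maximum principle only constants are harmonic for the product chain. -/
lemma harmonic_const (hp : IsIrredAperiodic p) (hq : IsIrredAperiodic q) (f : X × Y → ℝ)
    (hf : ∀ z, f z = ∑ z', p z.1 z'.1 * q z.2 z'.2 * f z') (z z' : X × Y) : f z = f z' := by
  have hpow : ∀ k : ℕ, ∀ z, f z = ∑ z', (p ^ k) z.1 z'.1 * (q ^ k) z.2 z'.2 * f z' := by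
    intro k
    induction k with
    | zero =>
      intro z
      rw [Finset.sum_eq_single z] <;> simp +contextual [Matrix.one_apply, Prod.ext_iff]
      intro a b h h₁ h₂
      exact absurd h₁.symm (h h₂.symm)
    | succ k ih =>
      intro z
      rw [ih z]
      have : ∀ x, (p ^ k) z.1 x.1 * (q ^ k) z.2 x.2 * f x
          = ∑ z', (p ^ k) z.1 x.1 * (q ^ k) z.2 x.2 * (p x.1 z'.1 * q x.2 z'.2 * f z') := by
        intro x
        rw [← Finset.mul_sum, ← hf x]
      rw [Finset.sum_congr rfl fun x _ => this x, Finset.sum_comm]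
      refine Finset.sum_congr rfl fun y _ => ?_
      rw [pow_succ, pow_succ, Matrix.mul_apply, Matrix.mul_apply, Finset.sum_mul_sum,
        Finset.sum_mul, Fintype.sum_prod_type]
      refine Finset.sum_congr rfl fun a _ => ?_
      rw [Finset.sum_mul]
      exact Finset.sum_congr rfl fun b _ => by ring
  obtain ⟨m, -, hm⟩ :=
    Finset.exists_max_image (Finset.univ : Finset (X × Y)) f ⟨z, Finset.mem_univ z⟩
  have key : ∀ w, f w = f m := by
    intro w
    obtain ⟨K, hK⟩ := hp.exists_forall_ge_pow_pos m.1 w.1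
    obtain ⟨K', hK'⟩ := hq.exists_forall_ge_pow_pos m.2 w.2
    set k := max K K'
    have h₁ := hK k (le_max_left _ _)
    have h₂ := hK' k (le_max_right _ _)
    have hsum : ∑ z' : X × Y, (p ^ k) m.1 z'.1 * (q ^ k) m.2 z'.2 = 1 := by
      rw [Fintype.sum_prod_type]
      simp_rw [← Finset.mul_sum, hq.pow_row_sum, mul_one, hp.pow_row_sum]
    have hzero : ∑ z', (p ^ k) m.1 z'.1 * (q ^ k) m.2 z'.2 * (f m - f z') = 0 := by
      simp_rw [mul_sub, Finset.sum_sub_distrib]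
      rw [← hpow k m, ← Finset.sum_mul, hsum, one_mul, sub_self]
    have hnn : ∀ z' ∈ (Finset.univ : Finset (X × Y)),
        0 ≤ (p ^ k) m.1 z'.1 * (q ^ k) m.2 z'.2 * (f m - f z') := fun z' hz' =>
      mul_nonneg (mul_nonneg (hp.pow_nonneg _ _ _) (hq.pow_nonneg _ _ _))
        (sub_nonneg.2 (hm z' hz'))
    have := (Finset.sum_eq_zero_iff_of_nonneg hnn).1 hzero w (Finset.mem_univ w)
    have := (mul_eq_zero.1 this).resolve_left (mul_pos h₁ h₂).ne'
    linarith
  rw [key z, key z']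

/-- The Poisson equation `u - Pu = f - πf` of the product chain has a solution that depends
linearly on `f`; `G` is the matrix of the solution operator. -/
lemma exists_poisson (hp : IsIrredAperiodic p) (hq : IsIrredAperiodic q) {v : X → ℝ} {w : Y → ℝ}
    (hv : IsStationaryDist p v) (hw : IsStationaryDist q w) :
    ∃ G : X × Y → X × Y → ℝ, ∀ (f : X × Y → ℝ) (z : X × Y),
      (∑ x, G z x * f x) - ∑ z', p z.1 z'.1 * q z.2 z'.2 * ∑ x, G z' x * f x
        = f z - ∑ x, v x.1 * w x.2 * f x := by
  let A : (X × Y → ℝ) →ₗ[ℝ] (X × Y → ℝ) :=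
    { toFun := fun f z => f z - ∑ z', p z.1 z'.1 * q z.2 z'.2 * f z' + ∑ x, v x.1 * w x.2 * f x
      map_add' := fun f g => by
        ext z
        simp only [Pi.add_apply, mul_add, Finset.sum_add_distrib]
        ring
      map_smul' := fun c f => by
        ext z
        simp only [Pi.smul_apply, smul_eq_mul, RingHom.id_apply, mul_add, mul_sub, Finset.mul_sum]
        congr 1
        · congr 1
          exact Finset.sum_congr rfl fun _ _ => by ring
        · exact Finset.sum_congr rfl fun _ _ => by ring }
  have hA : ∀ f z, A f z
      = f z - ∑ z', p z.1 z'.1 * q z.2 z'.2 * f z' + ∑ x, v x.1 * w x.2 * f x := fun _ _ => rfl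
  have hone : ∑ x : X × Y, v x.1 * w x.2 = 1 := by
    rw [Fintype.sum_prod_type]
    simp_rw [← Finset.mul_sum, hw.sum_one, mul_one, hv.sum_one]
  have hstat : ∀ f : X × Y → ℝ, ∑ z : X × Y, v z.1 * w z.2 * ∑ z', p z.1 z'.1 * q z.2 z'.2 * f z'
      = ∑ x, v x.1 * w x.2 * f x := by
    intro f
    simp_rw [Finset.mul_sum]
    rw [Finset.sum_comm]
    refine Finset.sum_congr rfl fun y _ => ?_
    rw [← hv.stationary, ← hw.stationary, Finset.sum_mul_sum, Finset.sum_mul,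
      Fintype.sum_prod_type]
    refine Finset.sum_congr rfl fun a _ => ?_
    rw [Finset.sum_mul]
    exact Finset.sum_congr rfl fun b _ => by ring
  have hmean : ∀ f, ∑ z : X × Y, v z.1 * w z.2 * A f z = ∑ x, v x.1 * w x.2 * f x := by
    intro f
    simp_rw [hA, mul_add, mul_sub, Finset.sum_add_distrib, Finset.sum_sub_distrib]
    rw [hstat, ← Finset.sum_mul, hone]
    ring
  have hinj : Function.Injective A := by
    rw [← LinearMap.ker_eq_bot, LinearMap.ker_eq_bot']
    intro f hf
    have h0 : ∑ x : X × Y, v x.1 * w x.2 * f x = 0 := by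
      rw [← hmean, hf]
      simp
    have hharm : ∀ z, f z = ∑ z', p z.1 z'.1 * q z.2 z'.2 * f z' := by
      intro z
      have := congrFun hf z
      rw [hA, h0] at this
      simp only [Pi.zero_apply] at this
      linarith
    ext z
    have hc := harmonic_const hp hq f hharm
    have : ∑ x : X × Y, v x.1 * w x.2 * f x = f z := by
      rw [Finset.sum_congr rfl fun x _ => by rw [hc x z], ← Finset.sum_mul, hone, one_mul]
    rw [← this, h0]
    rfl
  have hsurj : Function.Surjective A := LinearMap.injective_iff_surjective.1 hinj
  choose u hu using fun x : X × Y => hsurj (Pi.single x 1)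
  refine ⟨fun z x => u x z, fun f z => ?_⟩
  set F : X × Y → ℝ := ∑ x, f x • u x with hF
  have hFz : ∀ z, ∑ x, u x z * f x = F z := by
    intro z
    rw [hF, Finset.sum_apply]
    exact Finset.sum_congr rfl fun x _ => by simp [mul_comm]
  have hAF : A F = f := by
    rw [hF, map_sum]
    ext y
    simp [hu, Finset.sum_apply, Pi.single_apply]
  have h₁ := hmean F
  rw [hAF] at h₁
  have h₂ := congrFun hAF z
  rw [hA] at h₂
  simp_rw [hFz]
  linarith

end ProductChain

/-! ### Bounds on one-slot decisions and on the utilities -/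

namespace EHNetwork

variable {Node Link Ch En : Type*} [Fintype Node] [DecidableEq Node] [Fintype Link]
  [DecidableEq Link] [Fintype Ch] [DecidableEq Ch] [Fintype En] [DecidableEq En]
  (net : EHNetwork Node Link Ch En)

include net in
lemma nonempty_ch : Nonempty Ch := by
  by_contra h
  rw [not_nonempty_iff] at h
  simpa using net.πCh_stat.sum_one

include net in
lemma nonempty_en : Nonempty En := by
  by_contra h
  rw [not_nonempty_iff] at h
  simpa using net.πEn_stat.sum_one

lemma Pmax_nonneg [Nonempty Node] : 0 ≤ net.Pmax := by
  obtain ⟨s⟩ := net.nonempty_ch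
  obtain ⟨P, hP⟩ := net.PowSet_nonempty s
  obtain ⟨n⟩ := ‹Nonempty Node›
  exact (Finset.sum_nonneg fun l _ => net.pow_nonneg s P hP l).trans (net.pow_le s P hP n)

lemma hmax_nonneg [Nonempty Node] : 0 ≤ net.hmax := by
  obtain ⟨j⟩ := net.nonempty_en
  obtain ⟨n⟩ := ‹Nonempty Node›
  exact (net.h_nonneg j n).trans (net.h_le j n)

lemma muMax_nonneg (l : Link) : 0 ≤ net.muMax := by
  obtain ⟨s⟩ := net.nonempty_ch
  obtain ⟨P, hP⟩ := net.PowSet_nonempty s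
  exact (net.mu_nonneg s P hP l).trans (net.mu_le s P hP l)

/-- Capacity of all links together. -/
def totalRate : ℝ := Fintype.card Link * net.muMax

lemma totalRate_nonneg : 0 ≤ net.totalRate := by
  rw [totalRate]
  rcases isEmpty_or_nonempty Link with h | ⟨⟨l⟩⟩
  · simp
  · exact mul_nonneg (Nat.cast_nonneg _) (net.muMax_nonneg l)

lemma sum_muMax_le (t : Finset Link) : ∑ _l ∈ t, net.muMax ≤ net.totalRate := by
  rcases isEmpty_or_nonempty Link with h | ⟨⟨l⟩⟩
  · rw [Finset.eq_empty_of_isEmpty t]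
    simpa using net.totalRate_nonneg
  · rw [Finset.sum_const, nsmul_eq_mul, totalRate]
    exact mul_le_mul_of_nonneg_right (by exact_mod_cast Finset.card_le_univ t) (net.muMax_nonneg l)

lemma Rmax_le_γ : net.Rmax ≤ net.γ := by
  rw [γ, le_add_iff_nonneg_right]
  rcases isEmpty_or_nonempty Link with h | ⟨⟨l⟩⟩
  · have h0 : net.dmax = 0 := by
      rw [dmax, ← Nat.le_zero]
      exact Finset.sup_le fun n _ => by simp
    simp [h0]
  · exact mul_nonneg (Nat.cast_nonneg (α := ℝ) net.dmax) (net.muMax_nonneg l)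

lemma γ_nonneg : 0 ≤ net.γ := net.Rmax_nonneg.trans net.Rmax_le_γ

/-- A bound on the change of any data or energy queue in one slot. -/
def stepBound : ℝ := net.Rmax + net.totalRate + net.Pmax + net.hmax

lemma stepBound_nonneg [Nonempty Node] : 0 ≤ net.stepBound := by
  have := net.Rmax_nonneg
  have := net.totalRate_nonneg
  have := net.Pmax_nonneg
  have := net.hmax_nonneg
  rw [stepBound]
  positivity

lemma outRate_nonneg {m : Link → Node → ℝ} (hm : ∀ l c, 0 ≤ m l c) (n c : Node) :
    0 ≤ net.outRate m n c := Finset.sum_nonneg fun l _ => hm l c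

lemma inRate_nonneg {m : Link → Node → ℝ} (hm : ∀ l c, 0 ≤ m l c) (n c : Node) :
    0 ≤ net.inRate m n c := Finset.sum_nonneg fun l _ => hm l c

section Admissible

variable {net} {s : Ch} {j : En} {a : SlotAction Node Link}

lemma Admissible.rate_le_muMax (ha : net.Admissible s j a) (l : Link) (c : Node) :
    a.rate l c ≤ net.muMax :=
  ((Finset.single_le_sum (f := fun c => a.rate l c) (fun c _ => ha.rate_nonneg l c)
    (Finset.mem_univ c)).trans (ha.rate_le l)).trans (net.mu_le s _ ha.pow_mem l)

lemma Admissible.inRate_le (ha : net.Admissible s j a) (n c : Node) :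
    net.inRate a.rate n c ≤ net.totalRate :=
  (Finset.sum_le_sum fun l _ => ha.rate_le_muMax l c).trans (net.sum_muMax_le _)

lemma Admissible.outRate_le (ha : net.Admissible s j a) (n c : Node) :
    net.outRate a.rate n c ≤ net.totalRate :=
  (Finset.sum_le_sum fun l _ => ha.rate_le_muMax l c).trans (net.sum_muMax_le _)

lemma Admissible.spent_nonneg (ha : net.Admissible s j a) (n : Node) : 0 ≤ net.spent a.pow n :=
  Finset.sum_nonneg fun l _ => net.pow_nonneg s _ ha.pow_mem l

lemma Admissible.harv_le (ha : net.Admissible s j a) (n : Node) : a.harv n ≤ net.hmax :=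
  (ha.harv_mem n).2.trans (net.h_le j n)

lemma Admissible.abs_data_le [Nonempty Node] (ha : net.Admissible s j a) (n c : Node) :
    |a.adm n c + net.inRate a.rate n c - net.outRate a.rate n c| ≤ net.stepBound := by
  have h1 := ha.adm_mem n c
  have h2 := ha.inRate_le n c
  have h3 := ha.outRate_le n c
  have h4 := net.inRate_nonneg ha.rate_nonneg n c
  have h5 := net.outRate_nonneg ha.rate_nonneg n c
  have h6 := net.Pmax_nonneg
  have h7 := net.hmax_nonneg
  have h8 := net.Rmax_nonneg
  rw [stepBound, abs_le]
  constructor <;> linarith [h1.1, h1.2]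

lemma Admissible.abs_energy_le [Nonempty Node] (ha : net.Admissible s j a) (n : Node) :
    |net.spent a.pow n - a.harv n| ≤ net.stepBound := by
  have h1 := ha.spent_nonneg n
  have h2 : net.spent a.pow n ≤ net.Pmax := net.pow_le s _ ha.pow_mem n
  have h3 := ha.harv_mem n
  have h4 := ha.harv_le n
  have h6 := net.Pmax_nonneg
  have h7 := net.hmax_nonneg
  have h8 := net.Rmax_nonneg
  have h9 := net.totalRate_nonneg
  rw [stepBound, abs_le]
  constructor <;> linarith [h3.1, h3.2]

end Admissible

lemma U_sub_le {n c : Node} {x y : ℝ} (hy : 0 ≤ y) (hyx : y ≤ x) :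
    net.U n c x - net.U n c y ≤ net.β * (x - y) := by
  have hconc := (net.U_strictConcave n c).concaveOn
  have hβ : derivWithin (net.U n c) (Ici 0) 0 ≤ net.β :=
    le_ciSup (f := fun p : Node × Node => derivWithin (net.U p.1 p.2) (Ici 0) 0)
      (Set.finite_range _).bddAbove (n, c)
  have hdiff : DifferentiableWithinAt ℝ (net.U n c) (Ici 0) 0 :=
    (net.U_contDiff n c).differentiableOn one_ne_zero 0 self_mem_Ici
  have h0 : ∀ z, 0 < z → (net.U n c z - net.U n c 0) / (z - 0) ≤ net.β := fun z hz => by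
    have := hconc.slope_le_derivWithin self_mem_Ici (mem_Ici.2 hz.le) hz hdiff
    rw [slope_def_field] at this
    exact this.trans hβ
  rcases hyx.eq_or_lt with rfl | hlt
  · simp
  have hslope : (net.U n c x - net.U n c y) / (x - y) ≤ net.β := by
    rcases hy.eq_or_lt with rfl | hy0
    · exact h0 x hlt
    · exact (hconc.slope_anti_adjacent self_mem_Ici (mem_Ici.2 (hy0.trans hlt).le) hy0 hlt).trans
        (h0 y hy0)
  rwa [div_le_iff₀ (sub_pos.2 hlt)] at hslope

lemma β_pos [Nonempty Node] : 0 < net.β := by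
  obtain ⟨n⟩ := ‹Nonempty Node›
  have h1 := net.U_sub_le (n := n) (c := n) le_rfl zero_le_one
  have h2 := net.U_strictMono n n (a := 0) self_mem_Ici (mem_Ici.2 zero_le_one) zero_lt_one
  linarith

/-- All utilities have slope at least some positive constant on `[0, Rmax]`. -/
lemma exists_slope_ge [Nonempty Node] : ∃ m : ℝ, 0 < m ∧ ∀ n c, ∀ r ∈ Icc 0 net.Rmax,
    m * (net.Rmax - r) ≤ net.U n c net.Rmax - net.U n c r := by
  obtain ⟨p, -, hp⟩ := Finset.exists_min_image (Finset.univ : Finset (Node × Node))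
    (fun p => net.U p.1 p.2 (net.Rmax + 1) - net.U p.1 p.2 net.Rmax) Finset.univ_nonempty
  have hR := net.Rmax_nonneg
  have hR1 : (0 : ℝ) ≤ net.Rmax + 1 := by linarith
  refine ⟨net.U p.1 p.2 (net.Rmax + 1) - net.U p.1 p.2 net.Rmax,
    sub_pos.2 (net.U_strictMono _ _ (mem_Ici.2 hR) (mem_Ici.2 hR1) (by linarith)), ?_⟩
  intro n c r hr
  rcases hr.2.eq_or_lt with rfl | hlt
  · simp
  have h := (net.U_strictConcave n c).concaveOn.slope_anti_adjacent (mem_Ici.2 hr.1)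
    (mem_Ici.2 hR1) hlt (lt_add_one _)
  rw [add_sub_cancel_left, div_one, le_div_iff₀ (sub_pos.2 hlt)] at h
  exact (mul_le_mul_of_nonneg_right (hp (n, c) (Finset.mem_univ _))
    (sub_nonneg.2 hr.2)).trans h

lemma U_le_U {n c : Node} {x y : ℝ} (hx : 0 ≤ x) (hxy : x ≤ y) : net.U n c x ≤ net.U n c y :=
  (net.U_strictMono n c).monotoneOn (mem_Ici.2 hx) (mem_Ici.2 (hx.trans hxy)) hxy

/-- The utility when every node admits all data. -/
def maxUtility : ℝ := net.Utot fun _ _ => net.Rmax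

lemma Utot_le_maxUtility {r : Node → Node → ℝ} (hr : ∀ n c, r n c ∈ Icc 0 net.Rmax) :
    net.Utot r ≤ net.maxUtility :=
  Finset.sum_le_sum fun n _ => Finset.sum_le_sum fun c _ => net.U_le_U (hr n c).1 (hr n c).2

lemma maxUtility_nonneg : 0 ≤ net.maxUtility :=
  Finset.sum_nonneg fun n _ => Finset.sum_nonneg fun c _ => by
    rw [← net.U_zero n c]
    exact net.U_le_U le_rfl net.Rmax_nonneg

lemma maxUtility_sub_le {r : Node → Node → ℝ} {ε : ℝ} (hr : ∀ n c, r n c ∈ Icc 0 net.Rmax)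
    [Nonempty Node] (hε : ∀ n c, net.Rmax - ε ≤ r n c) :
    net.maxUtility - (Fintype.card Node : ℝ) ^ 2 * (net.β * ε) ≤ net.Utot r := by
  have : ∀ n c, net.U n c net.Rmax - net.β * ε ≤ net.U n c (r n c) := fun n c => by
    have h1 := net.U_sub_le (n := n) (c := c) (hr n c).1 (hr n c).2
    have h2 : net.β * (net.Rmax - r n c) ≤ net.β * ε :=
      mul_le_mul_of_nonneg_left (by linarith [hε n c]) net.β_pos.le
    linarith
  have h := Finset.sum_le_sum fun n (_ : n ∈ Finset.univ) =>
    Finset.sum_le_sum fun c (_ : c ∈ Finset.univ) => this n c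
  simp only [Finset.sum_sub_distrib, Finset.sum_const, Finset.card_univ, nsmul_eq_mul] at h
  simp only [maxUtility, Utot]
  nlinarith [h]

/-! ### The dual function -/

/-- The Lagrangian of one slot. -/
def lagr (V : ℝ) (a : SlotAction Node Link) (υ : Node → Node → ℝ) (ν : Node → ℝ) : ℝ :=
  V * net.Utot a.adm
    - ∑ n, ∑ c, υ n c * (a.adm n c + net.inRate a.rate n c - net.outRate a.rate n c)
    - ∑ n, ν n * (net.spent a.pow n - a.harv n)

/-- The number of queues, up to counting the empty queues at destinations. -/
def dim (Node : Type*) [Fintype Node] : ℝ := (Fintype.card Node : ℝ) ^ 2 + Fintype.card Node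

omit [DecidableEq Node] in
/-- The sup norm of `(υ, ν)` is the natural norm of the product type; it is equivalent to the
Euclidean norm with constants that depend on the network only. -/
lemma abs_pairing_le {υ d : Node → Node → ℝ} {ν e : Node → ℝ} {b : ℝ} (hd : ∀ n c, |d n c| ≤ b)
    (he : ∀ n, |e n| ≤ b) :
    |∑ n, ∑ c, υ n c * d n c + ∑ n, ν n * e n| ≤ dim Node * b * ‖(υ, ν)‖ := by
  have h1 : ∀ n c, |υ n c * d n c| ≤ ‖(υ, ν)‖ * b := fun n c => by
    rw [abs_mul]
    refine mul_le_mul ?_ (hd n c) (abs_nonneg _) (norm_nonneg _)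
    exact ((norm_le_pi_norm (υ n) c).trans (norm_le_pi_norm υ n)).trans (norm_fst_le (υ, ν))
  have h2 : ∀ n, |ν n * e n| ≤ ‖(υ, ν)‖ * b := fun n => by
    rw [abs_mul]
    refine mul_le_mul ?_ (he n) (abs_nonneg _) (norm_nonneg _)
    exact (norm_le_pi_norm ν n).trans (norm_snd_le (υ, ν))
  have h3 : |∑ n, ∑ c, υ n c * d n c| ≤ ∑ _n : Node, ∑ _c : Node, ‖(υ, ν)‖ * b :=
    (Finset.abs_sum_le_sum_abs _ _).trans (Finset.sum_le_sum fun n _ =>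
      (Finset.abs_sum_le_sum_abs _ _).trans (Finset.sum_le_sum fun c _ => h1 n c))
  have h4 : |∑ n, ν n * e n| ≤ ∑ _n : Node, ‖(υ, ν)‖ * b :=
    (Finset.abs_sum_le_sum_abs _ _).trans (Finset.sum_le_sum fun n _ => h2 n)
  simp only [Finset.sum_const, Finset.card_univ, nsmul_eq_mul] at h3 h4
  refine (abs_add_le _ _).trans ((add_le_add h3 h4).trans (le_of_eq ?_))
  rw [dim]
  ring

omit [DecidableEq Node] in
lemma dim_nonneg : 0 ≤ dim Node := by rw [dim]; positivity

variable {net} in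
lemma Admissible.abs_lagr_sub_le [Nonempty Node] {s : Ch} {j : En} {a : SlotAction Node Link}
    (ha : net.Admissible s j a) (V : ℝ) (y y' : (Node → Node → ℝ) × (Node → ℝ)) :
    |net.lagr V a y.1 y.2 - net.lagr V a y'.1 y'.2| ≤ dim Node * net.stepBound * ‖y - y'‖ := by
  have := abs_pairing_le (υ := (y - y').1) (ν := (y - y').2)
    (fun n c => ha.abs_data_le n c) (fun n => ha.abs_energy_le n)
  rw [← abs_neg]
  convert this using 2
  simp only [lagr, Prod.fst_sub, Prod.snd_sub, Pi.sub_apply, sub_mul, Finset.sum_sub_distrib]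
  ring

section Dual

variable {V : ℝ} (hV : 0 ≤ V) (s : Ch) (j : En)
include hV

variable {net s j} in
lemma Admissible.lagr_le [Nonempty Node] {a : SlotAction Node Link} (ha : net.Admissible s j a)
    (υ : Node → Node → ℝ) (ν : Node → ℝ) :
    net.lagr V a υ ν ≤ V * net.maxUtility + dim Node * net.stepBound * ‖(υ, ν)‖ := by
  have h1 := mul_le_mul_of_nonneg_left (net.Utot_le_maxUtility ha.adm_mem) hV
  have h2 := abs_pairing_le (υ := υ) (ν := ν) (fun n c => ha.abs_data_le n c)
    (fun n => ha.abs_energy_le n)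
  rw [lagr]
  linarith [(abs_le.1 h2).1]

variable {net s j} in
lemma Admissible.lagr_le_dualAt [Nonempty Node] {a : SlotAction Node Link}
    (ha : net.Admissible s j a) (υ : Node → Node → ℝ) (ν : Node → ℝ) :
    net.lagr V a υ ν ≤ net.dualAt V s j υ ν := by
  refine le_csSup ⟨V * net.maxUtility + dim Node * net.stepBound * ‖(υ, ν)‖, ?_⟩ ⟨a, ha, rfl⟩
  rintro x ⟨a', ha', rfl⟩
  exact ha'.lagr_le hV υ ν

omit hV in
lemma exists_admissible : ∃ a, net.Admissible s j a ∧ (∀ n c, a.adm n c = net.Rmax) := by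
  obtain ⟨P, hP⟩ := net.PowSet_nonempty s
  refine ⟨⟨fun _ _ => net.Rmax, P, fun _ _ => 0, fun _ => 0⟩, ⟨fun _ _ => ⟨net.Rmax_nonneg, le_rfl⟩,
    hP, fun _ _ => le_rfl, fun l => ?_, fun n => ⟨le_rfl, net.h_nonneg j n⟩⟩, fun _ _ => rfl⟩
  simpa using net.mu_nonneg s P hP l

omit hV in
lemma dualAt_le {υ : Node → Node → ℝ} {ν : Node → ℝ} {x : ℝ}
    (h : ∀ a, net.Admissible s j a → net.lagr V a υ ν ≤ x) : net.dualAt V s j υ ν ≤ x := by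
  obtain ⟨a, ha, -⟩ := net.exists_admissible s j
  refine csSup_le ⟨_, a, ha, rfl⟩ ?_
  rintro x ⟨a', ha', rfl⟩
  exact h a' ha'

lemma dualAt_sub_le [Nonempty Node] (y y' : (Node → Node → ℝ) × (Node → ℝ)) :
    net.dualAt V s j y.1 y.2 - net.dualAt V s j y'.1 y'.2
      ≤ dim Node * net.stepBound * ‖y - y'‖ := by
  rw [sub_le_iff_le_add]
  refine net.dualAt_le s j fun a ha => ?_
  have h1 := ha.lagr_le_dualAt hV y'.1 y'.2
  have h2 := (abs_le.1 (ha.abs_lagr_sub_le V y y')).2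
  linarith

lemma abs_dualAt_sub_le [Nonempty Node] (y y' : (Node → Node → ℝ) × (Node → ℝ)) :
    |net.dualAt V s j y.1 y.2 - net.dualAt V s j y'.1 y'.2|
      ≤ dim Node * net.stepBound * ‖y - y'‖ := by
  rw [abs_le]
  have h1 := net.dualAt_sub_le hV s j y y'
  have h2 := net.dualAt_sub_le hV s j y' y
  rw [norm_sub_rev] at h2
  constructor <;> linarith

lemma dualAt_zero [Nonempty Node] : net.dualAt V s j 0 0 = V * net.maxUtility := by
  refine le_antisymm (net.dualAt_le s j fun a ha => ?_) ?_
  · have := ha.lagr_le hV 0 0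
    rwa [show ((0 : Node → Node → ℝ), (0 : Node → ℝ)) = 0 from rfl, norm_zero, mul_zero,
      add_zero] at this
  · obtain ⟨a, ha, hR⟩ := net.exists_admissible s j
    have h : a.adm = fun _ _ => net.Rmax := by ext n c; exact hR n c
    have := ha.lagr_le_dualAt hV 0 0
    rw [lagr, h] at this
    simpa [maxUtility] using this

end Dual

end EHNetwork

/-! ### Linear growth of the dual function forces its minimizer to be the origin -/

/-- Maximizers of small linear perturbations of a strictly concave function are close together. -/
lemma StrictConcaveOn.exists_argmax_close {f : ℝ → ℝ} {R : ℝ} (hR : 0 ≤ R)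
    (hf : StrictConcaveOn ℝ (Icc 0 R) f) (hc : ContinuousOn f (Icc 0 R)) (x : ℝ) {η : ℝ}
    (hη : 0 < η) :
    ∃ ε₀ : ℝ, 0 < ε₀ ∧ ∀ ε, 0 < ε → ε < ε₀ → ∀ r ∈ Icc 0 R, ∀ r' ∈ Icc 0 R,
      (∀ t ∈ Icc 0 R, f t - ε * x * t ≤ f r - ε * x * r) →
      (∀ t ∈ Icc 0 R, f t + ε * x * t ≤ f r' + ε * x * r') → |r' - r| ≤ η := by
  obtain ⟨m, hm, hmax⟩ := isCompact_Icc.exists_isMaxOn (nonempty_Icc.2 hR) hc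
  have hmax' : ∀ t ∈ Icc 0 R, f t ≤ f m := fun t ht => hmax ht
  obtain ⟨hconv, hstrict⟩ := hf
  let K : Set (ℝ × ℝ) := (Icc 0 R ×ˢ Icc 0 R) ∩ {p | η ≤ |p.2 - p.1|}
  have hK : IsCompact K := (isCompact_Icc.prod isCompact_Icc).inter_right
    (isClosed_le continuous_const (by fun_prop))
  have hKc : ContinuousOn (fun p : ℝ × ℝ => f p.1 + f p.2) K :=
    (hc.comp continuousOn_fst fun p hp => hp.1.1).add
      (hc.comp continuousOn_snd fun p hp => hp.1.2)
  have hgap : ∃ δ : ℝ, 0 < δ ∧ ∀ p ∈ K, f p.1 + f p.2 ≤ 2 * f m - δ := by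
    rcases K.eq_empty_or_nonempty with h | h
    · exact ⟨1, one_pos, by simp [h]⟩
    obtain ⟨q, hq, hqmax⟩ := hK.exists_isMaxOn h hKc
    refine ⟨2 * f m - (f q.1 + f q.2), ?_, fun p hp => ?_⟩
    · have hne : q.1 ≠ q.2 := by
        intro he
        have := hq.2
        simp only [mem_ofPred_eq, he, sub_self, abs_zero] at this
        linarith
      have h1 := hstrict hq.1.1 hq.1.2 hne (a := 1 / 2) (b := 1 / 2) (by norm_num)
        (by norm_num) (by norm_num)
      have h2 := hmax' _ (hconv hq.1.1 hq.1.2 (a := 1 / 2) (b := 1 / 2) (by norm_num)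
        (by norm_num) (by norm_num))
      simp only [smul_eq_mul] at h1 h2
      linarith
    · have : f p.1 + f p.2 ≤ f q.1 + f q.2 := hqmax hp
      linarith
  obtain ⟨δ, hδ, hδK⟩ := hgap
  refine ⟨δ / (4 * (|x| * R + 1)), by positivity, fun ε hε hεδ r hr r' hr' h1 h2 => ?_⟩
  by_contra! hlt
  have h3 := hδK (r, r') ⟨⟨hr, hr'⟩, hlt.le⟩
  have h4 := h1 m hm
  have h5 := h2 m hm
  have hb : ∀ t ∈ Icc 0 R, |x * t| ≤ |x| * R := fun t ht => by
    rw [abs_mul, abs_of_nonneg ht.1]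
    exact mul_le_mul_of_nonneg_left ht.2 (abs_nonneg x)
  have h6 : ε * x * r' - ε * x * r ≤ ε * (|x| * R + |x| * R) := by
    have := mul_le_mul_of_nonneg_left
      (add_le_add (abs_le.1 (hb r' hr')).2 (neg_le.1 (abs_le.1 (hb r hr)).1)) hε.le
    linarith
  rw [lt_div_iff₀ (by positivity)] at hεδ
  simp only at h3
  have h7 : 0 ≤ ε * (|x| * R) := by positivity
  linarith

namespace EHNetwork

variable {Node Link Ch En : Type*} [Fintype Node] [DecidableEq Node] [Fintype Link]
  [DecidableEq Link] [Fintype Ch] [DecidableEq Ch] [Fintype En] [DecidableEq En]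
  (net : EHNetwork Node Link Ch En)

/-- The part of the Lagrangian that depends on routing, power and harvesting. It is homogeneous in
the multipliers. -/
def flowTerm (a : SlotAction Node Link) (υ : Node → Node → ℝ) (ν : Node → ℝ) : ℝ :=
  ∑ n, ∑ c, υ n c * (net.outRate a.rate n c - net.inRate a.rate n c)
    + ∑ n, ν n * (a.harv n - net.spent a.pow n)

lemma lagr_eq (V : ℝ) (a : SlotAction Node Link) (υ : Node → Node → ℝ) (ν : Node → ℝ) :
    net.lagr V a υ ν
      = (∑ n, ∑ c, (V * net.U n c (a.adm n c) - υ n c * a.adm n c)) + net.flowTerm a υ ν := by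
  simp only [lagr, flowTerm, Utot, mul_add, mul_sub, Finset.sum_add_distrib,
    Finset.sum_sub_distrib, Finset.mul_sum]
  ring

lemma flowTerm_smul (t : ℝ) (a : SlotAction Node Link) (υ : Node → Node → ℝ) (ν : Node → ℝ) :
    net.flowTerm a (t • υ) (t • ν) = t * net.flowTerm a υ ν := by
  simp only [flowTerm, Pi.smul_apply, smul_eq_mul, mul_add, Finset.mul_sum, mul_assoc]

variable {net} in
lemma Admissible.replace_adm {s : Ch} {j : En} {a : SlotAction Node Link}
    (ha : net.Admissible s j a) {r : Node → Node → ℝ} (hr : ∀ n c, r n c ∈ Icc 0 net.Rmax) :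
    net.Admissible s j ⟨r, a.pow, a.rate, a.harv⟩ :=
  ⟨hr, ha.pow_mem, ha.rate_nonneg, ha.rate_le, ha.harv_mem⟩

/-- Second difference of the dual function of one state along a ray. The routing part is linear
along the ray and drops out, so only the movement of the optimal admission rates remains. -/
lemma dualAt_second_diff [Nonempty Node] {V ε : ℝ} (hV : 0 ≤ V) (hε : 0 < ε) (hε1 : ε < 1)
    (υ : Node → Node → ℝ) (ν : Node → ℝ) {r r' : Node → Node → ℝ}
    (hr : ∀ n c, r n c ∈ Icc 0 net.Rmax) (hr' : ∀ n c, r' n c ∈ Icc 0 net.Rmax)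
    (hmax : ∀ n c, ∀ t ∈ Icc 0 net.Rmax, V * net.U n c t - (1 + ε) * υ n c * t
      ≤ V * net.U n c (r n c) - (1 + ε) * υ n c * r n c)
    (hmax' : ∀ n c, ∀ t ∈ Icc 0 net.Rmax, V * net.U n c t - (1 - ε) * υ n c * t
      ≤ V * net.U n c (r' n c) - (1 - ε) * υ n c * r' n c) (s : Ch) (j : En) :
    net.dualAt V s j ((1 + ε) • υ) ((1 + ε) • ν) + net.dualAt V s j ((1 - ε) • υ) ((1 - ε) • ν)
      ≤ 2 * net.dualAt V s j υ ν + ε * ∑ n, ∑ c, υ n c * (r' n c - r n c) := by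
  rw [← le_sub_iff_add_le]
  refine net.dualAt_le s j fun a ha => ?_
  rw [le_sub_comm]
  refine net.dualAt_le s j fun a' ha' => ?_
  have hA : ∑ n, ∑ c, (V * net.U n c (a.adm n c) - (1 + ε) * υ n c * a.adm n c)
      ≤ ∑ n, ∑ c, (V * net.U n c (r n c) - (1 + ε) * υ n c * r n c) :=
    Finset.sum_le_sum fun n _ => Finset.sum_le_sum fun c _ => hmax n c _ (ha.adm_mem n c)
  have hA' : ∑ n, ∑ c, (V * net.U n c (a'.adm n c) - (1 - ε) * υ n c * a'.adm n c)
      ≤ ∑ n, ∑ c, (V * net.U n c (r' n c) - (1 - ε) * υ n c * r' n c) :=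
    Finset.sum_le_sum fun n _ => Finset.sum_le_sum fun c _ => hmax' n c _ (ha'.adm_mem n c)
  -- the better of the two routing decisions can be combined with both admission decisions
  have hcomb : ∃ b, net.Admissible s j b ∧ net.flowTerm a υ ν ≤ net.flowTerm b υ ν ∧
      net.flowTerm a' υ ν ≤ net.flowTerm b υ ν := by
    rcases le_total (net.flowTerm a υ ν) (net.flowTerm a' υ ν) with h | h
    exacts [⟨a', ha', h, le_rfl⟩, ⟨a, ha, le_rfl, h⟩]
  obtain ⟨b, hb, h1, h2⟩ := hcomb
  have h3 := (hb.replace_adm hr).lagr_le_dualAt hV υ ν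
  have h4 := (hb.replace_adm hr').lagr_le_dualAt hV υ ν
  rw [lagr_eq] at h3 h4
  rw [lagr_eq, lagr_eq, flowTerm_smul, flowTerm_smul]
  simp only [Pi.smul_apply, smul_eq_mul]
  have h5 : ∀ b r, net.flowTerm (⟨r, b.pow, b.rate, b.harv⟩ : SlotAction Node Link) υ ν
      = net.flowTerm b υ ν := fun _ _ => rfl
  rw [h5] at h3 h4
  have h6 := mul_le_mul_of_nonneg_left h1 (by linarith : (0 : ℝ) ≤ 1 + ε)
  have h7 := mul_le_mul_of_nonneg_left h2 (by linarith : (0 : ℝ) ≤ 1 - ε)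
  have e1 : ∑ n, ∑ c, (V * net.U n c (r n c) - (1 + ε) * υ n c * r n c)
      = ∑ n, ∑ c, (V * net.U n c (r n c) - υ n c * r n c) - ε * ∑ n, ∑ c, υ n c * r n c := by
    simp only [Finset.mul_sum, ← Finset.sum_sub_distrib]
    exact Finset.sum_congr rfl fun n _ => Finset.sum_congr rfl fun c _ => by ring
  have e2 : ∑ n, ∑ c, (V * net.U n c (r' n c) - (1 - ε) * υ n c * r' n c)
      = ∑ n, ∑ c, (V * net.U n c (r' n c) - υ n c * r' n c) + ε * ∑ n, ∑ c, υ n c * r' n c := by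
    simp only [Finset.mul_sum, ← Finset.sum_add_distrib]
    exact Finset.sum_congr rfl fun n _ => Finset.sum_congr rfl fun c _ => by ring
  have e3 : ∑ n, ∑ c, υ n c * (r' n c - r n c)
      = ∑ n, ∑ c, υ n c * r' n c - ∑ n, ∑ c, υ n c * r n c := by
    simp only [mul_sub, Finset.sum_sub_distrib]
  rw [e3]
  rw [e1] at hA
  rw [e2] at hA'
  linarith

lemma sum_weights_le {f g : Ch → En → ℝ} (h : ∀ s j, f s j ≤ g s j) :
    ∑ s, net.πCh s * ∑ j, net.πEn j * f s j ≤ ∑ s, net.πCh s * ∑ j, net.πEn j * g s j :=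
  Finset.sum_le_sum fun s _ => mul_le_mul_of_nonneg_left
    (Finset.sum_le_sum fun j _ => mul_le_mul_of_nonneg_left (h s j) (net.πEn_stat.nonneg j))
    (net.πCh_stat.nonneg s)

lemma sum_weights_const (x : ℝ) : ∑ s, net.πCh s * ∑ j, net.πEn j * x = x := by
  simp_rw [← Finset.sum_mul, net.πEn_stat.sum_one, net.πCh_stat.sum_one, one_mul]

lemma dual_second_diff [Nonempty Node] {V ε : ℝ} (hV : 0 ≤ V) (hε : 0 < ε) (hε1 : ε < 1)
    (υ : Node → Node → ℝ) (ν : Node → ℝ) {r r' : Node → Node → ℝ}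
    (hr : ∀ n c, r n c ∈ Icc 0 net.Rmax) (hr' : ∀ n c, r' n c ∈ Icc 0 net.Rmax)
    (hmax : ∀ n c, ∀ t ∈ Icc 0 net.Rmax, V * net.U n c t - (1 + ε) * υ n c * t
      ≤ V * net.U n c (r n c) - (1 + ε) * υ n c * r n c)
    (hmax' : ∀ n c, ∀ t ∈ Icc 0 net.Rmax, V * net.U n c t - (1 - ε) * υ n c * t
      ≤ V * net.U n c (r' n c) - (1 - ε) * υ n c * r' n c) :
    net.dual V ((1 + ε) • υ) ((1 + ε) • ν) + net.dual V ((1 - ε) • υ) ((1 - ε) • ν)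
      ≤ 2 * net.dual V υ ν + ε * ∑ n, ∑ c, υ n c * (r' n c - r n c) := by
  have h := net.sum_weights_le
    (net.dualAt_second_diff hV hε hε1 υ ν hr hr' hmax hmax')
  set x := ε * ∑ n, ∑ c, υ n c * (r' n c - r n c)
  have hx := net.sum_weights_const x
  simp only [mul_add, Finset.sum_add_distrib] at h
  have e : ∑ s, net.πCh s * ∑ j, net.πEn j * (2 * net.dualAt V s j υ ν)
      = 2 * net.dual V υ ν := by
    simp only [dual, Finset.mul_sum]
    exact Finset.sum_congr rfl fun s _ => Finset.sum_congr rfl fun j _ => by ring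
  rw [e, hx] at h
  exact h

lemma exists_adm_argmax {V x : ℝ} (n c : Node) : ∃ r ∈ Icc 0 net.Rmax, ∀ t ∈ Icc 0 net.Rmax,
    V * net.U n c t - x * t ≤ V * net.U n c r - x * r := by
  have hc : ContinuousOn (fun t => V * net.U n c t - x * t) (Icc 0 net.Rmax) :=
    (continuousOn_const.mul ((net.U_contDiff n c).continuousOn.mono Icc_subset_Ici_self)).sub
      (continuousOn_const.mul continuousOn_id)
  obtain ⟨r, hr, hmax⟩ := isCompact_Icc.exists_isMaxOn (nonempty_Icc.2 net.Rmax_nonneg) hc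
  exact ⟨r, hr, fun t ht => hmax ht⟩

/-- For small `ε` the optimal admission rates for the multipliers `(1 + ε) υ` and `(1 - ε) υ`
are close. -/
lemma exists_adm_close {V : ℝ} (hV : 0 < V) (υ : Node → Node → ℝ) {η : ℝ} (hη : 0 < η) :
    ∃ ε : ℝ, 0 < ε ∧ ε < 1 ∧ ∀ n c, ∀ r ∈ Icc 0 net.Rmax, ∀ r' ∈ Icc 0 net.Rmax,
      (∀ t ∈ Icc 0 net.Rmax, V * net.U n c t - (1 + ε) * υ n c * t
        ≤ V * net.U n c r - (1 + ε) * υ n c * r) →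
      (∀ t ∈ Icc 0 net.Rmax, V * net.U n c t - (1 - ε) * υ n c * t
        ≤ V * net.U n c r' - (1 - ε) * υ n c * r') → |r' - r| ≤ η := by
  have hconc : ∀ n c, StrictConcaveOn ℝ (Icc 0 net.Rmax)
      (fun t => V * net.U n c t - υ n c * t) := fun n c => by
    refine ⟨convex_Icc _ _, fun x hx y hy hxy a b ha hb hab => ?_⟩
    have := mul_lt_mul_of_pos_left ((net.U_strictConcave n c).2 (mem_Ici.2 hx.1) (mem_Ici.2 hy.1)
      hxy ha hb hab) hV
    simp only [smul_eq_mul] at this ⊢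
    linarith
  have hcont : ∀ n c, ContinuousOn (fun t => V * net.U n c t - υ n c * t) (Icc 0 net.Rmax) :=
    fun n c =>
      (continuousOn_const.mul ((net.U_contDiff n c).continuousOn.mono Icc_subset_Ici_self)).sub
        (continuousOn_const.mul continuousOn_id)
  choose ε₀ hε₀ hclose using fun p : Node × Node =>
    (hconc p.1 p.2).exists_argmax_close net.Rmax_nonneg (hcont p.1 p.2) (υ p.1 p.2) hη
  obtain ⟨ε, hε, hεmin⟩ : ∃ ε : ℝ, 0 < ε ∧ ∀ p, ε < min (ε₀ p) 1 := by
    rcases isEmpty_or_nonempty (Node × Node) with h | h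
    · exact ⟨1, one_pos, fun p => h.elim p⟩
    obtain ⟨p, -, hp⟩ := Finset.exists_min_image (Finset.univ : Finset (Node × Node))
      (fun p => min (ε₀ p) 1) Finset.univ_nonempty
    have : 0 < min (ε₀ p) 1 := lt_min (hε₀ p) one_pos
    exact ⟨min (ε₀ p) 1 / 2, by positivity, fun q =>
      (half_lt_self this).trans_le (hp q (Finset.mem_univ q))⟩
  refine ⟨min ε (1 / 2), by positivity, (min_le_right _ _).trans_lt (by norm_num), ?_⟩
  intro n c r hr r' hr' h1 h2
  refine hclose (n, c) (min ε (1 / 2)) (by positivity)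
    ((min_le_left _ _).trans_lt ((hεmin (n, c)).trans_le (min_le_left _ _))) r hr r' hr' ?_ ?_
  · intro t ht
    have := h1 t ht
    linarith
  · intro t ht
    have := h2 t ht
    linarith

omit [DecidableEq Node] in
lemma abs_coord_le_dualDist (υ : Node → Node → ℝ) (ν : Node → ℝ) (υ' : Node → Node → ℝ)
    (ν' : Node → ℝ) :
    (∀ n c, |υ n c - υ' n c| ≤ dualDist υ ν υ' ν') ∧ ∀ n, |ν n - ν' n| ≤ dualDist υ ν υ' ν' := by
  have h1 : 0 ≤ ∑ n, ∑ c, (υ n c - υ' n c) ^ 2 :=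
    Finset.sum_nonneg fun n _ => Finset.sum_nonneg fun c _ => sq_nonneg _
  have h2 : 0 ≤ ∑ n, (ν n - ν' n) ^ 2 := Finset.sum_nonneg fun n _ => sq_nonneg _
  refine ⟨fun n c => Real.abs_le_sqrt ?_, fun n => Real.abs_le_sqrt ?_⟩
  · have h3 := Finset.single_le_sum (f := fun c => (υ n c - υ' n c) ^ 2)
      (fun c _ => sq_nonneg _) (Finset.mem_univ c)
    have h4 := Finset.single_le_sum (f := fun n => ∑ c, (υ n c - υ' n c) ^ 2)
      (fun n _ => Finset.sum_nonneg fun c _ => sq_nonneg _) (Finset.mem_univ n)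
    linarith
  · have h3 := Finset.single_le_sum (f := fun n => (ν n - ν' n) ^ 2)
      (fun n _ => sq_nonneg _) (Finset.mem_univ n)
    linarith

/-- Along the ray through a minimizer the dual function is the sum of a linear function and of a
function that is differentiable by strict concavity of the utilities. So it cannot have a kink at
the minimizer, and linear growth leaves only the origin. -/
lemma minimizer_eq_zero [Nonempty Node] {V L : ℝ} (hV : 0 < V) (hL : 0 < L)
    {υs : Node → Node → ℝ} {νs : Node → ℝ} (hfeas : DualFeasible υs)
    (hgrow : ∀ (υ : Node → Node → ℝ) (ν : Node → ℝ), DualFeasible υ →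
      net.dual V υs νs + L * dualDist υs νs υ ν ≤ net.dual V υ ν) : υs = 0 ∧ νs = 0 := by
  have hray : ∀ t : ℝ, 0 ≤ t → DualFeasible (t • υs) := fun t ht =>
    ⟨fun n c => mul_nonneg ht (hfeas.1 n c), fun c => by simp [hfeas.2 c]⟩
  set S : ℝ := ∑ n, ∑ c, υs n c with hS
  have hS0 : 0 ≤ S := Finset.sum_nonneg fun n _ => Finset.sum_nonneg fun c _ => hfeas.1 n c
  have key : ∀ x : ℝ, (∀ t : ℝ, |t| * x ≤ dualDist υs νs ((1 + t) • υs) ((1 + t) • νs)) →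
      x ≤ 0 := by
    intro x hx
    by_contra! hx0
    obtain ⟨ε, hε, hε1, hclose⟩ := net.exists_adm_close hV υs
      (η := L * x / (S + 1)) (by positivity)
    choose r hr hrmax using fun n c =>
      net.exists_adm_argmax (V := V) (x := (1 + ε) * υs n c) n c
    choose r' hr' hrmax' using fun n c =>
      net.exists_adm_argmax (V := V) (x := (1 - ε) * υs n c) n c
    have h1 := net.dual_second_diff hV.le hε hε1 υs νs hr hr' hrmax hrmax'
    have h2 := hgrow _ ((1 + ε) • νs) (hray (1 + ε) (by linarith))
    have h3 := hgrow _ ((1 - ε) • νs) (hray (1 - ε) (by linarith))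
    have h4 := mul_le_mul_of_nonneg_left (hx ε) hL.le
    have h5 := mul_le_mul_of_nonneg_left (hx (-ε)) hL.le
    rw [← sub_eq_add_neg, abs_neg] at h5
    rw [abs_of_pos hε] at h4 h5
    have h6 : ∑ n, ∑ c, υs n c * (r' n c - r n c) ≤ L * x / (S + 1) * S := by
      rw [hS, Finset.mul_sum]
      refine Finset.sum_le_sum fun n _ => ?_
      rw [Finset.mul_sum]
      refine Finset.sum_le_sum fun c _ => ?_
      rw [mul_comm]
      exact mul_le_mul_of_nonneg_right ((le_abs_self _).trans
        (hclose n c _ (hr n c) _ (hr' n c) (hrmax n c) (hrmax' n c))) (hfeas.1 n c)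
    have h7 : L * x / (S + 1) * S ≤ L * x := by
      rw [div_mul_eq_mul_div, div_le_iff₀ (by linarith)]
      have : 0 < L * x := by positivity
      nlinarith
    have h8 := mul_le_mul_of_nonneg_left (h6.trans h7) hε.le
    have h9 : 0 < ε * (L * x) := by positivity
    linarith
  constructor
  · ext n c
    have := key |υs n c| fun t => by
      have := (abs_coord_le_dualDist υs νs ((1 + t) • υs) ((1 + t) • νs)).1 n c
      rwa [show υs n c - ((1 + t) • υs) n c = -(t * υs n c) by
        simp only [Pi.smul_apply, smul_eq_mul]; ring, abs_neg, abs_mul] at this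
    exact abs_nonpos_iff.1 this
  · ext n
    have := key |νs n| fun t => by
      have := (abs_coord_le_dualDist υs νs ((1 + t) • υs) ((1 + t) • νs)).2 n
      rwa [show νs n - ((1 + t) • νs) n = -(t * νs n) by
        simp only [Pi.smul_apply, smul_eq_mul]; ring, abs_neg, abs_mul] at this
    exact abs_nonpos_iff.1 this

/-- The dual function grows linearly away from the origin, where it equals `V` times the utility
of full admission. -/
lemma dual_ge [Nonempty Node] {V L : ℝ} (hV : 0 < V) (hL : 0 < L)
    {υs : Node → Node → ℝ} {νs : Node → ℝ} (hfeas : DualFeasible υs)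
    (hgrow : ∀ (υ : Node → Node → ℝ) (ν : Node → ℝ), DualFeasible υ →
      net.dual V υs νs + L * dualDist υs νs υ ν ≤ net.dual V υ ν)
    {υ : Node → Node → ℝ} {ν : Node → ℝ} (hυ : DualFeasible υ) :
    V * net.maxUtility + L * ‖(υ, ν)‖ ≤ net.dual V υ ν := by
  obtain ⟨rfl, rfl⟩ := net.minimizer_eq_zero hV hL hfeas hgrow
  refine le_trans (add_le_add ?_ ?_) (hgrow υ ν hυ)
  · simp only [dual, net.dualAt_zero hV.le, net.sum_weights_const, le_refl]
  · refine mul_le_mul_of_nonneg_left ?_ hL.le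
    obtain ⟨h1, h2⟩ := abs_coord_le_dualDist 0 0 υ ν
    have h0 : 0 ≤ dualDist 0 0 υ ν := Real.sqrt_nonneg _
    simp only [Pi.zero_apply, zero_sub, abs_neg] at h1 h2
    rw [Prod.norm_mk]
    exact max_le ((pi_norm_le_iff_of_nonneg h0).2 fun n =>
      (pi_norm_le_iff_of_nonneg h0).2 fun c => h1 n c) ((pi_norm_le_iff_of_nonneg h0).2 h2)

end EHNetwork

/-! ### One slot of ESA -/

namespace EHNetwork

variable {Node Link Ch En : Type*} [Fintype Node] [DecidableEq Node] [Fintype Link]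
  [DecidableEq Link] [Fintype Ch] [DecidableEq Ch] [Fintype En] [DecidableEq En]
  (net : EHNetwork Node Link Ch En)

/-- The range in which ESA keeps the data queues. -/
def QueueRange (V : ℝ) (Q : Node → Node → ℝ) : Prop :=
  (∀ n c, Q n c ∈ Icc 0 (net.β * V + net.Rmax)) ∧ ∀ c, Q c c = 0

lemma sum_src_eq (f : Node → ℝ) (P : Link → ℝ) :
    ∑ n, f n * net.spent P n = ∑ l, f (net.src l) * P l := by
  simp only [spent, Finset.mul_sum, Finset.sum_filter]
  rw [Finset.sum_comm]
  exact Finset.sum_congr rfl fun l _ => by simp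

lemma sum_flow_eq (Q : Node → Node → ℝ) (m : Link → Node → ℝ) :
    ∑ n, ∑ c, Q n c * (net.outRate m n c - net.inRate m n c)
      = ∑ l, ∑ c, m l c * (Q (net.src l) c - Q (net.dst l) c) := by
  have h : ∀ (g : Link → Node), ∑ n, ∑ c, Q n c * ∑ l with g l = n, m l c
      = ∑ l, ∑ c, m l c * Q (g l) c := by
    intro g
    rw [Finset.sum_comm, Finset.sum_comm (s := (Finset.univ : Finset Link))]
    refine Finset.sum_congr rfl fun c _ => ?_
    simp only [Finset.mul_sum, Finset.sum_filter]
    rw [Finset.sum_comm]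
    refine Finset.sum_congr rfl fun l _ => ?_
    simp [mul_comm]
  simp only [mul_sub, Finset.sum_sub_distrib, outRate, inRate, h]

lemma weight_le_iSup (Q : Node → Node → ℝ) (l : Link) (c : Node) :
    net.weight Q l c ≤ ⨆ c, net.weight Q l c :=
  le_ciSup (Set.finite_range _).bddAbove c

lemma weight_nonneg (Q : Node → Node → ℝ) (l : Link) (c : Node) : 0 ≤ net.weight Q l c :=
  le_max_right _ _

lemma iSup_weight_nonneg (Q : Node → Node → ℝ) (l : Link) : 0 ≤ ⨆ c, net.weight Q l c :=
  Real.iSup_nonneg fun c => net.weight_nonneg Q l c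

variable {net}

lemma QueueRange.iSup_weight_le [Nonempty Node] {V : ℝ} (hV : 0 ≤ V) {Q : Node → Node → ℝ}
    (hQ : net.QueueRange V Q) (l : Link) : ⨆ c, net.weight Q l c ≤ net.β * V := by
  refine ciSup_le fun c => max_le ?_ (mul_nonneg net.β_pos.le hV)
  have h1 := (hQ.1 (net.src l) c).2
  have h2 := (hQ.1 (net.dst l) c).1
  have h3 := net.Rmax_le_γ
  linarith

section Action

variable {V : ℝ} {θ : Node → ℝ} {Q : Node → Node → ℝ} {E : Node → ℝ} {s : Ch} {j : En}
  {a : SlotAction Node Link}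

lemma IsESAAction.admissible (h : net.IsESAAction V θ Q E s j a) : net.Admissible s j a where
  adm_mem := h.adm_mem
  pow_mem := h.pow_mem
  rate_nonneg l c := by
    obtain ⟨c', -, h0, h1⟩ := h.routing l
    by_cases hc : c = c'
    · rw [hc, h1]
      split_ifs
      exacts [net.mu_nonneg s _ h.pow_mem l, le_rfl]
    · rw [h0 c hc]
  rate_le l := by
    obtain ⟨c', -, h0, h1⟩ := h.routing l
    rw [Finset.sum_eq_single c' (fun c _ hc => h0 c hc) (by simp), h1]
    split_ifs
    exacts [le_rfl, net.mu_nonneg s _ h.pow_mem l]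
  harv_mem n := by
    rw [h.harvest n]
    split_ifs
    exacts [⟨net.h_nonneg j n, le_rfl⟩, ⟨le_rfl, net.h_nonneg j n⟩]

lemma IsESAAction.lt_of_rate_ne_zero (h : net.IsESAAction V θ Q E s j a) {l : Link} {c : Node}
    (hr : a.rate l c ≠ 0) : net.γ < Q (net.src l) c - Q (net.dst l) c := by
  obtain ⟨c', -, h0, h1⟩ := h.routing l
  have hc : c = c' := by
    by_contra hc
    exact hr (h0 c hc)
  subst hc
  have hw : 0 < net.weight Q l c := by
    by_contra hw
    rw [if_neg hw] at h1
    exact hr h1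
  rw [weight, lt_max_iff] at hw
  rcases hw with hw | hw
  · linarith
  · exact absurd hw (lt_irrefl _)

lemma IsESAAction.le_sum_rate (h : net.IsESAAction V θ Q E s j a) (l : Link) :
    net.mu s a.pow l * (⨆ c, net.weight Q l c)
      ≤ ∑ c, a.rate l c * (Q (net.src l) c - Q (net.dst l) c) := by
  have hadm := h.admissible
  obtain ⟨c', hmax, h0, h1⟩ := h.routing l
  have : Nonempty Node := ⟨c'⟩
  have hsup : ⨆ c, net.weight Q l c = net.weight Q l c' :=
    le_antisymm (ciSup_le hmax) (net.weight_le_iSup Q l c')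
  rw [Finset.sum_eq_single c' (fun c _ hc => by rw [h0 c hc, zero_mul]) (by simp), hsup, h1]
  split_ifs with hw
  · refine mul_le_mul_of_nonneg_left ?_ (net.mu_nonneg s _ h.pow_mem l)
    rw [weight, lt_max_iff] at hw
    have hw' := hw.resolve_right (lt_irrefl _)
    rw [weight, max_eq_left hw'.le]
    linarith [net.γ_nonneg]
  · rw [le_antisymm (not_lt.1 hw) (net.weight_nonneg Q l c')]
    simp

lemma IsESAAction.adm_eq_zero (h : net.IsESAAction V θ Q E s j a) (hV : 0 ≤ V) {n c : Node}
    (hQ : net.β * V < Q n c) : a.adm n c = 0 := by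
  have h1 := h.adm_max n c 0 ⟨le_rfl, net.Rmax_nonneg⟩
  have h2 := net.U_sub_le (n := n) (c := c) le_rfl (h.adm_mem n c).1
  rw [net.U_zero, sub_zero, sub_zero] at h2
  rw [net.U_zero, mul_zero, mul_zero, sub_zero] at h1
  have h3 := mul_le_mul_of_nonneg_left h2 hV
  have h4 := (h.adm_mem n c).1
  by_contra hne
  have h5 : 0 < a.adm n c := lt_of_le_of_ne h4 (Ne.symm hne)
  nlinarith

/-- ESA admits as much data as possible into short queues. -/
lemma IsESAAction.adm_eq_Rmax (h : net.IsESAAction V θ Q E s j a) (hV : 0 ≤ V) {n c : Node} {m : ℝ}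
    (hm : ∀ r ∈ Icc 0 net.Rmax, m * (net.Rmax - r) ≤ net.U n c net.Rmax - net.U n c r)
    (hQ : Q n c < m * V) : a.adm n c = net.Rmax := by
  have h1 := h.adm_max n c net.Rmax ⟨net.Rmax_nonneg, le_rfl⟩
  have h2 := mul_le_mul_of_nonneg_left (hm _ (h.adm_mem n c)) hV
  by_contra hne
  have h3 : a.adm n c < net.Rmax := lt_of_le_of_ne (h.adm_mem n c).2 hne
  nlinarith

/-- A queue only receives data from a neighbour when it is by `γ` shorter, and it admits no new
data when it exceeds `β V`. -/
lemma IsESAAction.queueRange_nextQ (h : net.IsESAAction V θ Q E s j a) [Nonempty Node]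
    (hV : 0 ≤ V) (hQ : net.QueueRange V Q) : net.QueueRange V (net.nextQ Q a) := by
  have hadm := h.admissible
  have hβV := mul_nonneg net.β_pos.le hV
  refine ⟨fun n c => ?_, fun c => by simp [nextQ]⟩
  rw [nextQ]
  split_ifs with hnc
  · exact ⟨le_rfl, add_nonneg hβV net.Rmax_nonneg⟩
  have hin := net.inRate_nonneg hadm.rate_nonneg n c
  have hout := net.outRate_nonneg hadm.rate_nonneg n c
  have hm : max (Q n c - net.outRate a.rate n c) 0 ≤ Q n c :=
    max_le (by linarith) (hQ.1 n c).1
  have hm0 : 0 ≤ max (Q n c - net.outRate a.rate n c) 0 := le_max_right _ _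
  have hr := h.adm_mem n c
  refine ⟨by linarith [hr.1], ?_⟩
  by_cases hall : ∀ l, net.dst l = n → a.rate l c = 0
  · have hzero : net.inRate a.rate n c = 0 :=
      Finset.sum_eq_zero fun l hl => hall l (Finset.mem_filter.1 hl).2
    rw [hzero]
    rcases le_or_gt (Q n c) (net.β * V) with hle | hgt
    · linarith [hr.2]
    · rw [h.adm_eq_zero hV hgt]
      linarith [(hQ.1 n c).2]
  · push Not at hall
    obtain ⟨l, hl, hne⟩ := hall
    have h1 := h.lt_of_rate_ne_zero hne
    rw [hl] at h1
    have h2 := (hQ.1 (net.src l) c).2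
    have h3 : net.inRate a.rate n c ≤ net.dmax * net.muMax := by
      refine (Finset.sum_le_sum fun l _ => hadm.rate_le_muMax l c).trans ?_
      rw [Finset.sum_const, nsmul_eq_mul]
      refine mul_le_mul_of_nonneg_right ?_ (net.muMax_nonneg l)
      exact_mod_cast Finset.le_sup
        (f := fun n => (Finset.univ.filter fun l => net.dst l = n).card) (Finset.mem_univ n)
    have h4 : net.γ = net.Rmax + net.dmax * net.muMax := rfl
    linarith [hr.2]

/-- Switching off a link at a node that is short of energy does not decrease the objective of
the power allocation. -/
lemma powObj_le_update [Nonempty Node] (hV : 0 ≤ V) (hQ : net.QueueRange V Q)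
    (hθ : ∀ n, net.δ * net.β * V + net.Pmax ≤ θ n) {P : Link → ℝ} (hP : P ∈ net.PowSet s)
    {l : Link} (hl : E (net.src l) < net.Pmax) :
    net.powObj θ Q E s P ≤ net.powObj θ Q E s (Function.update P l 0) := by
  set W : Link → ℝ := fun l => ⨆ c, net.weight Q l c with hW
  have h1 : ∑ l', net.mu s P l' * W l'
      ≤ ∑ l', (net.mu s (Function.update P l 0) l' * W l'
        + if l' = l then net.δ * P l * W l else 0) := by
    refine Finset.sum_le_sum fun l' _ => ?_
    split_ifs with hll
    · subst hll
      have := mul_le_mul_of_nonneg_right (net.mu_property1 s P hP l') (net.iSup_weight_nonneg Q l')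
      linarith
    · rw [add_zero]
      exact mul_le_mul_of_nonneg_right (net.mu_property2 s P hP l l' hll)
        (net.iSup_weight_nonneg Q l')
  rw [Finset.sum_add_distrib, Finset.sum_ite_eq' Finset.univ l] at h1
  simp only [Finset.mem_univ, if_true] at h1
  have h2 : ∑ l', (E (net.src l') - θ (net.src l')) * P l'
      = ∑ l', ((E (net.src l') - θ (net.src l')) * Function.update P l 0 l'
        + if l' = l then (E (net.src l) - θ (net.src l)) * P l else 0) := by
    refine Finset.sum_congr rfl fun l' _ => ?_
    split_ifs with hll
    · subst hll
      simp
    · simp [Function.update_of_ne hll]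
  rw [Finset.sum_add_distrib, Finset.sum_ite_eq' Finset.univ l] at h2
  simp only [Finset.mem_univ, if_true] at h2
  rw [powObj, powObj, net.sum_src_eq (fun n => E n - θ n), net.sum_src_eq (fun n => E n - θ n), h2]
  have h3 : net.δ * P l * W l ≤ (θ (net.src l) - E (net.src l)) * P l := by
    have hPl := net.pow_nonneg s P hP l
    have h4 : net.δ * W l ≤ net.δ * (net.β * V) :=
      mul_le_mul_of_nonneg_left (hQ.iSup_weight_le hV l) net.δ_pos.le
    have h5 : net.δ * W l ≤ θ (net.src l) - E (net.src l) := by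
      linarith [hθ (net.src l)]
    have := mul_le_mul_of_nonneg_right h5 hPl
    linarith
  linarith

/-- The energy-availability constraint costs nothing: the power allocation of ESA is optimal among
all feasible power vectors. -/
lemma IsESAAction.powObj_le (h : net.IsESAAction V θ Q E s j a) [Nonempty Node] (hV : 0 ≤ V)
    (hQ : net.QueueRange V Q) (hθ : ∀ n, net.δ * net.β * V + net.Pmax ≤ θ n) {P : Link → ℝ}
    (hP : P ∈ net.PowSet s) : net.powObj θ Q E s P ≤ net.powObj θ Q E s a.pow := by
  have key : ∀ t : Finset Link, (∀ l ∈ t, E (net.src l) < net.Pmax) →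
      ∃ P' ∈ net.PowSet s, (∀ l ∈ t, P' l = 0) ∧ net.powObj θ Q E s P ≤ net.powObj θ Q E s P' := by
    intro t
    induction t using Finset.induction_on with
    | empty => exact fun _ => ⟨P, hP, by simp, le_rfl⟩
    | insert l t hlt ih =>
      intro ht
      obtain ⟨P', hP', hz, hle⟩ := ih fun l' hl' => ht l' (Finset.mem_insert_of_mem hl')
      refine ⟨Function.update P' l 0, net.pow_update s P' hP' l, fun l' hl' => ?_,
        hle.trans (powObj_le_update hV hQ hθ hP' (ht l (Finset.mem_insert_self l t)))⟩
      by_cases hll : l' = l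
      · subst hll
        simp
      · rw [Function.update_of_ne hll]
        exact hz l' ((Finset.mem_insert.1 hl').resolve_left hll)
  obtain ⟨P', hP', hz, hle⟩ := key (Finset.univ.filter fun l => E (net.src l) < net.Pmax)
    (fun l hl => (Finset.mem_filter.1 hl).2)
  refine hle.trans (h.pow_max P' hP' fun n => ?_)
  rcases lt_or_ge (E n) net.Pmax with hn | hn
  · have : net.spent P' n = 0 := Finset.sum_eq_zero fun l hl =>
      hz l (Finset.mem_filter.2 ⟨Finset.mem_univ l, by rwa [(Finset.mem_filter.1 hl).2]⟩)
    rw [this]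
    exact (h.admissible.spent_nonneg n).trans (h.energy_available n)
  · exact (net.pow_le s P' hP' n).trans hn

/-- ESA maximizes the one-slot Lagrangian up to a constant, at the multipliers given by its queues.
The constant comes from the shift by `γ` in the weights. -/
lemma IsESAAction.dualAt_le (h : net.IsESAAction V θ Q E s j a) [Nonempty Node] (hV : 0 ≤ V)
    (hQ : net.QueueRange V Q) (hθ : ∀ n, net.δ * net.β * V + net.Pmax ≤ θ n) :
    net.dualAt V s j Q (fun n => θ n - E n)
      ≤ net.lagr V a Q (fun n => θ n - E n) + net.γ * net.totalRate := by
  refine net.dualAt_le s j fun b hb => ?_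
  rw [lagr_eq, lagr_eq, flowTerm, flowTerm, sum_flow_eq, sum_flow_eq]
  have h1 : ∑ n, ∑ c, (V * net.U n c (b.adm n c) - Q n c * b.adm n c)
      ≤ ∑ n, ∑ c, (V * net.U n c (a.adm n c) - Q n c * a.adm n c) :=
    Finset.sum_le_sum fun n _ => Finset.sum_le_sum fun c _ => h.adm_max n c _ (hb.adm_mem n c)
  have h2 : ∑ n, (θ n - E n) * b.harv n ≤ ∑ n, (θ n - E n) * a.harv n := by
    refine Finset.sum_le_sum fun n _ => ?_
    have hbn := hb.harv_mem n
    rw [h.harvest n]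
    split_ifs with hE
    · exact mul_le_mul_of_nonneg_left hbn.2 (by linarith)
    · rw [mul_zero]
      exact mul_nonpos_of_nonpos_of_nonneg (by linarith) hbn.1
  have h3 : ∑ l, ∑ c, b.rate l c * (Q (net.src l) c - Q (net.dst l) c)
      ≤ ∑ l, net.mu s b.pow l * (⨆ c, net.weight Q l c) + net.γ * net.totalRate := by
    have hl : ∀ l, ∑ c, b.rate l c * (Q (net.src l) c - Q (net.dst l) c)
        ≤ net.mu s b.pow l * (⨆ c, net.weight Q l c) + net.γ * net.muMax := by
      intro l
      have hW := net.iSup_weight_nonneg Q l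
      have hr : ∀ c, b.rate l c * (Q (net.src l) c - Q (net.dst l) c)
          ≤ b.rate l c * ((⨆ c, net.weight Q l c) + net.γ) := fun c => by
        refine mul_le_mul_of_nonneg_left ?_ (hb.rate_nonneg l c)
        have := (le_max_left _ _).trans (net.weight_le_iSup Q l c)
        linarith
      refine (Finset.sum_le_sum fun c _ => hr c).trans ?_
      rw [← Finset.sum_mul]
      refine (mul_le_mul_of_nonneg_right (hb.rate_le l)
        (add_nonneg hW net.γ_nonneg)).trans ?_
      have := mul_le_mul_of_nonneg_left (net.mu_le s b.pow hb.pow_mem l) net.γ_nonneg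
      linarith
    refine (Finset.sum_le_sum fun l _ => hl l).trans (le_of_eq ?_)
    rw [Finset.sum_add_distrib, Finset.sum_const, Finset.card_univ, nsmul_eq_mul, totalRate]
    ring
  have h4 := h.powObj_le hV hQ hθ hb.pow_mem
  have h5 : ∑ l, net.mu s a.pow l * (⨆ c, net.weight Q l c)
      ≤ ∑ l, ∑ c, a.rate l c * (Q (net.src l) c - Q (net.dst l) c) :=
    Finset.sum_le_sum fun l _ => h.le_sum_rate l
  rw [powObj, powObj] at h4
  have h6 : ∀ P, ∑ n, (E n - θ n) * net.spent P n = -∑ n, (θ n - E n) * net.spent P n := fun P => by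
    rw [← Finset.sum_neg_distrib]
    exact Finset.sum_congr rfl fun n _ => by ring
  rw [h6, h6] at h4
  have h7 : ∀ b : SlotAction Node Link, ∑ n, (θ n - E n) * (b.harv n - net.spent b.pow n)
      = ∑ n, (θ n - E n) * b.harv n - ∑ n, (θ n - E n) * net.spent b.pow n := fun b => by
    simp only [mul_sub, Finset.sum_sub_distrib]
  rw [h7, h7]
  linarith

end Action

/-! ### The queues as a point of the multiplier space -/

/-- The point of the multiplier space that corresponds to the queues `Q` and `E`. -/
def queuePoint (θ : Node → ℝ) (Q : Node → Node → ℝ) (E : Node → ℝ) :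
    (Node → Node → ℝ) × (Node → ℝ) := (Q, fun n => θ n - E n)

/-- Square of the Euclidean norm. -/
def sqNorm (y : (Node → Node → ℝ) × (Node → ℝ)) : ℝ := ∑ n, ∑ c, y.1 n c ^ 2 + ∑ n, y.2 n ^ 2

section SqNorm

omit [DecidableEq Node]

lemma abs_fst_le (y : (Node → Node → ℝ) × (Node → ℝ)) (n c : Node) : |y.1 n c| ≤ ‖y‖ :=
  ((norm_le_pi_norm (y.1 n) c).trans (norm_le_pi_norm y.1 n)).trans (norm_fst_le y)

lemma abs_snd_le (y : (Node → Node → ℝ) × (Node → ℝ)) (n : Node) : |y.2 n| ≤ ‖y‖ :=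
  (norm_le_pi_norm y.2 n).trans (norm_snd_le y)

lemma norm_le_of_abs_le {y : (Node → Node → ℝ) × (Node → ℝ)} {x : ℝ} (hx : 0 ≤ x)
    (h₁ : ∀ n c, |y.1 n c| ≤ x) (h₂ : ∀ n, |y.2 n| ≤ x) : ‖y‖ ≤ x :=
  max_le ((pi_norm_le_iff_of_nonneg hx).2 fun n => (pi_norm_le_iff_of_nonneg hx).2 fun c => h₁ n c)
    ((pi_norm_le_iff_of_nonneg hx).2 h₂)

lemma norm_sq_le_sqNorm (y : (Node → Node → ℝ) × (Node → ℝ)) : ‖y‖ ^ 2 ≤ sqNorm y := by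
  have h1 : 0 ≤ ∑ n, ∑ c, y.1 n c ^ 2 :=
    Finset.sum_nonneg fun n _ => Finset.sum_nonneg fun c _ => sq_nonneg _
  have h2 : 0 ≤ ∑ n, y.2 n ^ 2 := Finset.sum_nonneg fun n _ => sq_nonneg _
  have h0 : 0 ≤ sqNorm y := add_nonneg h1 h2
  have : ‖y‖ ≤ Real.sqrt (sqNorm y) := by
    refine norm_le_of_abs_le (Real.sqrt_nonneg _) (fun n c => Real.abs_le_sqrt ?_)
      (fun n => Real.abs_le_sqrt ?_)
    · have h3 := Finset.single_le_sum (f := fun c => y.1 n c ^ 2)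
        (fun c _ => sq_nonneg _) (Finset.mem_univ c)
      have h4 := Finset.single_le_sum (f := fun n => ∑ c, y.1 n c ^ 2)
        (fun n _ => Finset.sum_nonneg fun c _ => sq_nonneg _) (Finset.mem_univ n)
      rw [sqNorm]
      linarith
    · have h3 := Finset.single_le_sum (f := fun n => y.2 n ^ 2)
        (fun n _ => sq_nonneg _) (Finset.mem_univ n)
      rw [sqNorm]
      linarith
  calc ‖y‖ ^ 2 ≤ Real.sqrt (sqNorm y) ^ 2 := pow_le_pow_left₀ (norm_nonneg y) this 2
    _ = sqNorm y := Real.sq_sqrt h0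

lemma sqNorm_sub_le (y y' : (Node → Node → ℝ) × (Node → ℝ)) :
    |sqNorm y' - sqNorm y| ≤ dim Node * (‖y‖ + ‖y'‖) * ‖y' - y‖ := by
  have h := abs_pairing_le (υ := (y' - y).1) (ν := (y' - y).2) (d := (y' + y).1) (e := (y' + y).2)
    (b := ‖y‖ + ‖y'‖)
    (fun n c => (abs_fst_le (y' + y) n c).trans ((norm_add_le _ _).trans (add_comm _ _).le))
    (fun n => (abs_snd_le (y' + y) n).trans ((norm_add_le _ _).trans (add_comm _ _).le))
  convert h using 2
  simp only [sqNorm, Prod.fst_sub, Prod.snd_sub, Prod.fst_add, Prod.snd_add, Pi.sub_apply,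
    Pi.add_apply]
  rw [add_sub_add_comm]
  simp only [← Finset.sum_sub_distrib]
  congr 1
  · exact Finset.sum_congr rfl fun n _ => Finset.sum_congr rfl fun c _ => by ring
  · exact Finset.sum_congr rfl fun n _ => by ring

lemma sqNorm_le (y : (Node → Node → ℝ) × (Node → ℝ)) : sqNorm y ≤ dim Node * ‖y‖ ^ 2 := by
  have h := sqNorm_sub_le 0 y
  have h0 : sqNorm (0 : (Node → Node → ℝ) × (Node → ℝ)) = 0 := by simp [sqNorm]
  rw [h0, sub_zero, sub_zero, norm_zero, zero_add] at h
  linarith [le_abs_self (sqNorm y)]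

end SqNorm

section Step

variable {V : ℝ} {θ : Node → ℝ} {Q : Node → Node → ℝ} {E : Node → ℝ} {s : Ch} {j : En}
  {a : SlotAction Node Link}

lemma Admissible.norm_step_le [Nonempty Node] (ha : net.Admissible s j a)
    (hQ : ∀ n c, 0 ≤ Q n c) (hd : ∀ c, Q c c = 0) :
    ‖queuePoint θ (net.nextQ Q a) (net.nextE E a) - queuePoint θ Q E‖ ≤ net.stepBound := by
  refine norm_le_of_abs_le net.stepBound_nonneg (fun n c => ?_) (fun n => ?_)
  · change |net.nextQ Q a n c - Q n c| ≤ _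
    rw [nextQ]
    split_ifs with hnc
    · rw [hnc, hd, sub_zero, abs_zero]
      exact net.stepBound_nonneg
    have h1 := ha.adm_mem n c
    have h2 := ha.inRate_le n c
    have h3 := ha.outRate_le n c
    have h4 := net.inRate_nonneg ha.rate_nonneg n c
    have h5 := net.outRate_nonneg ha.rate_nonneg n c
    have h6 := net.Pmax_nonneg
    have h7 := net.hmax_nonneg
    have h8 := net.Rmax_nonneg
    have h9 : max (Q n c - net.outRate a.rate n c) 0 ≤ Q n c := max_le (by linarith) (hQ n c)
    have h10 := le_max_left (Q n c - net.outRate a.rate n c) 0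
    rw [stepBound, abs_le]
    constructor <;> linarith [h1.1, h1.2]
  · change |(θ n - net.nextE E a n) - (θ n - E n)| ≤ _
    rw [nextE, show θ n - (E n - net.spent a.pow n + a.harv n) - (θ n - E n)
      = net.spent a.pow n - a.harv n by ring]
    exact ha.abs_energy_le n

lemma Admissible.sqNorm_step_le [Nonempty Node] (ha : net.Admissible s j a)
    (hQ : ∀ n c, 0 ≤ Q n c) (hd : ∀ c, Q c c = 0) :
    sqNorm (queuePoint θ (net.nextQ Q a) (net.nextE E a))
      ≤ sqNorm (queuePoint θ Q E) + 2 * (V * net.Utot a.adm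
        - net.lagr V a Q (fun n => θ n - E n)) + 2 * (dim Node * net.stepBound ^ 2) := by
  have h1 : ∀ n c, net.nextQ Q a n c ^ 2 ≤ Q n c ^ 2
      + 2 * (Q n c * (a.adm n c + net.inRate a.rate n c - net.outRate a.rate n c))
      + 2 * net.stepBound ^ 2 := by
    intro n c
    rw [nextQ]
    split_ifs with hnc
    · rw [hnc, hd]
      simp only [zero_mul, mul_zero, zero_pow two_ne_zero, zero_add]
      positivity
    have h1 := ha.adm_mem n c
    have h2 := ha.inRate_le n c
    have h3 := ha.outRate_le n c
    have h4 := net.inRate_nonneg ha.rate_nonneg n c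
    have h5 := net.outRate_nonneg ha.rate_nonneg n c
    have h6 := net.Pmax_nonneg
    have h7 := net.hmax_nonneg
    have h8 := net.Rmax_nonneg
    set o := net.outRate a.rate n c
    set i := net.inRate a.rate n c + a.adm n c with hi
    have hi0 : 0 ≤ i := add_nonneg h4 h1.1
    have hib : i ≤ net.stepBound := by rw [stepBound]; linarith [h1.2]
    have hob : o ≤ net.stepBound := by rw [stepBound]; linarith [h1.2]
    have hm1 : max (Q n c - o) 0 ≤ Q n c := max_le (by linarith) (hQ n c)
    have hm2 : max (Q n c - o) 0 ^ 2 ≤ (Q n c - o) ^ 2 := by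
      rcases max_cases (Q n c - o) 0 with ⟨h, -⟩ | ⟨h, -⟩
      · rw [h]
      · rw [h]
        nlinarith [sq_nonneg (Q n c - o)]
    have hi2 : i ^ 2 ≤ net.stepBound ^ 2 := pow_le_pow_left₀ hi0 hib 2
    have ho2 : o ^ 2 ≤ net.stepBound ^ 2 := pow_le_pow_left₀ h5 hob 2
    have hmi := mul_le_mul_of_nonneg_right hm1 hi0
    rw [add_assoc, ← hi]
    nlinarith
  have h2 : ∀ n, (θ n - net.nextE E a n) ^ 2 ≤ (θ n - E n) ^ 2
      + 2 * ((θ n - E n) * (net.spent a.pow n - a.harv n)) + 2 * net.stepBound ^ 2 := by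
    intro n
    have h3 := ha.abs_energy_le n
    have h4 : (net.spent a.pow n - a.harv n) ^ 2 ≤ net.stepBound ^ 2 := by
      rw [← sq_abs]
      exact pow_le_pow_left₀ (abs_nonneg _) h3 2
    rw [nextE]
    nlinarith [sq_nonneg net.stepBound]
  have h3 := Finset.sum_le_sum fun n (_ : n ∈ Finset.univ) =>
    Finset.sum_le_sum fun c (_ : c ∈ Finset.univ) => h1 n c
  have h4 := Finset.sum_le_sum fun n (_ : n ∈ Finset.univ) => h2 n
  simp only [Finset.sum_add_distrib, ← Finset.mul_sum, Finset.sum_const, Finset.card_univ,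
    nsmul_eq_mul] at h3 h4
  simp only [sqNorm, queuePoint, lagr, dim]
  linarith

/-- Drift of the squared distance from the origin in one slot of ESA. -/
lemma IsESAAction.sqNorm_step_le (h : net.IsESAAction V θ Q E s j a) [Nonempty Node] (hV : 0 ≤ V)
    (hQ : net.QueueRange V Q) (hθ : ∀ n, net.δ * net.β * V + net.Pmax ≤ θ n) :
    sqNorm (queuePoint θ (net.nextQ Q a) (net.nextE E a))
      ≤ sqNorm (queuePoint θ Q E)
        - 2 * (net.dualAt V s j Q (fun n => θ n - E n) - V * net.maxUtility)
        + 2 * (net.γ * net.totalRate + dim Node * net.stepBound ^ 2) := by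
  have h1 := h.admissible.sqNorm_step_le (V := V) (θ := θ) (E := E) (fun n c => (hQ.1 n c).1) hQ.2
  have h2 := h.dualAt_le hV hQ hθ
  have h3 := mul_le_mul_of_nonneg_left (net.Utot_le_maxUtility h.adm_mem) hV
  linarith

end Step

end EHNetwork

/-! ### From quadratic drift to geometric drift of an exponential -/

/-- A bounded increment with negative mean makes a small exponential contract on average. -/
lemma sum_exp_le {Z : Type*} [Fintype Z] {p x : Z → ℝ} (hp : ∀ z, 0 ≤ p z) (hp1 : ∑ z, p z = 1)
    {m ε : ℝ} (hε : 0 < ε) (hεm : ε ≤ m) (hx : ∀ z, |x z| ≤ m) (hmean : ∑ z, p z * x z ≤ -ε) :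
    ∑ z, p z * Real.exp (ε / (2 * m ^ 2) * x z) ≤ 1 - ε / (2 * m ^ 2) * ε / 2 := by
  have hm : 0 < m := hε.trans_le hεm
  set κ := ε / (2 * m ^ 2) with hκ
  have hκ0 : 0 < κ := by positivity
  have hκm2 : κ ^ 2 * m ^ 2 = κ * ε / 2 := by
    rw [hκ]
    field_simp
  have hκm : κ * m ≤ 1 := by
    rw [hκ, div_mul_eq_mul_div, div_le_one (by positivity)]
    nlinarith
  have h1 : ∀ z, Real.exp (κ * x z) ≤ 1 + κ * x z + κ * ε / 2 := by
    intro z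
    have h2 : |κ * x z| ≤ 1 := by
      rw [abs_mul, abs_of_pos hκ0]
      exact (mul_le_mul_of_nonneg_left (hx z) hκ0.le).trans hκm
    have h3 := (abs_le.1 (Real.abs_exp_sub_one_sub_id_le h2)).2
    have h4 : x z ^ 2 ≤ m ^ 2 := sq_le_sq' (abs_le.1 (hx z)).1 (abs_le.1 (hx z)).2
    have h5 := mul_le_mul_of_nonneg_left h4 (sq_nonneg κ)
    rw [hκm2] at h5
    rw [mul_pow] at h3
    linarith
  calc ∑ z, p z * Real.exp (κ * x z) ≤ ∑ z, p z * (1 + κ * x z + κ * ε / 2) :=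
        Finset.sum_le_sum fun z _ => mul_le_mul_of_nonneg_left (h1 z) (hp z)
    _ = ∑ z, (p z * (1 + κ * ε / 2) + κ * (p z * x z)) :=
        Finset.sum_congr rfl fun z _ => by ring
    _ = 1 + κ * ε / 2 + κ * ∑ z, p z * x z := by
        rw [Finset.sum_add_distrib, ← Finset.sum_mul, hp1, one_mul, Finset.mul_sum]
    _ ≤ 1 - κ * ε / 2 := by nlinarith

set_option maxHeartbeats 400000 in
/-- If a quadratic function `q`, corrected by a function `w` of linear growth, has drift
`-2 L ‖y‖ + B`, then `exp (2 κ √(q - 2 w + c))` contracts geometrically up to a constant: the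
square root has bounded increments and a negative drift far from the origin. -/
lemma exists_exp_drift {Y Z : Type*} [NormedAddCommGroup Y] [Fintype Z] {P : Z → Z → ℝ}
    (hP : ∀ z z', 0 ≤ P z z') (hP1 : ∀ z, ∑ z', P z z' = 1) {q : Y → ℝ} {d b D L B : ℝ}
    (hq₁ : ∀ y, ‖y‖ ^ 2 ≤ q y) (hq₂ : ∀ y, q y ≤ d * ‖y‖ ^ 2)
    (hq₃ : ∀ y y', |q y' - q y| ≤ d * (‖y‖ + ‖y'‖) * ‖y' - y‖)
    (hd : 0 ≤ d) (hb : 0 ≤ b) (hD : 0 ≤ D) (hL : 0 < L) (hB : 0 ≤ B) :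
    ∃ κ ρ B₁ c : ℝ, 0 < κ ∧ 0 ≤ ρ ∧ ρ < 1 ∧ 0 ≤ B₁ ∧ ∀ w : Z → Y → ℝ, (∀ z y, |w z y| ≤ D * ‖y‖) →
      (∀ z y, Real.exp (κ * ‖y‖) ≤ Real.exp (2 * κ * √(q y - 2 * w z y + c))) ∧
      ∀ z y y', ‖y' - y‖ ≤ b →
        ∑ z', P z z' * (q y' - 2 * w z' y') ≤ q y - 2 * w z y - 2 * L * ‖y‖ + B →
        ∑ z', P z z' * Real.exp (2 * κ * √(q y' - 2 * w z' y' + c))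
          ≤ ρ * Real.exp (2 * κ * √(q y - 2 * w z y + c)) + B₁ := by
  set c : ℝ := 2 * D ^ 2 + 1 with hc
  set A : ℝ := d + 2 * D + 1 with hA
  set e : ℝ := (d * b + 2 * D) * (2 + b) with he
  set ε : ℝ := L / (4 * A) with hε
  set m : ℝ := 4 * e + 1 + ε with hm
  set κ : ℝ := ε / (2 * m ^ 2) with hκ
  set r₀ : ℝ := 1 + B / L with hr₀
  have hA0 : 1 ≤ A := by rw [hA]; linarith
  have he0 : 0 ≤ e := by rw [he]; positivity
  have hε0 : 0 < ε := by rw [hε]; positivity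
  have hεm : ε ≤ m := by rw [hm]; linarith
  have hm0 : 0 < m := hε0.trans_le hεm
  have hκ0 : 0 < κ := by rw [hκ]; positivity
  have hκε : κ * ε / 2 ≤ 1 := by
    rw [hκ, div_mul_eq_mul_div, div_div, div_le_one (by positivity)]
    nlinarith
  refine ⟨κ / 2, 1 - κ * ε / 2, Real.exp (κ * (A * (r₀ + 1) + m)), c, by positivity, by linarith,
    by nlinarith, (Real.exp_pos _).le, fun w hw => ?_⟩
  rw [mul_div_cancel₀ κ two_ne_zero]
  set R : Z → Y → ℝ := fun z y => √(q y - 2 * w z y + c) with hR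
  have hlow : ∀ z y, ‖y‖ ^ 2 / 4 + 1 ≤ q y - 2 * w z y + c := by
    intro z y
    have h1 := (abs_le.1 (hw z y)).2
    have h2 := hq₁ y
    rw [hc]
    linarith [sq_nonneg (‖y‖ - 2 * D), sq_nonneg ‖y‖]
  have hRsq : ∀ z y, R z y ^ 2 = q y - 2 * w z y + c := fun z y =>
    Real.sq_sqrt (by linarith [hlow z y, sq_nonneg ‖y‖])
  have hR1 : ∀ z y, 1 ≤ R z y := fun z y => by
    rw [hR, Real.one_le_sqrt]
    linarith [hlow z y, sq_nonneg ‖y‖]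
  have hRnorm : ∀ z y, ‖y‖ / 2 ≤ R z y := fun z y => by
    refine Real.le_sqrt_of_sq_le ?_
    linarith [hlow z y]
  have hRup : ∀ z y, R z y ≤ A * (‖y‖ + 1) := fun z y => by
    refine Real.sqrt_le_iff.2 ⟨by positivity, ?_⟩
    have h1 := (abs_le.1 (hw z y)).1
    have h2 := hq₂ y
    have h3 := norm_nonneg y
    have h4 : d * ‖y‖ ^ 2 + 2 * (D * ‖y‖) + c ≤ (A * (‖y‖ + 1)) ^ 2 := by
      have h5 : A ^ 2 = d ^ 2 + 2 * d + 1 + 4 * D ^ 2 + 4 * (D * d) + 4 * D := by rw [hA]; ring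
      have h5a := mul_nonneg hD hd
      have h5b := sq_nonneg D
      have h5c := sq_nonneg d
      have h9 := mul_le_mul_of_nonneg_right (show d ≤ A ^ 2 by linarith) (sq_nonneg ‖y‖)
      have h10 := mul_le_mul_of_nonneg_right (show 2 * D ≤ A ^ 2 by linarith) h3
      have h11 : 0 ≤ A ^ 2 * ‖y‖ := by positivity
      have h12 : (A * (‖y‖ + 1)) ^ 2 = A ^ 2 * ‖y‖ ^ 2 + 2 * (A ^ 2 * ‖y‖) + A ^ 2 := by ring
      rw [h12]
      linarith
    linarith
  refine ⟨fun z y => Real.exp_le_exp.2 ?_, fun z y y' hyy hdrift => ?_⟩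
  · have := mul_le_mul_of_nonneg_left (hRnorm z y) hκ0.le
    calc κ / 2 * ‖y‖ = κ * (‖y‖ / 2) := by ring
      _ ≤ _ := this
  have hRpos : 0 < R z y := one_pos.trans_le (hR1 z y)
  have hny' : ‖y'‖ ≤ ‖y‖ + b := by
    have := norm_add_le (y' - y) y
    rw [sub_add_cancel] at this
    linarith
  have hn := norm_nonneg y
  -- increments of the square root
  have hinc : ∀ z', |R z' y' - R z y| ≤ m := by
    intro z'
    have h1 : |R z' y' ^ 2 - R z y ^ 2| ≤ e * (‖y‖ + 1) := by
      rw [hRsq, hRsq]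
      have h2 : |q y' - q y| ≤ d * b * (2 * ‖y‖ + b) := by
        refine (hq₃ y y').trans ?_
        have h3 : d * (‖y‖ + ‖y'‖) ≤ d * (2 * ‖y‖ + b) :=
          mul_le_mul_of_nonneg_left (by linarith) hd
        refine (mul_le_mul h3 hyy (norm_nonneg _) (by positivity)).trans (le_of_eq (by ring))
      have h3 : |w z' y'| ≤ D * (‖y‖ + b) :=
        (hw z' y').trans (mul_le_mul_of_nonneg_left hny' hD)
      have h4 := hw z y
      have h5 : |q y' - 2 * w z' y' + c - (q y - 2 * w z y + c)|
          ≤ |q y' - q y| + 2 * |w z' y'| + 2 * |w z y| := by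
        have e1 := abs_le.1 (le_refl |q y' - q y|)
        have e2 := abs_le.1 (le_refl |w z' y'|)
        have e3 := abs_le.1 (le_refl |w z y|)
        rw [abs_le]
        constructor <;> linarith [e1.1, e1.2, e2.1, e2.2, e3.1, e3.2]
      refine h5.trans ((add_le_add (add_le_add h2 (mul_le_mul_of_nonneg_left h3 zero_le_two))
        (mul_le_mul_of_nonneg_left h4 zero_le_two)).trans ?_)
      have h6 : (d * b + 2 * D) * (2 * ‖y‖ + b) ≤ (d * b + 2 * D) * ((2 + b) * (‖y‖ + 1)) := by
        refine mul_le_mul_of_nonneg_left ?_ (by positivity)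
        linarith [mul_nonneg hb hn]
      rw [he]
      linarith
    have h7 : (‖y‖ + 1) ≤ 4 * (R z' y' + R z y) := by
      linarith [hRnorm z y, hR1 z y, hR1 z' y']
    have h8 : 0 < R z' y' + R z y := by linarith [hR1 z' y']
    have h9 : |R z' y' - R z y| * (R z' y' + R z y) ≤ 4 * e * (R z' y' + R z y) := by
      rw [← abs_of_pos h8, ← abs_mul, abs_of_pos h8,
        show (R z' y' - R z y) * (R z' y' + R z y) = R z' y' ^ 2 - R z y ^ 2 by ring]
      have := mul_le_mul_of_nonneg_left h7 he0
      linarith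
    have := le_of_mul_le_mul_right h9 h8
    rw [hm]
    linarith
  have hsplit : ∑ z', P z z' * Real.exp (κ * R z' y')
      = Real.exp (κ * R z y) * ∑ z', P z z' * Real.exp (κ * (R z' y' - R z y)) := by
    rw [Finset.mul_sum]
    refine Finset.sum_congr rfl fun z' _ => ?_
    rw [mul_left_comm, ← Real.exp_add]
    congr 2
    ring
  change ∑ z', P z z' * Real.exp (κ * R z' y') ≤ (1 - κ * ε / 2) * Real.exp (κ * R z y) + _
  rcases le_or_gt r₀ ‖y‖ with hfar | hnear
  · -- far from the origin
    have hy1 : 1 ≤ ‖y‖ := by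
      have : 0 ≤ B / L := by positivity
      linarith
    have hBL : B ≤ L * ‖y‖ := by
      have : B / L ≤ ‖y‖ := by linarith
      rw [div_le_iff₀ hL] at this
      linarith
    have hmean : ∑ z', P z z' * (R z' y' - R z y) ≤ -ε := by
      have h1 : ∀ z', R z' y' - R z y
          ≤ ((q y' - 2 * w z' y') - (q y - 2 * w z y)) / (2 * R z y) := by
        intro z'
        rw [le_div_iff₀ (by linarith)]
        have h2 := hRsq z' y'
        have h3 := hRsq z y
        linarith [sq_nonneg (R z' y' - R z y)]
      have h2 : ∑ z', P z z' * (R z' y' - R z y)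
          ≤ (∑ z', P z z' * (q y' - 2 * w z' y') - (q y - 2 * w z y)) / (2 * R z y) := by
        refine (Finset.sum_le_sum fun z' _ => mul_le_mul_of_nonneg_left (h1 z') (hP z z')).trans
          (le_of_eq ?_)
        simp_rw [mul_div_assoc', ← Finset.sum_div]
        congr 1
        simp_rw [mul_sub (P z _) (q y' - _), Finset.sum_sub_distrib]
        rw [← Finset.sum_mul, hP1, one_mul]
      refine h2.trans ?_
      rw [div_le_iff₀ (by linarith)]
      have h3 : ε * (2 * R z y) ≤ L * ‖y‖ := by
        have h4 : R z y ≤ A * (2 * ‖y‖) :=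
          (hRup z y).trans (mul_le_mul_of_nonneg_left (by linarith) (by linarith))
        have h5 : ε * (2 * R z y) ≤ ε * (2 * (A * (2 * ‖y‖))) := by
          refine mul_le_mul_of_nonneg_left ?_ hε0.le
          linarith
        refine h5.trans (le_of_eq ?_)
        rw [hε]
        field_simp
        ring
      linarith
    have h1 := sum_exp_le (hP z) (hP1 z) hε0 hεm hinc hmean
    rw [hsplit, mul_comm]
    have h2 := mul_le_mul_of_nonneg_right h1 (Real.exp_pos (κ * R z y)).le
    have h3 := (Real.exp_pos (κ * (A * (r₀ + 1) + m))).le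
    linarith
  · -- near the origin
    have h1 : ∀ z', Real.exp (κ * R z' y') ≤ Real.exp (κ * (A * (r₀ + 1) + m)) := by
      intro z'
      refine Real.exp_le_exp.2 (mul_le_mul_of_nonneg_left ?_ hκ0.le)
      have h2 := (abs_le.1 (hinc z')).2
      have h3 : R z y ≤ A * (r₀ + 1) :=
        (hRup z y).trans (mul_le_mul_of_nonneg_left (by linarith) (by linarith))
      linarith
    have h2 : ∑ z', P z z' * Real.exp (κ * R z' y')
        ≤ ∑ z', P z z' * Real.exp (κ * (A * (r₀ + 1) + m)) :=
      Finset.sum_le_sum fun z' _ => mul_le_mul_of_nonneg_left (h1 z') (hP z z')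
    rw [← Finset.sum_mul, hP1, one_mul] at h2
    have h3 : 0 ≤ (1 - κ * ε / 2) * Real.exp (κ * R z y) :=
      mul_nonneg (by linarith) (Real.exp_pos _).le
    linarith

namespace EHNetwork

variable {Node Link Ch En : Type*} [Fintype Node] [DecidableEq Node] [Fintype Link]
  [DecidableEq Link] [Fintype Ch] [DecidableEq Ch] [Fintype En] [DecidableEq En]
  (net : EHNetwork Node Link Ch En)

/-- Transition probabilities of the environment. -/
def pEnv (z z' : Ch × En) : ℝ := net.pCh z.1 z'.1 * net.pEn z.2 z'.2

lemma pEnv_nonneg (z z' : Ch × En) : 0 ≤ net.pEnv z z' :=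
  mul_nonneg (net.pCh_chain.nonneg _ _) (net.pEn_chain.nonneg _ _)

lemma sum_pEnv (z : Ch × En) : ∑ z', net.pEnv z z' = 1 := by
  simp only [pEnv, Fintype.sum_prod_type, ← Finset.mul_sum, net.pEn_chain.row_sum, mul_one,
    net.pCh_chain.row_sum]

/-- An exponential Lyapunov function for ESA. The constants `κ`, `ρ`, `B` do not depend on `V` and
`θ`. In the quadratic function behind it, the correction by the solution `w` of the Poisson
equation for the one-slot dual functions replaces the current state of the environment by its
stationary average, so that the growth of the dual function gives the drift. -/
theorem exists_lyapunov [Nonempty Node] {L : ℝ} (hL : 0 < L) :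
    ∃ κ ρ B : ℝ, 0 < κ ∧ 0 ≤ ρ ∧ ρ < 1 ∧ 0 ≤ B ∧ ∀ V : ℝ, 0 ≤ V →
      (∀ (υ : Node → Node → ℝ) (ν : Node → ℝ), DualFeasible υ →
        V * net.maxUtility + L * ‖(υ, ν)‖ ≤ net.dual V υ ν) →
      ∃ Λ : Ch × En → (Node → Node → ℝ) × (Node → ℝ) → ℝ,
        (∀ z, Continuous (Λ z)) ∧ (∀ z y, Real.exp (κ * ‖y‖) ≤ Λ z y) ∧
        ∀ θ : Node → ℝ, (∀ n, net.δ * net.β * V + net.Pmax ≤ θ n) →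
        ∀ (Q : Node → Node → ℝ) (E : Node → ℝ) (s : Ch) (j : En) (a : SlotAction Node Link),
          net.IsESAAction V θ Q E s j a → net.QueueRange V Q →
          ∑ z, net.pEnv (s, j) z * Λ z (queuePoint θ (net.nextQ Q a) (net.nextE E a))
            ≤ ρ * Λ (s, j) (queuePoint θ Q E) + B := by
  obtain ⟨G, hG⟩ := exists_poisson net.pCh_chain net.pEn_chain net.πCh_stat net.πEn_stat
  set D₀ : ℝ := dim Node * net.stepBound with hD₀
  set D : ℝ := (∑ z, ∑ x, |G z x|) * D₀ with hD
  have hb := net.stepBound_nonneg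
  have hD₀0 : 0 ≤ D₀ := mul_nonneg dim_nonneg hb
  have hD0 : 0 ≤ D := mul_nonneg (Finset.sum_nonneg fun z _ => Finset.sum_nonneg fun x _ =>
    abs_nonneg _) hD₀0
  have hB0 : 0 ≤ 2 * (net.γ * net.totalRate + dim Node * net.stepBound ^ 2)
      + 2 * (D * net.stepBound) := by
    have := mul_nonneg net.γ_nonneg net.totalRate_nonneg
    have := mul_nonneg (dim_nonneg (Node := Node)) (sq_nonneg net.stepBound)
    positivity
  obtain ⟨κ, ρ, B, c, hκ, hρ, hρ1, hB, hexp⟩ := exists_exp_drift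
    (Y := (Node → Node → ℝ) × (Node → ℝ))
    net.pEnv_nonneg net.sum_pEnv norm_sq_le_sqNorm sqNorm_le sqNorm_sub_le dim_nonneg hb hD0 hL hB0
  refine ⟨κ, ρ, B, hκ, hρ, hρ1, hB, fun V hV hgrow => ?_⟩
  set ψ : Ch × En → (Node → Node → ℝ) × (Node → ℝ) → ℝ :=
    fun z y => net.dualAt V z.1 z.2 y.1 y.2 - V * net.maxUtility with hψ
  set w : Ch × En → (Node → Node → ℝ) × (Node → ℝ) → ℝ := fun z y => ∑ x, G z x * ψ x y with hw
  have hψlip : ∀ z y y', |ψ z y - ψ z y'| ≤ D₀ * ‖y - y'‖ := fun z y y' => by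
    have := net.abs_dualAt_sub_le hV z.1 z.2 y y'
    rwa [hψ, sub_sub_sub_cancel_right]
  have hψ0 : ∀ z, ψ z 0 = 0 := fun z => sub_eq_zero.2 (net.dualAt_zero hV z.1 z.2)
  have hwlip : ∀ z y y', |w z y - w z y'| ≤ D * ‖y - y'‖ := by
    intro z y y'
    rw [hw, ← Finset.sum_sub_distrib]
    refine (Finset.abs_sum_le_sum_abs _ _).trans ?_
    have h1 : ∀ x, |G z x * ψ x y - G z x * ψ x y'| ≤ |G z x| * (D₀ * ‖y - y'‖) := fun x => by
      rw [← mul_sub, abs_mul]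
      exact mul_le_mul_of_nonneg_left (hψlip x y y') (abs_nonneg _)
    refine (Finset.sum_le_sum fun x _ => h1 x).trans ?_
    rw [← Finset.sum_mul, hD, mul_assoc _ D₀]
    exact mul_le_mul_of_nonneg_right (Finset.single_le_sum
      (f := fun z => ∑ x, |G z x|) (fun z _ => Finset.sum_nonneg fun x _ => abs_nonneg _)
      (Finset.mem_univ z)) (by positivity)
  have hw0 : ∀ z, w z 0 = 0 := fun z => Finset.sum_eq_zero fun x _ => by rw [hψ0, mul_zero]
  have hwnorm : ∀ z y, |w z y| ≤ D * ‖y‖ := fun z y => by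
    have := hwlip z y 0
    rwa [hw0, sub_zero, sub_zero] at this
  obtain ⟨hlow, hdrift⟩ := hexp w hwnorm
  have hwcont : ∀ z, Continuous (w z) := fun z =>
    (LipschitzWith.of_dist_le_mul (K := D.toNNReal) fun y y' => by
      rw [Real.dist_eq, dist_eq_norm, Real.coe_toNNReal _ hD0]
      exact hwlip z y y').continuous
  have hqcont : Continuous (sqNorm : (Node → Node → ℝ) × (Node → ℝ) → ℝ) := by
    unfold sqNorm
    fun_prop
  refine ⟨fun z y => Real.exp (2 * κ * √(sqNorm y - 2 * w z y + c)), fun z => ?_, hlow, ?_⟩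
  · have := hwcont z
    fun_prop
  intro θ hθ Q E s j a ha hQ
  refine hdrift (s, j) _ _ (ha.admissible.norm_step_le (fun n c => (hQ.1 n c).1) hQ.2) ?_
  set y := queuePoint θ Q E with hy
  set y' := queuePoint θ (net.nextQ Q a) (net.nextE E a) with hy'
  have h1 := ha.sqNorm_step_le hV hQ hθ
  have h2 := hG (fun x => ψ x y) (s, j)
  have h3 : V * net.maxUtility + L * ‖y‖ ≤ net.dual V y.1 y.2 :=
    hgrow y.1 y.2 ⟨fun n c => (hQ.1 n c).1, hQ.2⟩
  have h4 : ∑ x : Ch × En, net.πCh x.1 * net.πEn x.2 * ψ x y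
      = net.dual V y.1 y.2 - V * net.maxUtility := by
    have e1 := net.sum_weights_const (V * net.maxUtility)
    have e2 : ∀ s, ∑ j, net.πCh s * net.πEn j * ψ (s, j) y
        = net.πCh s * ∑ j, net.πEn j * net.dualAt V s j y.1 y.2
          - net.πCh s * ∑ j, net.πEn j * (V * net.maxUtility) := fun s => by
      rw [Finset.mul_sum, Finset.mul_sum, ← Finset.sum_sub_distrib]
      exact Finset.sum_congr rfl fun j _ => by rw [hψ]; ring
    simp only [Fintype.sum_prod_type, e2, Finset.sum_sub_distrib, e1, dual]
  have h5 : ∑ z, net.pEnv (s, j) z * (sqNorm y' - 2 * w z y')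
      = sqNorm y' - 2 * ∑ z, net.pEnv (s, j) z * w z y' := by
    simp only [mul_sub, Finset.sum_sub_distrib, ← Finset.sum_mul, net.sum_pEnv, one_mul,
      Finset.mul_sum]
    congr 1
    exact Finset.sum_congr rfl fun _ _ => by ring
  have h6 : ∑ z, net.pEnv (s, j) z * w z y
      ≤ ∑ z, net.pEnv (s, j) z * w z y' + D * net.stepBound := by
    have e1 : ∀ z, w z y ≤ w z y' + D * net.stepBound := fun z => by
      have e2 := (abs_le.1 (hwlip z y' y)).1
      have e3 := mul_le_mul_of_nonneg_left (ha.admissible.norm_step_le (θ := θ) (E := E)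
        (fun n c => (hQ.1 n c).1) hQ.2) hD0
      linarith
    have := Finset.sum_le_sum fun z (_ : z ∈ Finset.univ) =>
      mul_le_mul_of_nonneg_left (e1 z) (net.pEnv_nonneg (s, j) z)
    simpa only [mul_add, Finset.sum_add_distrib, ← Finset.sum_mul, net.sum_pEnv, one_mul] using this
  have h7 : w (s, j) y - ∑ z, net.pEnv (s, j) z * w z y
      = ψ (s, j) y - ∑ x : Ch × En, net.πCh x.1 * net.πEn x.2 * ψ x y := h2
  have h8 : ψ (s, j) y = net.dualAt V s j Q (fun n => θ n - E n) - V * net.maxUtility := rfl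
  rw [h5]
  linarith

end EHNetwork

/-! ### Conditional expectations along a run of ESA -/

namespace EHNetwork

variable {Node Link Ch En : Type*} [Fintype Node] [DecidableEq Node] [Fintype Link]
  [DecidableEq Link] [Fintype Ch] [DecidableEq Ch] [Fintype En] [DecidableEq En]
  {net : EHNetwork Node Link Ch En}

omit [Fintype Node] [DecidableEq Node] in
lemma continuous_queuePoint (θ : Node → ℝ) :
    Continuous fun x : (Node → Node → ℝ) × (Node → ℝ) => queuePoint θ x.1 x.2 := by
  unfold queuePoint
  fun_prop

omit [Fintype Node] [DecidableEq Node] in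
lemma measurable_queues {Ω : Type*} {m : MeasurableSpace Ω} {Q : Ω → Node → Node → ℝ}
    {E : Ω → Node → ℝ} (hQ : ∀ n c, Measurable fun ω => Q ω n c)
    (hE : ∀ n, Measurable fun ω => E ω n) : Measurable fun ω => (Q ω, E ω) :=
  (measurable_pi_iff.2 fun n => measurable_pi_iff.2 fun c => hQ n c).prodMk
    (measurable_pi_iff.2 fun n => hE n)

omit [DecidableEq Node] in
lemma measurable_queuePoint {Ω : Type*} {m : MeasurableSpace Ω} (θ : Node → ℝ)
    {Q : Ω → Node → Node → ℝ} {E : Ω → Node → ℝ} (hQ : ∀ n c, Measurable fun ω => Q ω n c)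
    (hE : ∀ n, Measurable fun ω => E ω n) : Measurable fun ω => queuePoint θ (Q ω) (E ω) :=
  (continuous_queuePoint θ).measurable.comp (measurable_queues hQ hE)

variable {Ω : Type*} {mΩ : MeasurableSpace Ω} {ℙ : Measure Ω} {ℱ : Filtration ℕ mΩ}
  {S : ℕ → Ω → Ch} {H : ℕ → Ω → En}

omit [DecidableEq Ch] [DecidableEq En] in
lemma eq_sum_indicator (S : Ω → Ch) (H : Ω → En) (f : Ch × En → Ω → ℝ) (ω : Ω) :
    f (S ω, H ω) ω
      = ∑ z, f z ω * ({ω | S ω = z.1 ∧ H ω = z.2}).indicator (fun _ => (1 : ℝ)) ω := by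
  rw [Finset.sum_eq_single (S ω, H ω)]
  · simp
  · intro z _ hz
    rw [indicator_of_notMem, mul_zero]
    rintro ⟨h1, h2⟩
    exact hz (Prod.ext h1.symm h2.symm)
  · simp

lemma IsEnv.measurableSet (hE : net.IsEnv ℙ ℱ S H) (t : ℕ) (z : Ch × En) :
    MeasurableSet[ℱ t] {ω | S t ω = z.1 ∧ H t ω = z.2} :=
  (hE.meas_S t z.1).inter (hE.meas_H t z.2)

lemma IsEnv.measurable (hE : net.IsEnv ℙ ℱ S H) {t : ℕ} {f : Ch × En → Ω → ℝ}
    (hf : ∀ z, Measurable (f z)) : Measurable fun ω => f (S t ω, H t ω) ω := by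
  simp_rw [eq_sum_indicator (S t) (H t) f]
  exact Finset.measurable_sum _ fun z _ =>
    (hf z).mul (measurable_const.indicator (ℱ.le t _ (hE.measurableSet t z)))

variable [IsProbabilityMeasure ℙ]

/-- The environment is the only part of the next state that is not known yet. -/
lemma IsEnv.condExp_eq (hE : net.IsEnv ℙ ℱ S H) (t : ℕ) {f : Ch × En → Ω → ℝ}
    (hf : ∀ z, Measurable[ℱ t] (f z)) {K : ℝ} (hK : ∀ z ω, |f z ω| ≤ K) :
    ℙ[fun ω => f (S (t + 1) ω, H (t + 1) ω) ω | ℱ t]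
      =ᵐ[ℙ] fun ω => ∑ z, net.pEnv (S t ω, H t ω) z * f z ω := by
  have hind : ∀ z : Ch × En, Integrable
      (({ω | S (t + 1) ω = z.1 ∧ H (t + 1) ω = z.2}).indicator fun _ => (1 : ℝ)) ℙ := fun z =>
    (integrable_const (1 : ℝ)).indicator (ℱ.le _ _ (hE.measurableSet (t + 1) z))
  have hfun : (fun ω => f (S (t + 1) ω, H (t + 1) ω) ω) = ∑ z, f z *
      (({ω | S (t + 1) ω = z.1 ∧ H (t + 1) ω = z.2}).indicator fun _ => (1 : ℝ)) := by
    ext ω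
    rw [eq_sum_indicator (S (t + 1)) (H (t + 1)) f, Finset.sum_apply]
    rfl
  have hint : ∀ z : Ch × En, Integrable (f z *
      (({ω | S (t + 1) ω = z.1 ∧ H (t + 1) ω = z.2}).indicator fun _ => (1 : ℝ))) ℙ := fun z =>
    (hind z).bdd_mul (c := K) ((hf z).mono (ℱ.le t) le_rfl).aestronglyMeasurable
      (ae_of_all _ fun ω => hK z ω)
  rw [hfun]
  refine (condExp_finsetSum (fun z _ => hint z) (ℱ t)).trans ?_
  have h1 : ∀ z : Ch × En, ℙ[f z *
      (({ω | S (t + 1) ω = z.1 ∧ H (t + 1) ω = z.2}).indicator fun _ => (1 : ℝ)) | ℱ t]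
      =ᵐ[ℙ] fun ω => net.pEnv (S t ω, H t ω) z * f z ω := by
    intro z
    filter_upwards [condExp_stronglyMeasurable_mul_of_bound (ℱ.le t) (hf z).stronglyMeasurable
      (hind z) K (ae_of_all _ fun ω => hK z ω), hE.markov t z.1 z.2] with ω h2 h3
    rw [h2, Pi.mul_apply, h3, mul_comm]
    rfl
  have h2 : ∀ᵐ ω ∂ℙ, ∀ z : Ch × En, ℙ[f z *
      (({ω | S (t + 1) ω = z.1 ∧ H (t + 1) ω = z.2}).indicator fun _ => (1 : ℝ)) | ℱ t] ω
      = net.pEnv (S t ω, H t ω) z * f z ω := ae_all_iff.2 h1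
  filter_upwards [h2] with ω hω
  rw [Finset.sum_apply]
  exact Finset.sum_congr rfl fun z _ => hω z

variable {V : ℝ} {θ : Node → ℝ} {t₀ : ℕ} {Q : ℕ → Ω → Node → Node → ℝ} {E : ℕ → Ω → Node → ℝ}
  {a : ℕ → Ω → SlotAction Node Link}

omit [IsProbabilityMeasure ℙ]

lemma IsESARun.queueRange [Nonempty Node] (h : net.IsESARun V θ ℱ S H t₀ Q E a) (hV : 0 ≤ V)
    (h0 : ∀ ω, net.QueueRange V (Q 0 ω)) (t : ℕ) (ω : Ω) : net.QueueRange V (Q t ω) := by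
  induction t with
  | zero => exact h0 ω
  | succ t ih =>
    rw [h.Q_next t ω]
    exact (h.action t ω).queueRange_nextQ hV ih

lemma IsESARun.norm_le [Nonempty Node] (h : net.IsESARun V θ ℱ S H t₀ Q E a) (hV : 0 ≤ V)
    (h0 : ∀ ω, net.QueueRange V (Q 0 ω)) {K : ℝ} (hK : ∀ ω, ‖queuePoint θ (Q 0 ω) (E 0 ω)‖ ≤ K)
    (t : ℕ) (ω : Ω) : ‖queuePoint θ (Q t ω) (E t ω)‖ ≤ K + t * net.stepBound := by
  induction t with
  | zero => simpa using hK ω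
  | succ t ih =>
    have h1 := h.queueRange hV h0 t ω
    have h2 := (h.action t ω).admissible.norm_step_le (θ := θ) (E := E t ω)
      (fun n c => (h1.1 n c).1) h1.2
    rw [h.Q_next t ω, h.E_next t ω]
    have h3 := norm_add_le
      (queuePoint θ (net.nextQ (Q t ω) (a t ω)) (net.nextE (E t ω) (a t ω))
        - queuePoint θ (Q t ω) (E t ω)) (queuePoint θ (Q t ω) (E t ω))
    rw [sub_add_cancel] at h3
    push_cast
    linarith

lemma IsESARun.measurable_point (h : net.IsESARun V θ ℱ S H t₀ Q E a) (t : ℕ) :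
    Measurable fun ω => queuePoint θ (Q t ω) (E t ω) :=
  measurable_queuePoint θ (fun n c => (h.adapted.Q_meas t n c).mono (ℱ.le _) le_rfl)
    (fun n => (h.adapted.E_meas t n).mono (ℱ.le _) le_rfl)

lemma IsESARun.measurable_next (h : net.IsESARun V θ ℱ S H t₀ Q E a) (t : ℕ) :
    Measurable[ℱ (t₀ + t)] fun ω =>
      queuePoint θ (net.nextQ (Q t ω) (a t ω)) (net.nextE (E t ω) (a t ω)) := by
  have hA := h.adapted
  refine measurable_queuePoint (m := ℱ (t₀ + t)) θ (fun n c => ?_) (fun n => ?_)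
  · have h1 := hA.Q_meas t n c
    have h2 := fun l => hA.rate_meas t l c
    have h3 := hA.adm_meas t n c
    simp only [nextQ, outRate, inRate]
    by_cases hnc : n = c
    · simp only [hnc, if_true]
      exact measurable_const
    · simp only [hnc, if_false]
      exact (((h1.sub (Finset.measurable_sum _ fun l _ => h2 l)).max measurable_const).add
        (Finset.measurable_sum _ fun l _ => h2 l)).add h3
  · have h1 := hA.E_meas t n
    have h2 := fun l => hA.pow_meas t l
    have h3 := hA.harv_meas t n
    simp only [nextE, spent]
    exact (h1.sub (Finset.measurable_sum _ fun l _ => h2 l)).add h3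

lemma IsESARun.integrable_exp [Nonempty Node] [IsProbabilityMeasure ℙ]
    (h : net.IsESARun V θ ℱ S H t₀ Q E a) {κ : ℝ} (hκ : 0 ≤ κ) (hV : 0 ≤ V)
    (h0 : ∀ ω, net.QueueRange V (Q 0 ω)) {K : ℝ} (hK : ∀ ω, ‖queuePoint θ (Q 0 ω) (E 0 ω)‖ ≤ K)
    (t : ℕ) : Integrable (fun ω => Real.exp (κ * ‖queuePoint θ (Q t ω) (E t ω)‖)) ℙ := by
  refine Integrable.of_bound (Real.measurable_exp.comp ((measurable_norm.comp
    (h.measurable_point t)).const_mul κ)).aestronglyMeasurable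
    (Real.exp (κ * (K + t * net.stepBound))) (ae_of_all _ fun ω => ?_)
  rw [Real.norm_of_nonneg (Real.exp_pos _).le]
  exact Real.exp_le_exp.2 (mul_le_mul_of_nonneg_left (h.norm_le hV h0 hK t ω) hκ)

/-- Geometric decay of the conditional exponential moment of the queues of ESA, down to a constant
level. -/
theorem IsESARun.condExp_exp_le [Nonempty Node] [IsProbabilityMeasure ℙ]
    (h : net.IsESARun V θ ℱ S H t₀ Q E a) (hE : net.IsEnv ℙ ℱ S H) (hV : 0 ≤ V)
    (h0 : ∀ ω, net.QueueRange V (Q 0 ω)) {K : ℝ} (hK : ∀ ω, ‖queuePoint θ (Q 0 ω) (E 0 ω)‖ ≤ K)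
    {κ ρ B : ℝ} (hρ : 0 ≤ ρ) (hρ1 : ρ < 1) (hB : 0 ≤ B)
    {Λ : Ch × En → (Node → Node → ℝ) × (Node → ℝ) → ℝ} (hΛc : ∀ z, Continuous (Λ z))
    (hΛ : ∀ z y, Real.exp (κ * ‖y‖) ≤ Λ z y)
    (hdrift : ∀ (Q : Node → Node → ℝ) (E : Node → ℝ) (s : Ch) (j : En) (a : SlotAction Node Link),
      net.IsESAAction V θ Q E s j a → net.QueueRange V Q →
      ∑ z, net.pEnv (s, j) z * Λ z (queuePoint θ (net.nextQ Q a) (net.nextE E a))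
        ≤ ρ * Λ (s, j) (queuePoint θ Q E) + B) :
    ∃ C₀ : ℝ, ∀ t, ℙ[fun ω => Real.exp (κ * ‖queuePoint θ (Q t ω) (E t ω)‖) | ℱ t₀]
      ≤ᵐ[ℙ] fun _ => ρ ^ t * C₀ + B / (1 - ρ) := by
  set y : ℕ → Ω → (Node → Node → ℝ) × (Node → ℝ) := fun t ω => queuePoint θ (Q t ω) (E t ω) with hy
  set X : ℕ → Ω → ℝ := fun t ω => Λ (S (t₀ + t) ω, H (t₀ + t) ω) (y t ω) with hX
  have hΛ0 : ∀ z y, 0 ≤ Λ z y := fun z y => (Real.exp_pos _).le.trans (hΛ z y)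
  have hbound : ∀ t, ∃ K', ∀ z ω, |Λ z (y t ω)| ≤ K' := by
    intro t
    have hcomp := isCompact_closedBall (0 : (Node → Node → ℝ) × (Node → ℝ))
      (K + t * net.stepBound)
    choose b hb using fun z => hcomp.exists_bound_of_continuousOn (hΛc z).continuousOn
    refine ⟨∑ z, |b z|, fun z ω => ?_⟩
    have h1 := hb z (y t ω) (mem_closedBall_zero_iff.2 (h.norm_le hV h0 hK t ω))
    exact (h1.trans (le_abs_self _)).trans (Finset.single_le_sum (f := fun z => |b z|)
      (fun z _ => abs_nonneg _) (Finset.mem_univ z))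
  have hXint : ∀ t, Integrable (X t) ℙ := by
    intro t
    obtain ⟨K', hK'⟩ := hbound t
    exact Integrable.of_bound (hE.measurable (f := fun z ω => Λ z (y t ω)) fun z =>
      (hΛc z).measurable.comp (h.measurable_point t)).aestronglyMeasurable K'
      (ae_of_all _ fun ω => hK' _ ω)
  have hstep : ∀ t, ℙ[X (t + 1) | ℱ (t₀ + t)] ≤ᵐ[ℙ] fun ω => ρ * X t ω + B := by
    intro t
    obtain ⟨K', hK'⟩ := hbound (t + 1)
    have hyn : ∀ ω, y (t + 1) ω
        = queuePoint θ (net.nextQ (Q t ω) (a t ω)) (net.nextE (E t ω) (a t ω)) := fun ω => by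
      rw [hy, ← h.Q_next, ← h.E_next]
    have hmeas : Measurable[ℱ (t₀ + t)] (y (t + 1)) := by
      rw [show y (t + 1) = _ from funext hyn]
      exact h.measurable_next t
    filter_upwards [hE.condExp_eq (t₀ + t) (f := fun z ω => Λ z (y (t + 1) ω))
      (fun z => (hΛc z).measurable.comp hmeas) hK'] with ω hω
    refine (le_of_eq hω).trans ?_
    have := hdrift _ _ _ _ _ (h.action t ω) (h.queueRange hV h0 t ω)
    rwa [← hyn] at this
  obtain ⟨C₀, hC₀⟩ := hbound 0
  have hBρ : 0 ≤ B / (1 - ρ) := div_nonneg hB (by linarith)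
  have hmain : ∀ t, ℙ[X t | ℱ t₀] ≤ᵐ[ℙ] fun _ => ρ ^ t * C₀ + B / (1 - ρ) := by
    intro t
    induction t with
    | zero =>
      have h1 : ℙ[X 0 | ℱ t₀] ≤ᵐ[ℙ] ℙ[fun _ => C₀ | ℱ t₀] :=
        condExp_mono (hXint 0) (integrable_const _)
          (ae_of_all _ fun ω => (le_abs_self _).trans (hC₀ _ ω))
      filter_upwards [h1] with ω hω
      rw [condExp_const (ℱ.le t₀)] at hω
      rw [pow_zero, one_mul]
      linarith
    | succ t ih =>
      have h1 : ℙ[ℙ[X (t + 1) | ℱ (t₀ + t)] | ℱ t₀] =ᵐ[ℙ] ℙ[X (t + 1) | ℱ t₀] :=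
        condExp_condExp_of_le (ℱ.mono (Nat.le_add_right t₀ t)) (ℱ.le _)
      have h2 : ℙ[ℙ[X (t + 1) | ℱ (t₀ + t)] | ℱ t₀] ≤ᵐ[ℙ] ℙ[ρ • X t + fun _ => B | ℱ t₀] :=
        condExp_mono integrable_condExp (((hXint t).smul ρ).add (integrable_const _)) (hstep t)
      have h3 : ℙ[ρ • X t + fun _ => B | ℱ t₀] =ᵐ[ℙ] ℙ[ρ • X t | ℱ t₀] + ℙ[fun _ => B | ℱ t₀] :=
        condExp_add ((hXint t).smul ρ) (integrable_const _) _
      have h4 : ℙ[ρ • X t | ℱ t₀] =ᵐ[ℙ] ρ • ℙ[X t | ℱ t₀] := condExp_smul ρ _ _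
      filter_upwards [h1, h2, h3, h4, ih] with ω e1 e2 e3 e4 e5
      rw [← e1]
      refine e2.trans ?_
      rw [e3, Pi.add_apply, e4, Pi.smul_apply, condExp_const (ℱ.le t₀), smul_eq_mul]
      have e6 := mul_le_mul_of_nonneg_left e5 hρ
      have e7 : ρ * (B / (1 - ρ)) + B = B / (1 - ρ) := by
        have : 1 - ρ ≠ 0 := by linarith
        field_simp
        ring
      rw [pow_succ]
      linarith
  refine ⟨C₀, fun t => ?_⟩
  have hexp : Integrable (fun ω => Real.exp (κ * ‖y t ω‖)) ℙ := by
    refine (hXint t).mono' ?_ (ae_of_all _ fun ω => ?_)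
    · have := h.measurable_point t
      exact (Real.measurable_exp.comp
        ((measurable_norm.comp this).const_mul κ)).aestronglyMeasurable
    · rw [Real.norm_of_nonneg (Real.exp_pos _).le]
      exact hΛ _ _
  exact (condExp_mono hexp (hXint t) (ae_of_all _ fun ω => hΛ _ _)).trans (hmain t)

/-- In steady state the exponential moment of the queues of ESA is at most the constant level. -/
theorem IsPhaseOne.integral_exp_le [Nonempty Node] [IsProbabilityMeasure ℙ] {T : ℕ}
    (h : net.IsPhaseOne V θ ℙ ℱ S H T Q E a) {κ ρ B C₀ : ℝ} (hρ : 0 ≤ ρ) (hρ1 : ρ < 1)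
    (hmom : ∀ t, ℙ[fun ω => Real.exp (κ * ‖queuePoint θ (Q t ω) (E t ω)‖) | ℱ 0]
      ≤ᵐ[ℙ] fun _ => ρ ^ t * C₀ + B) :
    ∫ ω, Real.exp (κ * ‖queuePoint θ (Q T ω) (E T ω)‖) ∂ℙ ≤ B := by
  have h1 : ∀ t, ∫ ω, Real.exp (κ * ‖queuePoint θ (Q t ω) (E t ω)‖) ∂ℙ ≤ ρ ^ t * C₀ + B := by
    intro t
    rw [← integral_condExp (ℱ.le 0)]
    refine (integral_mono_ae integrable_condExp (integrable_const _) (hmom t)).trans ?_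
    simp
  have hmeas : ∀ t, Measurable fun ω => (Q t ω, E t ω) := fun t =>
    measurable_queues (fun n c => (h.run.adapted.Q_meas t n c).mono (ℱ.le _) le_rfl)
      (fun n => (h.run.adapted.E_meas t n).mono (ℱ.le _) le_rfl)
  have hcont : Continuous fun x : (Node → Node → ℝ) × (Node → ℝ) =>
      Real.exp (κ * ‖queuePoint θ x.1 x.2‖) := by
    have := continuous_queuePoint θ
    fun_prop
  have h2 : ∀ t, ∫ ω, Real.exp (κ * ‖queuePoint θ (Q t ω) (E t ω)‖) ∂ℙ
      = ∫ x, Real.exp (κ * ‖queuePoint θ x.1 x.2‖) ∂(ℙ.map fun ω => (Q t ω, E t ω)) := fun t =>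
    (integral_map (hmeas t).aemeasurable hcont.aestronglyMeasurable).symm
  have h3 : ∀ t, T ≤ t → ∫ ω, Real.exp (κ * ‖queuePoint θ (Q T ω) (E T ω)‖) ∂ℙ
      ≤ ρ ^ t * C₀ + B := fun t ht => by
    rw [h2, ← h.steady t ht, ← h2]
    exact h1 t
  have h4 : Tendsto (fun t : ℕ => ρ ^ t * C₀ + B) atTop (𝓝 (0 * C₀ + B)) :=
    ((tendsto_pow_atTop_nhds_zero_of_lt_one hρ hρ1).mul_const _).add_const _
  rw [zero_mul, zero_add] at h4
  exact ge_of_tendsto h4 (eventually_atTop.2 ⟨T, h3⟩)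

end EHNetwork

/-! ### The actual queues of MESA follow the virtual ones -/

namespace EHNetwork

variable {Node Link Ch En : Type*} [Fintype Node] [DecidableEq Node] [Fintype Link]
  [DecidableEq Link] [Fintype Ch] [DecidableEq Ch] [Fintype En] [DecidableEq En]
  {net : EHNetwork Node Link Ch En}

lemma storage_nonneg (V : ℝ) : 0 ≤ storage V := by
  rw [storage]
  positivity

section Slot

variable {M : ℝ} {Q₀ : Node → Node → ℝ} {E₀ : Node → ℝ} {Qhat : Node → Node → ℝ} {Ehat : Node → ℝ}
  {a : SlotAction Node Link} {s : Ch} {j : En}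

lemma Admissible.input_mem (ha : net.Admissible s j a) (n c : Node) :
    net.input M E₀ Ehat a n c ∈ Icc 0 (net.inRate a.rate n c + a.adm n c) := by
  rw [input, inRate, add_comm (∑ l with net.dst l = n, a.rate l c)]
  constructor
  · refine add_nonneg (ha.adm_mem n c).1 (Finset.sum_nonneg fun l _ => ?_)
    split_ifs
    exacts [ha.rate_nonneg l c, le_rfl]
  · refine add_le_add le_rfl (Finset.sum_le_sum fun l _ => ?_)
    split_ifs
    exacts [le_rfl, ha.rate_nonneg l c]

lemma Admissible.accepted_mem (ha : net.Admissible s j a) (n c : Node) :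
    net.accepted M Q₀ E₀ Qhat Ehat a n c ∈ Icc 0 (net.input M E₀ Ehat a n c) := by
  have h := (ha.input_mem (M := M) (E₀ := E₀) (Ehat := Ehat) n c).1
  rw [accepted]
  split_ifs with hlt
  · exact ⟨le_max_right _ _, max_le (by linarith) h⟩
  · exact ⟨h, le_rfl⟩

/-- A bound on the amount of data dropped in one slot. -/
def dropBound (net : EHNetwork Node Link Ch En) : ℝ :=
  net.totalRate + (Fintype.card Node : ℝ) ^ 2 * (net.totalRate + net.Rmax)

lemma dropBound_nonneg : 0 ≤ net.dropBound := by
  have := net.totalRate_nonneg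
  have := net.Rmax_nonneg
  rw [dropBound]
  positivity

lemma Admissible.dropped_mem (ha : net.Admissible s j a) :
    net.dropped M Q₀ E₀ Qhat Ehat a ∈ Icc 0 net.dropBound := by
  rw [dropped, dropBound]
  constructor
  · refine add_nonneg (Finset.sum_nonneg fun l _ => Finset.sum_nonneg fun c _ => ?_)
      (Finset.sum_nonneg fun n _ => Finset.sum_nonneg fun c _ =>
        sub_nonneg.2 (ha.accepted_mem n c).2)
    split_ifs
    exacts [le_rfl, ha.rate_nonneg l c]
  · refine add_le_add ?_ ?_
    · refine (Finset.sum_le_sum fun l _ => ?_).trans (net.sum_muMax_le Finset.univ)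
      refine le_trans (Finset.sum_le_sum fun c _ => ?_)
        ((ha.rate_le l).trans (net.mu_le s _ ha.pow_mem l))
      split_ifs
      exacts [ha.rate_nonneg l c, le_rfl]
    · have h : ∀ n c, net.input M E₀ Ehat a n c - net.accepted M Q₀ E₀ Qhat Ehat a n c
          ≤ net.totalRate + net.Rmax := fun n c => by
        have h1 := (ha.input_mem (M := M) (E₀ := E₀) (Ehat := Ehat) n c).2
        have h2 := (ha.accepted_mem (M := M) (Q₀ := Q₀) (E₀ := E₀) (Qhat := Qhat)
          (Ehat := Ehat) n c).1
        have h3 := ha.inRate_le n c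
        have h4 := (ha.adm_mem n c).2
        linarith
      refine (Finset.sum_le_sum fun n _ => Finset.sum_le_sum fun c _ => h n c).trans (le_of_eq ?_)
      simp only [Finset.sum_const, Finset.card_univ, nsmul_eq_mul]
      ring

lemma dropped_eq_zero (hE : ∀ n, net.InWindow M E₀ Ehat n) (hQ : ∀ n c, Q₀ n c ≤ Qhat n c) :
    net.dropped M Q₀ E₀ Qhat Ehat a = 0 := by
  rw [dropped]
  simp [hE, accepted, fun n c => not_lt.2 (hQ n c)]

/-- One slot of the comparison between an actual and a virtual data queue. Here `o` is the rate out
of the queue and `A` the input. -/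
lemma dataQueue_step {q x q₀ o A i K : ℝ} (ho : 0 ≤ o) (hoK : o ≤ K) (hi : i ≤ A)
    (hq : q ≤ max (x - q₀) 0 + K) :
    max (q - o) 0 + (if x < q₀ then max (i - (q₀ - x)) 0 else i)
      ≤ max (max (x - o) 0 + A - q₀) 0 + K := by
  have e1 := le_max_left (x - o) 0
  have e2 := le_max_right (x - o) 0
  have e3 := le_max_left (max (x - o) 0 + A - q₀) 0
  have e4 := le_max_right (max (x - o) 0 + A - q₀) 0
  split_ifs with hlt
  · rw [max_eq_right (by linarith : x - q₀ ≤ 0)] at hq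
    rcases max_cases (q - o) 0 with ⟨h1, -⟩ | ⟨h1, -⟩ <;>
      rcases max_cases (i - (q₀ - x)) 0 with ⟨h2, -⟩ | ⟨h2, -⟩ <;> rw [h1, h2] <;> linarith
  · rw [max_eq_left (by linarith : 0 ≤ x - q₀)] at hq
    rcases max_cases (q - o) 0 with ⟨h1, -⟩ | ⟨h1, -⟩ <;> rw [h1] <;> linarith

end Slot

section PhaseTwo

variable {Ω : Type*} {mΩ : MeasurableSpace Ω} {ℙ : Measure Ω} {ℱ : Filtration ℕ mΩ}
  {S : ℕ → Ω → Ch} {H : ℕ → Ω → En} {V : ℝ} {θ : Node → ℝ} {T : ℕ}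
  {Q₁ : ℕ → Ω → Node → Node → ℝ} {E₁ : ℕ → Ω → Node → ℝ} {a₁ : ℕ → Ω → SlotAction Node Link}
  {Q₀ : Ω → Node → Node → ℝ} {E₀ : Ω → Node → ℝ}
  {Qhat : ℕ → Ω → Node → Node → ℝ} {Ehat : ℕ → Ω → Node → ℝ} {a : ℕ → Ω → SlotAction Node Link}
  {Q : ℕ → Ω → Node → Node → ℝ} {E : ℕ → Ω → Node → ℝ}

lemma IsPhaseTwo.energy_mem
    (h : net.IsPhaseTwo V θ ℱ S H T Q₁ E₁ Q₀ E₀ Qhat Ehat a Q E) (t : ℕ) (ω : Ω) (n : Node) :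
    E t ω n ∈ Icc 0 (storage V) := by
  induction t with
  | zero => rw [h.E_zero]; exact ⟨le_rfl, storage_nonneg V⟩
  | succ t ih =>
    have ha := (h.run.action t ω).admissible
    have h1 := (ha.harv_mem n).1
    have h2 := storage_nonneg V
    rw [h.E_next t ω, nextActualE]
    split_ifs
    · exact ⟨le_min (add_nonneg (le_max_right _ _) (le_max_right _ _)) h2, min_le_right _ _⟩
    · exact ⟨le_min (add_nonneg ih.1 h1) h2, min_le_right _ _⟩
    · exact ⟨le_min (add_nonneg (le_max_right _ _) h1) h2, min_le_right _ _⟩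

/-- The actual energy level dominates the virtual one, seen through the window of size `M`. -/
lemma IsPhaseTwo.le_energy
    (h : net.IsPhaseTwo V θ ℱ S H T Q₁ E₁ Q₀ E₀ Qhat Ehat a Q E) (t : ℕ) (ω : Ω) (n : Node) :
    min (Ehat t ω n - E₀ ω n) (storage V) ≤ E t ω n := by
  induction t with
  | zero =>
    rw [h.E_zero, h.Ehat_zero, sub_self]
    exact min_le_left _ _
  | succ t ih =>
    have ha := (h.run.action t ω).admissible
    have h1 := (ha.harv_mem n).1
    have h2 := ha.spent_nonneg n
    have h3 := (h.energy_mem t ω n).1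
    rw [h.E_next t ω, h.run.E_next t ω, nextActualE, nextE]
    split_ifs with hlow hhigh
    · refine min_le_min ?_ le_rfl
      have e1 := le_max_right (E t ω n - net.spent (a t ω).pow n) 0
      have e2 := le_max_left ((a t ω).harv n - (E₀ ω n - Ehat t ω n)) 0
      linarith
    · rw [min_eq_right (by linarith)] at ih
      exact le_min ((min_le_right _ _).trans (by linarith)) (min_le_right _ _)
    · rw [min_eq_left (by linarith)] at ih
      refine min_le_min ?_ le_rfl
      have e1 := le_max_left (E t ω n - net.spent (a t ω).pow n) 0
      linarith

lemma IsPhaseTwo.spent_le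
    (h : net.IsPhaseTwo V θ ℱ S H T Q₁ E₁ Q₀ E₀ Qhat Ehat a Q E) (t : ℕ) (ω : Ω) (n : Node)
    (hw : net.InWindow (storage V) (E₀ ω) (Ehat t ω) n) :
    net.spent (a t ω).pow n ≤ E t ω n := by
  have h1 := h.le_energy t ω n
  have h2 := net.pow_le _ _ (h.run.action t ω).pow_mem n
  rw [min_eq_left (by linarith [hw.2])] at h1
  have h3 : net.spent (a t ω).pow n ≤ net.Pmax := h2
  linarith [hw.1]

lemma IsPhaseTwo.queueRange_zero
    (h : net.IsPhaseTwo V θ ℱ S H T Q₁ E₁ Q₀ E₀ Qhat Ehat a Q E) {ω : Ω}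
    (h₁ : net.QueueRange V (Q₁ T ω)) : net.QueueRange V (Qhat 0 ω) := by
  have hM := storage_nonneg V
  rw [h.Qhat_zero]
  refine ⟨fun n c => ?_, fun c => ?_⟩
  · rw [h.Q₀_eq]
    have := h₁.1 n c
    exact ⟨le_max_right _ _, max_le (by linarith [this.2]) (this.1.trans this.2)⟩
  · rw [h.Q₀_eq, h₁.2, max_eq_right (by linarith)]

/-- The actual data queues exceed the virtual ones, counted from the estimated attraction point, at
most by the capacity of all links. -/
lemma IsPhaseTwo.data_le
    (h : net.IsPhaseTwo V θ ℱ S H T Q₁ E₁ Q₀ E₀ Qhat Ehat a Q E)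
    (t : ℕ) (ω : Ω) (n c : Node) :
    Q t ω n c ≤ max (Qhat t ω n c - Q₀ ω n c) 0 + net.totalRate := by
  by_cases hnc : n = c
  · rw [hnc, h.Q_dest]
    exact add_nonneg (le_max_right _ _) net.totalRate_nonneg
  induction t with
  | zero =>
    rw [h.Q_zero]
    exact add_nonneg (le_max_right _ _) net.totalRate_nonneg
  | succ t ih =>
    have ha := (h.run.action t ω).admissible
    have hi := ha.input_mem (M := storage V) (E₀ := E₀ ω) (Ehat := Ehat t ω) n c
    refine (h.Q_next t ω n c hnc).trans ?_
    rw [h.run.Q_next t ω, nextQ, if_neg hnc, add_assoc]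
    exact dataQueue_step (net.outRate_nonneg ha.rate_nonneg n c) (ha.outRate_le n c)
      hi.2 ih

/-- If Phase I ends near the attraction point and the virtual queues are near it as well, then no
data is dropped. -/
lemma IsPhaseTwo.dropped_eq_zero
    (h : net.IsPhaseTwo V θ ℱ S H T Q₁ E₁ Q₀ E₀ Qhat Ehat a Q E) (hθ : ∀ n, storage V ≤ θ n)
    (hP : 4 * net.Pmax ≤ storage V) {t : ℕ} {ω : Ω}
    (h₁ : ‖queuePoint θ (Q₁ T ω) (E₁ T ω)‖ ≤ storage V / 8)
    (h₂ : ‖queuePoint θ (Qhat t ω) (Ehat t ω)‖ ≤ storage V / 8)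
    (hr : net.QueueRange V (Qhat t ω)) :
    net.dropped (storage V) (Q₀ ω) (E₀ ω) (Qhat t ω) (Ehat t ω) (a t ω) = 0 := by
  have hM := storage_nonneg V
  refine EHNetwork.dropped_eq_zero (fun n => ?_) (fun n c => ?_)
  · have e1 := abs_le.1 ((abs_snd_le (queuePoint θ (Q₁ T ω) (E₁ T ω)) n).trans h₁)
    have e2 := abs_le.1 ((abs_snd_le (queuePoint θ (Qhat t ω) (Ehat t ω)) n).trans h₂)
    simp only [queuePoint] at e1 e2
    have e3 := hθ n
    rw [InWindow, h.E₀_eq, max_eq_left (by linarith [e1.2])]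
    constructor <;> linarith [e1.1, e1.2, e2.1, e2.2]
  · have e1 := abs_le.1 ((abs_fst_le (queuePoint θ (Q₁ T ω) (E₁ T ω)) n c).trans h₁)
    simp only [queuePoint] at e1
    rw [h.Q₀_eq, max_eq_right (by linarith [e1.2])]
    exact (hr.1 n c).1

lemma IsPhaseTwo.norm_zero_le
    (h : net.IsPhaseTwo V θ ℱ S H T Q₁ E₁ Q₀ E₀ Qhat Ehat a Q E) {ω : Ω}
    (hQ : ∀ n c, 0 ≤ Q₁ T ω n c) (hE : ∀ n, 0 ≤ E₁ T ω n) {K : ℝ}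
    (hK : ‖queuePoint θ (Q₁ T ω) (E₁ T ω)‖ ≤ K) :
    ‖queuePoint θ (Qhat 0 ω) (Ehat 0 ω)‖ ≤ K + storage V / 2 := by
  have hM := storage_nonneg V
  have hK0 : 0 ≤ K := (norm_nonneg _).trans hK
  refine norm_le_of_abs_le (by positivity) (fun n c => ?_) (fun n => ?_)
  · have e1 := abs_le.1 ((abs_fst_le (queuePoint θ (Q₁ T ω) (E₁ T ω)) n c).trans hK)
    have e2 := le_max_right (Q₁ T ω n c - storage V / 2) 0
    have e3 := max_le (by linarith : Q₁ T ω n c - storage V / 2 ≤ Q₁ T ω n c) (hQ n c)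
    simp only [queuePoint] at e1 ⊢
    rw [h.Qhat_zero, h.Q₀_eq, abs_le]
    constructor <;> linarith [e1.1, e1.2]
  · have e1 := abs_le.1 ((abs_snd_le (queuePoint θ (Q₁ T ω) (E₁ T ω)) n).trans hK)
    have e2 := le_max_left (E₁ T ω n - storage V / 2) 0
    have e3 := max_le (by linarith : E₁ T ω n - storage V / 2 ≤ E₁ T ω n) (hE n)
    simp only [queuePoint] at e1 ⊢
    rw [h.Ehat_zero, h.E₀_eq, abs_le]
    constructor <;> linarith [e1.1, e1.2]

lemma IsPhaseTwo.measurable_dropped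
    (h : net.IsPhaseTwo V θ ℱ S H T Q₁ E₁ Q₀ E₀ Qhat Ehat a Q E)
    (hQ₁ : ∀ n c, Measurable fun ω => Q₁ T ω n c) (hE₁ : ∀ n, Measurable fun ω => E₁ T ω n)
    (t : ℕ) : Measurable fun ω =>
      net.dropped (storage V) (Q₀ ω) (E₀ ω) (Qhat t ω) (Ehat t ω) (a t ω) := by
  have hA := h.run.adapted
  have hQ₀ : ∀ n c, Measurable fun ω => Q₀ ω n c := fun n c => by
    simp_rw [h.Q₀_eq]
    exact ((hQ₁ n c).sub_const _).max measurable_const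
  have hE₀ : ∀ n, Measurable fun ω => E₀ ω n := fun n => by
    simp_rw [h.E₀_eq]
    exact ((hE₁ n).sub_const _).max measurable_const
  have hQh : ∀ n c, Measurable fun ω => Qhat t ω n c := fun n c =>
    (hA.Q_meas t n c).mono (ℱ.le _) le_rfl
  have hEh : ∀ n, Measurable fun ω => Ehat t ω n := fun n =>
    (hA.E_meas t n).mono (ℱ.le _) le_rfl
  have hrate : ∀ l c, Measurable fun ω => (a t ω).rate l c := fun l c =>
    (hA.rate_meas t l c).mono (ℱ.le _) le_rfl
  have hadm : ∀ n c, Measurable fun ω => (a t ω).adm n c := fun n c =>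
    (hA.adm_meas t n c).mono (ℱ.le _) le_rfl
  have hwin : ∀ n, MeasurableSet {ω | net.InWindow (storage V) (E₀ ω) (Ehat t ω) n} := fun n =>
    (measurableSet_le ((hE₀ n).add_const _) (hEh n)).inter
      (measurableSet_le (hEh n) ((hE₀ n).add_const _))
  have hinput : ∀ n c, Measurable fun ω =>
      net.input (storage V) (E₀ ω) (Ehat t ω) (a t ω) n c := fun n c => by
    simp only [input]
    exact (hadm n c).add (Finset.measurable_sum _ fun l _ =>
      Measurable.ite (hwin _) (hrate l c) measurable_const)
  have hacc : ∀ n c, Measurable fun ω =>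
      net.accepted (storage V) (Q₀ ω) (E₀ ω) (Qhat t ω) (Ehat t ω) (a t ω) n c := fun n c => by
    simp only [accepted]
    exact Measurable.ite (measurableSet_lt (hQh n c) (hQ₀ n c))
      (((hinput n c).sub ((hQ₀ n c).sub (hQh n c))).max measurable_const) (hinput n c)
  simp only [dropped]
  exact (Finset.measurable_sum _ fun l _ => Finset.measurable_sum _ fun c _ =>
    Measurable.ite (hwin _) measurable_const (hrate l c)).add
    (Finset.measurable_sum _ fun n _ => Finset.measurable_sum _ fun c _ =>
      (hinput n c).sub (hacc n c))

end PhaseTwo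

/-! ### Long-run averages -/

lemma mem_Icc_average {x : ℕ → ℝ} {R : ℝ} (hR : 0 ≤ R) (hx : ∀ t, x t ∈ Icc 0 R) (t : ℕ) :
    (1 / (t : ℝ)) * ∑ τ ∈ Finset.range t, x τ ∈ Icc 0 R := by
  have h1 : 0 ≤ ∑ τ ∈ Finset.range t, x τ := Finset.sum_nonneg fun τ _ => (hx τ).1
  refine ⟨by positivity, ?_⟩
  rcases Nat.eq_zero_or_pos t with rfl | ht
  · simpa using hR
  · have h2 : ∑ τ ∈ Finset.range t, x τ ≤ t * R := by
      refine (Finset.sum_le_sum fun τ _ => (hx τ).2).trans (le_of_eq ?_)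
      simp
    rw [one_div, inv_mul_le_iff₀ (by exact_mod_cast ht)]
    exact h2

lemma liminf_mem_Icc {u : ℕ → ℝ} {x y : ℝ} (hu : ∀ t, u t ∈ Icc x y) :
    liminf u atTop ∈ Icc x y := by
  have hb : IsBoundedUnder (· ≥ ·) atTop u := isBoundedUnder_of ⟨x, fun t => (hu t).1⟩
  have ha : IsBoundedUnder (· ≤ ·) atTop u := isBoundedUnder_of ⟨y, fun t => (hu t).2⟩
  exact ⟨le_liminf_of_le ha.isCoboundedUnder_ge (Eventually.of_forall fun t => (hu t).1),
    liminf_le_of_frequently_le (Eventually.of_forall fun t => (hu t).2).frequently hb⟩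

lemma tendsto_average {ρ : ℝ} (hρ : 0 ≤ ρ) (hρ1 : ρ < 1) (K x : ℝ) :
    Tendsto (fun t : ℕ => (1 / (t : ℝ)) * ∑ τ ∈ Finset.range t, (ρ ^ τ * K + x)) atTop (𝓝 x) := by
  have h : Tendsto (fun t : ℕ => ρ ^ t * K + x) atTop (𝓝 (0 * K + x)) :=
    ((tendsto_pow_atTop_nhds_zero_of_lt_one hρ hρ1).mul_const _).add_const _
  rw [zero_mul, zero_add] at h
  simpa only [one_div] using h.cesaro

lemma average_mono {x x' : ℕ → ℝ} (h : ∀ t, x t ≤ x' t) (t : ℕ) :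
    (1 / (t : ℝ)) * ∑ τ ∈ Finset.range t, x τ ≤ (1 / (t : ℝ)) * ∑ τ ∈ Finset.range t, x' τ :=
  mul_le_mul_of_nonneg_left (Finset.sum_le_sum fun τ _ => h τ) (by positivity)

lemma limsup_average_le {x : ℕ → ℝ} {ρ K B : ℝ} (hρ : 0 ≤ ρ) (hρ1 : ρ < 1)
    (h : ∀ t, x t ≤ ρ ^ t * K + B) :
    limsup (fun t : ℕ => (((1 / (t : ℝ)) * ∑ τ ∈ Finset.range t, x τ : ℝ) : EReal)) atTop
      ≤ (B : EReal) := by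
  have h1 : Tendsto (fun t : ℕ => (((1 / (t : ℝ)) * ∑ τ ∈ Finset.range t, (ρ ^ τ * K + B) : ℝ)
      : EReal)) atTop (𝓝 (B : EReal)) :=
    (continuous_coe_real_ereal.tendsto B).comp (tendsto_average hρ hρ1 K B)
  rw [← h1.limsup_eq]
  exact limsup_le_limsup (Eventually.of_forall fun t =>
    EReal.coe_le_coe_iff.2 (average_mono h t))

lemma le_liminf_average {x : ℕ → ℝ} {R ρ K B : ℝ} (hR : 0 ≤ R) (hx : ∀ t, x t ∈ Icc 0 R)
    (hρ : 0 ≤ ρ) (hρ1 : ρ < 1) (h : ∀ t, R - (ρ ^ t * K + B) ≤ x t) :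
    R - B ≤ liminf (fun t : ℕ => (1 / (t : ℝ)) * ∑ τ ∈ Finset.range t, x τ) atTop := by
  have h1 : Tendsto (fun t : ℕ => (1 / (t : ℝ)) * ∑ τ ∈ Finset.range t, (ρ ^ τ * (-K) + (R - B)))
      atTop (𝓝 (R - B)) := tendsto_average hρ hρ1 (-K) (R - B)
  have hmem := mem_Icc_average hR hx
  rw [← h1.liminf_eq]
  refine liminf_le_liminf (Eventually.of_forall fun t => average_mono (fun τ => ?_) t)
    h1.isBoundedUnder_ge
    (isBoundedUnder_of ⟨R, fun t => (hmem t).2⟩ :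
      IsBoundedUnder (· ≤ ·) atTop _).isCoboundedUnder_ge
  have := h τ
  linarith

/-- No policy achieves more than the utility of full admission. -/
lemma optUtility_le (net : EHNetwork Node Link Ch En) : net.optUtility ≤ net.maxUtility := by
  refine Real.sSup_le ?_ net.maxUtility_nonneg
  rintro u ⟨Ω, mΩ, ℙ, ℱ, S, H, Q, E, a, hℙ, -, hpol, rfl⟩
  refine net.Utot_le_maxUtility fun n c => ?_
  refine liminf_mem_Icc fun t => mem_Icc_average net.Rmax_nonneg (fun τ => ?_) t
  have hmem : ∀ ω, (a τ ω).adm n c ∈ Icc 0 net.Rmax := fun ω => (hpol.admissible τ ω).adm_mem n c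
  refine ⟨integral_nonneg fun ω => (hmem ω).1, ?_⟩
  refine (integral_mono_of_nonneg (ae_of_all _ fun ω => (hmem ω).1) (integrable_const net.Rmax)
    (ae_of_all _ fun ω => (hmem ω).2)).trans (le_of_eq ?_)
  simp

end EHNetwork

/-! ### Performance of Phase II -/

namespace EHNetwork

variable {Node Link Ch En : Type*} [Fintype Node] [DecidableEq Node] [Fintype Link]
  [DecidableEq Link] [Fintype Ch] [DecidableEq Ch] [Fintype En] [DecidableEq En]
  {net : EHNetwork Node Link Ch En}
  {Ω : Type*} {mΩ : MeasurableSpace Ω} {ℙ : Measure Ω} [IsProbabilityMeasure ℙ]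

lemma condExp_le_affine {m : MeasurableSpace Ω} (hm : m ≤ mΩ) {X Y : Ω → ℝ}
    (hX : Integrable X ℙ) (hY : Integrable Y ℙ) {α b y : ℝ} (hα : 0 ≤ α)
    (h : ∀ ω, X ω ≤ α * Y ω + b) (hy : ℙ[Y | m] ≤ᵐ[ℙ] fun _ => y) :
    ℙ[X | m] ≤ᵐ[ℙ] fun _ => α * y + b := by
  have h1 : ℙ[X | m] ≤ᵐ[ℙ] ℙ[α • Y + fun _ => b | m] :=
    condExp_mono hX ((hY.smul α).add (integrable_const _)) (ae_of_all _ h)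
  have h2 : ℙ[α • Y + fun _ => b | m] =ᵐ[ℙ] ℙ[α • Y | m] + ℙ[fun _ => b | m] :=
    condExp_add (hY.smul α) (integrable_const _) _
  have h3 : ℙ[α • Y | m] =ᵐ[ℙ] α • ℙ[Y | m] := condExp_smul α _ _
  filter_upwards [h1, h2, h3, hy] with ω e1 e2 e3 e4
  refine e1.trans ?_
  rw [e2, Pi.add_apply, e3, Pi.smul_apply, condExp_const hm, smul_eq_mul]
  have := mul_le_mul_of_nonneg_left e4 hα
  linarith

variable {ℱ : Filtration ℕ mΩ}
  {S : ℕ → Ω → Ch} {H : ℕ → Ω → En} {V : ℝ} {θ : Node → ℝ} {T : ℕ}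
  {Q₁ : ℕ → Ω → Node → Node → ℝ} {E₁ : ℕ → Ω → Node → ℝ} {a₁ : ℕ → Ω → SlotAction Node Link}
  {Q₀ : Ω → Node → Node → ℝ} {E₀ : Ω → Node → ℝ}
  {Qhat : ℕ → Ω → Node → Node → ℝ} {Ehat : ℕ → Ω → Node → ℝ} {a : ℕ → Ω → SlotAction Node Link}
  {Q : ℕ → Ω → Node → Node → ℝ} {E : ℕ → Ω → Node → ℝ}

lemma norm_le_exp {κ x : ℝ} (hκ : 0 < κ) : x ≤ 1 / κ * Real.exp (κ * x) := by
  rw [one_div, ← div_eq_inv_mul, le_div_iff₀ hκ]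
  linarith [Real.add_one_le_exp (κ * x)]

section Moments

variable {κ ρ C₀ B : ℝ}

lemma IsPhaseTwo.limsup_data_le [Nonempty Node]
    (h : net.IsPhaseTwo V θ ℱ S H T Q₁ E₁ Q₀ E₀ Qhat Ehat a Q E) (hκ : 0 < κ) (hρ : 0 ≤ ρ)
    (hρ1 : ρ < 1)
    (hint : ∀ t, Integrable (fun ω => Real.exp (κ * ‖queuePoint θ (Qhat t ω) (Ehat t ω)‖)) ℙ)
    (hmom : ∀ t, ℙ[fun ω => Real.exp (κ * ‖queuePoint θ (Qhat t ω) (Ehat t ω)‖) | ℱ T]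
      ≤ᵐ[ℙ] fun _ => ρ ^ t * C₀ + B) :
    ∀ᵐ ω ∂ℙ, condLimsupAvg ℙ (ℱ T) (fun t ω => ∑ n, ∑ c, Q t ω n c) ω
      ≤ (((Fintype.card Node : ℝ) ^ 2 * (B / κ + net.totalRate) : ℝ) : EReal) := by
  set N : ℝ := (Fintype.card Node : ℝ) ^ 2 with hN
  have hle : ∀ t ω, ∑ n, ∑ c, Q t ω n c
      ≤ N * (1 / κ) * Real.exp (κ * ‖queuePoint θ (Qhat t ω) (Ehat t ω)‖)
        + N * net.totalRate := by
    intro t ω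
    have h1 : ∀ n c, Q t ω n c
        ≤ 1 / κ * Real.exp (κ * ‖queuePoint θ (Qhat t ω) (Ehat t ω)‖) + net.totalRate := by
      intro n c
      refine (h.data_le t ω n c).trans (add_le_add ?_ le_rfl)
      refine le_trans (max_le ?_ (norm_nonneg _)) (norm_le_exp hκ)
      have h2 := (le_abs_self _).trans (abs_fst_le (queuePoint θ (Qhat t ω) (Ehat t ω)) n c)
      have h3 : 0 ≤ Q₀ ω n c := by
        rw [h.Q₀_eq]
        exact le_max_right _ _
      simp only [queuePoint] at h2 ⊢
      linarith
    refine (Finset.sum_le_sum fun n _ => Finset.sum_le_sum fun c _ => h1 n c).trans (le_of_eq ?_)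
    simp only [Finset.sum_const, Finset.card_univ, nsmul_eq_mul, hN]
    ring
  have hXint : ∀ t, Integrable (fun ω => ∑ n, ∑ c, Q t ω n c) ℙ := fun t => by
    refine (((hint t).const_mul (N * (1 / κ))).add (integrable_const (N * net.totalRate))).mono' ?_
      (ae_of_all _ fun ω => ?_)
    · exact (Finset.measurable_sum _ fun n _ => Finset.measurable_sum _ fun c _ =>
        (h.Q_meas t n c).mono (ℱ.le _) le_rfl).aestronglyMeasurable
    · rw [Real.norm_of_nonneg (Finset.sum_nonneg fun n _ => Finset.sum_nonneg fun c _ =>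
        h.Q_nonneg t ω n c)]
      exact hle t ω
  have hae := ae_all_iff.2 fun t => condExp_le_affine (ℱ.le T) (hXint t) (hint t)
    (by positivity : 0 ≤ N * (1 / κ)) (hle t) (hmom t)
  filter_upwards [hae] with ω hω
  refine limsup_average_le (K := N * (1 / κ) * C₀) hρ hρ1 fun t => (hω t).trans (le_of_eq ?_)
  ring

lemma IsPhaseTwo.le_condAvgRate
    (h : net.IsPhaseTwo V θ ℱ S H T Q₁ E₁ Q₀ E₀ Qhat Ehat a Q E) (hV : 0 < V) (hκ : 0 < κ)
    (hρ : 0 ≤ ρ) (hρ1 : ρ < 1) {m : ℝ} (hm : 0 < m)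
    (hslope : ∀ n c, ∀ r ∈ Icc 0 net.Rmax,
      m * (net.Rmax - r) ≤ net.U n c net.Rmax - net.U n c r)
    (hint : ∀ t, Integrable (fun ω => Real.exp (κ * ‖queuePoint θ (Qhat t ω) (Ehat t ω)‖)) ℙ)
    (hmom : ∀ t, ℙ[fun ω => Real.exp (κ * ‖queuePoint θ (Qhat t ω) (Ehat t ω)‖) | ℱ T]
      ≤ᵐ[ℙ] fun _ => ρ ^ t * C₀ + B) :
    ∀ᵐ ω ∂ℙ, ∀ n c, condAvgRate ℙ (ℱ T) a ω n c ∈ Icc 0 net.Rmax ∧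
      net.Rmax - net.Rmax / (κ * m * V) * B ≤ condAvgRate ℙ (ℱ T) a ω n c := by
  have hR := net.Rmax_nonneg
  have hadm : ∀ t ω n c, (a t ω).adm n c ∈ Icc 0 net.Rmax := fun t ω => (h.run.action t ω).adm_mem
  have hmV : 0 < m * V := by positivity
  have hle : ∀ t ω n c, -(a t ω).adm n c
      ≤ net.Rmax / (κ * m * V) * Real.exp (κ * ‖queuePoint θ (Qhat t ω) (Ehat t ω)‖)
        + -net.Rmax := by
    intro t ω n c
    have hpos : 0 ≤ net.Rmax / (κ * m * V)
        * Real.exp (κ * ‖queuePoint θ (Qhat t ω) (Ehat t ω)‖) := by positivity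
    rcases lt_or_ge (Qhat t ω n c) (m * V) with hlt | hge
    · rw [(h.run.action t ω).adm_eq_Rmax hV.le (hslope n c) hlt]
      linarith
    · -- a long virtual queue is far from the origin
      have h1 := (le_abs_self _).trans (abs_fst_le (queuePoint θ (Qhat t ω) (Ehat t ω)) n c)
      have h2 := norm_le_exp (x := ‖queuePoint θ (Qhat t ω) (Ehat t ω)‖) hκ
      have h3 : 1 ≤ 1 / (κ * m * V) * Real.exp (κ * ‖queuePoint θ (Qhat t ω) (Ehat t ω)‖) := by
        have e : 1 / (κ * m * V) * Real.exp (κ * ‖queuePoint θ (Qhat t ω) (Ehat t ω)‖)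
            = 1 / κ * Real.exp (κ * ‖queuePoint θ (Qhat t ω) (Ehat t ω)‖) / (m * V) := by
          field_simp
        rw [e, one_le_div hmV]
        exact hge.trans (h1.trans h2)
      have h4 := mul_le_mul_of_nonneg_left h3 hR
      have h5 := (hadm t ω n c).1
      rw [mul_one, ← mul_assoc, mul_one_div] at h4
      linarith
  have hXint : ∀ t n c, Integrable (fun ω => (a t ω).adm n c) ℙ := fun t n c =>
    Integrable.of_bound ((h.run.adapted.adm_meas t n c).mono (ℱ.le _) le_rfl).aestronglyMeasurable
      net.Rmax (ae_of_all _ fun ω => by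
        rw [Real.norm_of_nonneg (hadm t ω n c).1]
        exact (hadm t ω n c).2)
  have hae : ∀ᵐ ω ∂ℙ, ∀ t n c, ℙ[fun ω => (a t ω).adm n c | ℱ T] ω ∈ Icc 0 net.Rmax ∧
      net.Rmax - (ρ ^ t * (net.Rmax / (κ * m * V) * C₀) + net.Rmax / (κ * m * V) * B)
        ≤ ℙ[fun ω => (a t ω).adm n c | ℱ T] ω := by
    refine ae_all_iff.2 fun t => ae_all_iff.2 fun n => ae_all_iff.2 fun c => ?_
    have h1 : 0 ≤ᵐ[ℙ] ℙ[fun ω => (a t ω).adm n c | ℱ T] :=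
      condExp_nonneg (ae_of_all _ fun ω => (hadm t ω n c).1)
    have h2 : ℙ[fun ω => (a t ω).adm n c | ℱ T] ≤ᵐ[ℙ] ℙ[fun _ => net.Rmax | ℱ T] :=
      condExp_mono (hXint t n c) (integrable_const _) (ae_of_all _ fun ω => (hadm t ω n c).2)
    have h3 := condExp_le_affine (ℱ.le T) (hXint t n c).neg (hint t)
      (by positivity : 0 ≤ net.Rmax / (κ * m * V)) (fun ω => hle t ω n c) (hmom t)
    have h4 : ℙ[-fun ω => (a t ω).adm n c | ℱ T] =ᵐ[ℙ] -ℙ[fun ω => (a t ω).adm n c | ℱ T] :=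
      condExp_neg _ _
    filter_upwards [h1, h2, h3, h4] with ω e1 e2 e3 e4
    rw [condExp_const (ℱ.le T)] at e2
    rw [e4, Pi.neg_apply] at e3
    exact ⟨⟨e1, e2⟩, by linarith⟩
  filter_upwards [hae] with ω hω n c
  exact ⟨liminf_mem_Icc fun t => mem_Icc_average hR (fun τ => (hω τ n c).1) t,
    le_liminf_average hR (fun t => (hω t n c).1) hρ hρ1 fun t => (hω t n c).2⟩

lemma IsPhaseTwo.limsup_dropped_le [Nonempty Node]
    (h : net.IsPhaseTwo V θ ℱ S H T Q₁ E₁ Q₀ E₀ Qhat Ehat a Q E) (hκ : 0 < κ) (hρ : 0 ≤ ρ)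
    (hρ1 : ρ < 1) (hθ : ∀ n, storage V ≤ θ n) (hP : 4 * net.Pmax ≤ storage V)
    (hrange : ∀ t ω, net.QueueRange V (Qhat t ω))
    (hQ₁ : ∀ n c, Measurable[ℱ T] fun ω => Q₁ T ω n c)
    (hE₁ : ∀ n, Measurable[ℱ T] fun ω => E₁ T ω n)
    (hint : ∀ t, Integrable (fun ω => Real.exp (κ * ‖queuePoint θ (Qhat t ω) (Ehat t ω)‖)) ℙ)
    (hmom : ∀ t, ℙ[fun ω => Real.exp (κ * ‖queuePoint θ (Qhat t ω) (Ehat t ω)‖) | ℱ T]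
      ≤ᵐ[ℙ] fun _ => ρ ^ t * C₀ + B) :
    ∀ᵐ ω ∂ℙ, ‖queuePoint θ (Q₁ T ω) (E₁ T ω)‖ ≤ storage V / 8 →
      condLimsupAvg ℙ (ℱ T) (fun t ω =>
        net.dropped (storage V) (Q₀ ω) (E₀ ω) (Qhat t ω) (Ehat t ω) (a t ω)) ω
      ≤ ((net.dropBound * Real.exp (-(κ * (storage V / 8))) * B : ℝ) : EReal) := by
  set G : Set Ω := {ω | ‖queuePoint θ (Q₁ T ω) (E₁ T ω)‖ ≤ storage V / 8} with hG
  set X : ℕ → Ω → ℝ := fun t ω =>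
    net.dropped (storage V) (Q₀ ω) (E₀ ω) (Qhat t ω) (Ehat t ω) (a t ω) with hX
  set α : ℝ := net.dropBound * Real.exp (-(κ * (storage V / 8))) with hα
  have hα0 : 0 ≤ α := mul_nonneg dropBound_nonneg (Real.exp_pos _).le
  have hGmeas : MeasurableSet[ℱ T] G := by
    have h1 : Measurable[ℱ T] fun ω => queuePoint θ (Q₁ T ω) (E₁ T ω) :=
      measurable_queuePoint (m := ℱ T) θ hQ₁ hE₁
    exact (measurable_norm.comp h1) measurableSet_Iic
  have hXmem : ∀ t ω, X t ω ∈ Icc 0 net.dropBound := fun t ω =>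
    (h.run.action t ω).admissible.dropped_mem
  have hXint : ∀ t, Integrable (X t) ℙ := fun t =>
    Integrable.of_bound (h.measurable_dropped (fun n c => (hQ₁ n c).mono (ℱ.le _) le_rfl)
      (fun n => (hE₁ n).mono (ℱ.le _) le_rfl) t).aestronglyMeasurable net.dropBound
      (ae_of_all _ fun ω => by
        rw [Real.norm_of_nonneg (hXmem t ω).1]
        exact (hXmem t ω).2)
  have hle : ∀ t ω, G.indicator (X t) ω
      ≤ α * Real.exp (κ * ‖queuePoint θ (Qhat t ω) (Ehat t ω)‖) + 0 := by
    intro t ω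
    have hpos : 0 ≤ α * Real.exp (κ * ‖queuePoint θ (Qhat t ω) (Ehat t ω)‖) :=
      mul_nonneg hα0 (Real.exp_pos _).le
    rw [add_zero]
    by_cases hω : ω ∈ G
    · rw [indicator_of_mem hω]
      rcases le_or_gt ‖queuePoint θ (Qhat t ω) (Ehat t ω)‖ (storage V / 8) with hnear | hfar
      · rw [hX]
        simp only
        rwa [h.dropped_eq_zero hθ hP hω hnear (hrange t ω)]
      · refine (hXmem t ω).2.trans ?_
        rw [hα, mul_assoc, ← Real.exp_add]
        refine le_mul_of_one_le_right dropBound_nonneg (Real.one_le_exp ?_)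
        have := mul_le_mul_of_nonneg_left hfar.le hκ.le
        linarith
    · rwa [indicator_of_notMem hω]
  have hae := ae_all_iff.2 fun t => condExp_le_affine (ℱ.le T)
    ((hXint t).indicator (ℱ.le T _ hGmeas)) (hint t) hα0 (hle t) (hmom t)
  have hae' := ae_all_iff.2 fun t => condExp_indicator (hXint t) hGmeas
  filter_upwards [hae, hae'] with ω h1 h2 hω
  refine limsup_average_le (K := α * C₀) hρ hρ1 fun t => ?_
  have h3 := h1 t
  rw [h2 t, indicator_of_mem (show ω ∈ G from hω)] at h3
  linarith

end Moments

lemma InitRange.queueRange {Q : Node → Node → ℝ} {E : Node → ℝ} (h : net.InitRange V θ Q E) :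
    net.QueueRange V Q := ⟨h.Q_mem, h.Q_dest⟩

lemma InitRange.norm_le [Nonempty Node] {Q : Node → Node → ℝ} {E : Node → ℝ}
    (h : net.InitRange V θ Q E) (hV : 0 ≤ V) :
    ‖queuePoint θ Q E‖ ≤ net.β * V + net.Rmax + net.hmax + ∑ n, |θ n| := by
  have h1 := mul_nonneg net.β_pos.le hV
  have h2 := net.Rmax_nonneg
  have h3 := net.hmax_nonneg
  have h4 : 0 ≤ ∑ n, |θ n| := Finset.sum_nonneg fun n _ => abs_nonneg _
  refine norm_le_of_abs_le (by positivity) (fun n c => ?_) (fun n => ?_)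
  · have := h.Q_mem n c
    change |Q n c| ≤ _
    rw [abs_of_nonneg this.1]
    linarith [this.2]
  · have h5 := h.E_mem n
    have h6 := Finset.single_le_sum (f := fun n => |θ n|) (fun n _ => abs_nonneg _)
      (Finset.mem_univ n)
    have h7 := le_abs_self (θ n)
    change |θ n - E n| ≤ _
    rw [abs_le]
    constructor <;> linarith [h5.1, h5.2]

/-- Eventually in `V`, the storage size is between constants and the scale `δ β V` of `θ`. -/
lemma eventually_storage (net : EHNetwork Node Link Ch En) [Nonempty Node] (x : ℝ) :
    ∀ᶠ V : ℝ in atTop, 1 ≤ V ∧ 1 ≤ Real.log V ∧ x ≤ Real.log V ∧ 4 * net.Pmax ≤ storage V ∧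
      storage V ≤ net.δ * net.β * V := by
  have hδβ : 0 < net.δ * net.β := mul_pos net.δ_pos net.β_pos
  have hlog := Real.tendsto_log_atTop
  have hsmall := (Real.isLittleO_pow_log_id_atTop (n := 2)).bound
    (show 0 < net.δ * net.β / 4 by positivity)
  filter_upwards [eventually_ge_atTop 1, hlog.eventually_ge_atTop 1, hlog.eventually_ge_atTop x,
    hlog.eventually_ge_atTop net.Pmax, hsmall] with V h1 h2 h3 h4 h5
  refine ⟨h1, h2, h3, ?_, ?_⟩
  · rw [storage]
    nlinarith
  · rw [id, Real.norm_of_nonneg (by positivity), Real.norm_of_nonneg (by linarith)] at h5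
    rw [storage]
    linarith

end EHNetwork

theorem theorem5
    {Node Link Ch En : Type*}
    [Fintype Node] [DecidableEq Node] [Nonempty Node] [Fintype Link] [DecidableEq Link]
    [Fintype Ch] [DecidableEq Ch] [Fintype En] [DecidableEq En]
    (net : EHNetwork Node Link Ch En)
    (υs : ℝ → Node → Node → ℝ) (νs : ℝ → Node → ℝ)
    (hopt : ∀ V, 1 ≤ V → net.IsDualOptimal V (υs V) (νs V))
    (huniq : ∀ V, 1 ≤ V → ∀ υ ν, net.IsDualOptimal V υ ν → υ = υs V ∧ ν = νs V)
    (L : ℝ) (hL : 0 < L)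
    (hpoly : ∀ V, 1 ≤ V → ∀ (υ : Node → Node → ℝ) (ν : Node → ℝ), EHNetwork.DualFeasible υ →
      net.dual V (υs V) (νs V) + L * EHNetwork.dualDist (υs V) (νs V) υ ν ≤ net.dual V υ ν) :
    ∃ C V₀ : ℝ, 0 < C ∧ 1 ≤ V₀ ∧ ∀ V, V₀ ≤ V →
      ∀ θ : Node → ℝ, (∀ n, net.δ * net.β * V + net.Pmax ≤ θ n) → (∀ n, 0 < θ n - νs V n) →
      ∀ (Ω : Type*) (mΩ : MeasurableSpace Ω) (ℙ : Measure Ω) (_ : IsProbabilityMeasure ℙ)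
        (ℱ : Filtration ℕ mΩ) (S : ℕ → Ω → Ch) (H : ℕ → Ω → En) (_ : net.IsEnv ℙ ℱ S H)
        (T : ℕ)
        (Q₁ : ℕ → Ω → Node → Node → ℝ) (E₁ : ℕ → Ω → Node → ℝ) (a₁ : ℕ → Ω → SlotAction Node Link)
        (_ : net.IsPhaseOne V θ ℙ ℱ S H T Q₁ E₁ a₁)
        (Q₀ : Ω → Node → Node → ℝ) (E₀ : Ω → Node → ℝ)
        (Qhat : ℕ → Ω → Node → Node → ℝ) (Ehat : ℕ → Ω → Node → ℝ)
        (a : ℕ → Ω → SlotAction Node Link)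
        (Q : ℕ → Ω → Node → Node → ℝ) (E : ℕ → Ω → Node → ℝ)
        (_ : net.IsPhaseTwo V θ ℱ S H T Q₁ E₁ Q₀ E₀ Qhat Ehat a Q E),
        (∀ t ω n, 0 ≤ E t ω n ∧ E t ω n ≤ EHNetwork.storage V ∧
          (net.InWindow (EHNetwork.storage V) (E₀ ω) (Ehat t ω) n →
            net.spent (a t ω).pow n ≤ E t ω n)) ∧
        1 - C / V ^ 4 ≤ ℙ.real {ω |
          EHNetwork.condLimsupAvg ℙ (ℱ T) (fun t ω => ∑ n, ∑ c, Q t ω n c) ω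
              ≤ ((C * Real.log V ^ 2 : ℝ) : EReal) ∧
          net.optUtility - C / V ≤ net.Utot (EHNetwork.condAvgRate ℙ (ℱ T) a ω) ∧
          EHNetwork.condLimsupAvg ℙ (ℱ T)
              (fun t ω => net.dropped (EHNetwork.storage V) (Q₀ ω) (E₀ ω) (Qhat t ω) (Ehat t ω)
                (a t ω)) ω
              ≤ ((C / V : ℝ) : EReal)} := by
  obtain ⟨κ, ρ, B₁, hκ, hρ, hρ1, hB₁, hlyap⟩ := net.exists_lyapunov hL
  obtain ⟨m, hm, hslope⟩ := net.exists_slope_ge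
  obtain ⟨V₀, hV₀⟩ := eventually_atTop.1 (net.eventually_storage (8 / κ))
  set B : ℝ := B₁ / (1 - ρ) with hB
  have hB0 : 0 ≤ B := div_nonneg hB₁ (by linarith)
  set N : ℝ := (Fintype.card Node : ℝ) ^ 2 with hN
  set C₁ : ℝ := N * (B / κ + net.totalRate) with hC₁
  set C₂ : ℝ := N * (net.β * (net.Rmax / (κ * m) * B)) with hC₂
  set C₃ : ℝ := net.dropBound * B with hC₃
  have hC₁0 : 0 ≤ C₁ := by
    have := net.totalRate_nonneg
    positivity
  have hC₂0 : 0 ≤ C₂ := by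
    have := net.Rmax_nonneg
    have := net.β_pos
    positivity
  have hC₃0 : 0 ≤ C₃ := mul_nonneg EHNetwork.dropBound_nonneg hB0
  refine ⟨1 + B + C₁ + C₂ + C₃, max V₀ 1, by positivity, le_max_right _ _, ?_⟩
  set C : ℝ := 1 + B + C₁ + C₂ + C₃ with hC
  intro V hVV θ hθ _ Ω mΩ ℙ hℙ ℱ S H hEnv T Q₁ E₁ a₁ hI Q₀ E₀ Qhat Ehat a Q E hII
  obtain ⟨hV1, hlog1, hlogκ, hPM, hMθ⟩ := hV₀ V ((le_max_left _ _).trans hVV)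
  have hV : 0 < V := by linarith
  refine ⟨fun t ω n => ⟨(hII.energy_mem t ω n).1, (hII.energy_mem t ω n).2, hII.spent_le t ω n⟩, ?_⟩
  obtain ⟨Λ, hΛc, hΛ, hdrift⟩ := hlyap V hV.le fun υ ν hυ =>
    net.dual_ge hV hL (hopt V hV1).1 (hpoly V hV1) hυ
  -- Phase I
  have hr₁ := hI.run.queueRange hV.le fun ω => (hI.init ω).queueRange
  have hK₁ := hI.run.norm_le hV.le (fun ω => (hI.init ω).queueRange)
    (fun ω => (hI.init ω).norm_le hV.le)
  obtain ⟨D₁, hmom₁⟩ := hI.run.condExp_exp_le hEnv hV.le (fun ω => (hI.init ω).queueRange)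
    (fun ω => (hI.init ω).norm_le hV.le) hρ hρ1 hB₁ hΛc hΛ (hdrift θ hθ)
  have hsteady := hI.integral_exp_le hρ hρ1 hmom₁
  -- Phase II
  have hr₂ := fun ω => hII.queueRange_zero (hr₁ T ω)
  have hE₁0 : ∀ ω n, 0 ≤ E₁ T ω n := fun ω n =>
    ((hI.run.action T ω).admissible.spent_nonneg n).trans
      ((hI.run.action T ω).energy_available n)
  have hK₂ := fun ω => hII.norm_zero_le (fun n c => ((hr₁ T ω).1 n c).1) (hE₁0 ω) (hK₁ T ω)
  obtain ⟨D₂, hmom₂⟩ := hII.run.condExp_exp_le hEnv hV.le hr₂ hK₂ hρ hρ1 hB₁ hΛc hΛ (hdrift θ hθ)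
  have hint₁ := hI.run.integrable_exp (ℙ := ℙ) (κ := κ) hκ.le hV.le
    (fun ω => (hI.init ω).queueRange) (fun ω => (hI.init ω).norm_le hV.le)
  have hint₂ := hII.run.integrable_exp (ℙ := ℙ) (κ := κ) hκ.le hV.le hr₂ hK₂
  have hmQ : ∀ n c, Measurable[ℱ T] fun ω => Q₁ T ω n c := fun n c => by
    have := hI.run.adapted.Q_meas T n c
    rwa [zero_add] at this
  have hmE : ∀ n, Measurable[ℱ T] fun ω => E₁ T ω n := fun n => by
    have := hI.run.adapted.E_meas T n
    rwa [zero_add] at this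
  set M : ℝ := EHNetwork.storage V with hM
  have hMθ' : ∀ n, M ≤ θ n := fun n => by
    have := hθ n
    have := net.Pmax_nonneg
    linarith
  have hdata := hII.limsup_data_le hκ hρ hρ1 hint₂ hmom₂
  have hrate := hII.le_condAvgRate hV hκ hρ hρ1 hm hslope hint₂ hmom₂
  have hdrop := hII.limsup_dropped_le hκ hρ hρ1 hMθ' hPM
    (hII.run.queueRange hV.le hr₂) hmQ hmE hint₂ hmom₂
  -- the exponent `κ M / 8 = κ (log V)² / 2` is at least `4 log V`
  have hexp : V ^ 4 ≤ Real.exp (κ * (M / 8)) := by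
    have h1 : 8 ≤ κ * Real.log V := by
      rw [div_le_iff₀ hκ] at hlogκ
      linarith
    have h2 : 4 * Real.log V ≤ κ * (M / 8) := by
      rw [hM, EHNetwork.storage]
      have := mul_le_mul_of_nonneg_right h1 (by linarith : 0 ≤ Real.log V)
      linarith
    calc V ^ 4 = Real.exp (4 * Real.log V) := by
          rw [show (4 : ℝ) * Real.log V = ((4 : ℕ) : ℝ) * Real.log V by norm_num,
            Real.exp_nat_mul, Real.exp_log hV]
      _ ≤ _ := Real.exp_le_exp.2 h2
  have hV4 : V ≤ V ^ 4 := le_self_pow₀ hV1 (by norm_num)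
  have hV4pos : 0 < V ^ 4 := by positivity
  set G : Set Ω := {ω | ‖EHNetwork.queuePoint θ (Q₁ T ω) (E₁ T ω)‖ ≤ M / 8} with hG
  have hGprob : 1 - C / V ^ 4 ≤ ℙ.real G := by
    have hmeas : MeasurableSet G := measurableSet_le
      (measurable_norm.comp (hI.run.measurable_point T)) measurable_const
    have h1 := mul_meas_ge_le_integral_of_nonneg (ae_of_all ℙ fun ω => (Real.exp_pos
      (κ * ‖EHNetwork.queuePoint θ (Q₁ T ω) (E₁ T ω)‖)).le) (hint₁ T) (Real.exp (κ * (M / 8)))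
    have h2 : ℙ.real Gᶜ ≤ ℙ.real {ω | Real.exp (κ * (M / 8))
        ≤ Real.exp (κ * ‖EHNetwork.queuePoint θ (Q₁ T ω) (E₁ T ω)‖)} := by
      refine measureReal_mono fun ω hω => ?_
      have hω' : M / 8 < ‖EHNetwork.queuePoint θ (Q₁ T ω) (E₁ T ω)‖ := not_le.1 hω
      exact Real.exp_le_exp.2 (mul_le_mul_of_nonneg_left hω'.le hκ.le)
    have h3 : V ^ 4 * ℙ.real Gᶜ ≤ B :=
      (mul_le_mul hexp h2 measureReal_nonneg (Real.exp_pos _).le).trans (h1.trans hsteady)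
    have h4 : ℙ.real Gᶜ ≤ C / V ^ 4 := by
      rw [le_div_iff₀ hV4pos]
      linarith
    rw [probReal_compl_eq_one_sub hmeas] at h4
    linarith
  refine hGprob.trans (ENNReal.toReal_mono (measure_ne_top _ _) (measure_mono_ae ?_))
  filter_upwards [hdata, hrate, hdrop] with ω h1 h2 h3 hω
  refine ⟨h1.trans (EReal.coe_le_coe_iff.2 ?_), ?_, (h3 hω).trans (EReal.coe_le_coe_iff.2 ?_)⟩
  · have h4 : 1 ≤ Real.log V ^ 2 := one_le_pow₀ hlog1
    have h5 : C₁ ≤ C := by linarith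
    calc C₁ ≤ C₁ * Real.log V ^ 2 := le_mul_of_one_le_right hC₁0 h4
      _ ≤ C * Real.log V ^ 2 := mul_le_mul_of_nonneg_right h5 (by positivity)
  · have h4 := net.maxUtility_sub_le (fun n c => (h2 n c).1) (fun n c => (h2 n c).2)
    have h5 := EHNetwork.optUtility_le net
    have h6 : N * (net.β * (net.Rmax / (κ * m * V) * B)) = C₂ / V := by
      rw [hC₂]
      field_simp
    have h7 : C₂ / V ≤ C / V := div_le_div_of_nonneg_right (by linarith) hV.le
    rw [← hN, h6] at h4
    linarith
  · have h4 : Real.exp (-(κ * (M / 8))) ≤ 1 / V := by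
      rw [Real.exp_neg, ← one_div]
      exact one_div_le_one_div_of_le hV (hV4.trans hexp)
    calc net.dropBound * Real.exp (-(κ * (M / 8))) * B
        = C₃ * Real.exp (-(κ * (M / 8))) := by rw [hC₃]; ring
      _ ≤ C₃ * (1 / V) := mul_le_mul_of_nonneg_left h4 hC₃0
      _ = C₃ / V := by rw [mul_one_div]
      _ ≤ C / V := div_le_div_of_nonneg_right (by linarith) hV.le
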